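/- **Setting.** Let $\mathbb F_q$ be a finite field with $q$ elements, $K_\infty=\mathbb F_q((1/\theta))$ with the absolute value normalised by $|\theta|=q$, and $\mathbb C_\infty$ the completion of an algebraic closure of $K_\infty$. For $i\in\mathbb Z$ the twist $(\cdot)^{(i)}$ raises elements of $\mathbb C_\infty$ to the power $q^i$, and acts on matrices entrywise and on polynomials and power series in $t$ coefficientwise. In $\mathrm{Mat}_d(\mathbb C_\infty)[[\tau]]$ one has $\tau M=M^{(1)}\tau$. Let $\mathbb T$ be the ring of power series $\sum a_it^i$ over $\mathbb C_\infty$ with $|a_i|\to 0$, with the norm $\max_i|a_i|$; the norm of a row vector is the maximum of the norms of its entries. For a $t$-module $\psi_\theta=d[\theta]+A_1\tau+\dots+A_\ell\tau^\ell$ of dimension $d$ ($d[\theta]-\theta\,\mathrm{Id}_d$ nilpotent), $\mathrm{Exp}_\psi\in\mathrm{Mat}_d(\mathbb C_\infty)[[\tau]]$ is the unique series with constant term $\mathrm{Id}_d$ and $\mathrm{Exp}_\psi\, d[\theta]=\psi_\theta\,\mathrm{Exp}_\psi$, and $\mathrm{Log}_\psi=\sum_n P_n\tau^n$ is its inverse.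 The domain of convergence of $\mathrm{Log}_\psi$ is the set of $\mathbf z\in\mathbb C_\infty^d$ for which $\mathrm{Log}_\psi(\mathbf z):=\sum_nP_n\mathbf z^{(n)}$ converges. For $d=1$ write $\exp_\psi$, $\log_\psi$. Let $r,k\ge 1$ and let $\phi_\theta=\theta+\kappa_1\tau+\dots+\kappa_r\tau^r$ be a Drinfeld module over $\mathbb C_\infty$ with $|\kappa_i|\le 1$ for $1\le i\le r-1$ and $\kappa_r\in\mathbb F_q^\times$. Let $\phi\otimes C^{\otimes k}$ be the $t$-module of dimension $rk+1$ given by $\rho_\theta=d[\theta]+A_1\tau$, where $d[\theta]$ has $\theta$ on the diagonal, $1$ in the places $(i,i+r)$ and $0$ elsewhere, the last row of $A_1$ is $(\kappa_1,\dots,\kappa_r,0,\dots,0)$, for $1\le m\le r-1$ the row $r(k-1)+1+m$ of $A_1$ is the $m$-th unit vector, and the other rows of $A_1$ are $0$. *Periods.* Let $\xi_1,\dots,\xi_r$ be an $\mathbb F_q$-basis of $\phi[\theta]=\{z\in\mathbb C_\infty:\theta z+\kappa_1z^q+\dots+\kappa_rz^{q^r}=0\}$ and let $\lambda_i=\theta\log_\phi(\xi_i)$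 be the corresponding fundamental periods of $\phi$. Let $f_j=\sum_{i\ge0}\exp_\phi(\lambda_j/\theta^{i+1})t^i$, let $\Upsilon=(f_j^{(i-1)})_{1\le i,j\le r}$, let $V$ be the $r\times r$ matrix with $V_{ij}=\kappa_{i+j-1}^{(1-j)}$ if $i+j-1\le r$ and $V_{ij}=0$ otherwise, and let $\Psi=V^{-1}((\Upsilon^{(1)})^{\mathrm{tr}})^{-1}$. Fix $\eta$ with $\eta^{q-1}=-\theta$ and put $$\omega_C=\eta\prod_{j\ge0}\Bigl(1-\frac{t}{\theta^{q^j}}\Bigr)^{-1},\qquad \tilde\pi=\theta\,\eta\prod_{j\ge1}\bigl(1-\theta^{1-q^j}\bigr)^{-1}.$$ For $1\le\ell\le r-1$ let $F_{\tau^\ell}:\mathbb C_\infty\to\mathbb C_\infty$ be the entire function whose power series has no linear term and which satisfies $F_{\tau^\ell}(\theta z)-\theta F_{\tau^\ell}(z)=\exp_\phi(z)^{q^\ell}$ for all $z$. *The map $\varphi_{\mathrm{tens}}$.* Let $\Theta$ be the $r\times r$ matrix with entries $1$ in the places $(i,i+1)$, last row $\bigl(\frac{t-\theta}{\kappa_r},-\frac{\kappa_1}{\kappa_r},\dots,-\frac{\kappa_{r-1}}{\kappa_r}\bigr)$,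 and $0$ elsewhere. For $n\ge0$ and $\ell=ru+j$ with $1\le j\le r$, $1\le \ell\le rk+1$, put $$R_{n,\ell}=\Bigl(\prod_{i=0}^{n-1}(t-\theta^{q^i})\Bigr)^{k}(t-\theta^{q^n})^{u}\;\mathfrak e_j^{\mathrm{tr}}\;\Theta^{(n-1)}\cdots\Theta^{(1)}\Theta\;\bigl((V^{(-1)})^{\mathrm{tr}}\bigr)^{-1}\in\mathrm{Mat}_{1\times r}(\mathbb C_\infty[t]).$$ Let $\mathfrak v_u=q^{\frac{q^{r-1}}{q^r-1}+u+\frac{k}{q-1}}$, let $\mathbb M_{\mathrm{tens}}$ be the space of tuples $a=\bigl(\sum_na_{n,\ell}\tau^n\bigr)_{1\le\ell\le rk+1}$ in $\mathbb C_\infty[[\tau]]^{rk+1}$ with $|a_{n,ru+j}|\,\mathfrak v_u^{q^n}\to0$ as $n\to\infty$ for each $ru+j$, normed by $|a|=\max|a_{n,ru+j}|\mathfrak v_u^{q^n}$, and let $\varphi_{\mathrm{tens}}(a)=\sum_{n,\ell}a_{n,\ell}R_{n,\ell}$. For $\mathbf z\in\mathbb C_\infty^{rk+1}$ let $\delta_{1,\mathbf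 z}(a)=\sum_n\sum_\ell a_{n,\ell}z_\ell^{q^n}$ whenever this series in $n$ converges. **Theorem.** The functions $F_{\tau^\ell}$ exist and are unique, and $\varphi_{\mathrm{tens}}$ is a well-defined, injective map $\mathbb M_{\mathrm{tens}}\to\mathrm{Mat}_{1\times r}(\mathbb T)$ with $\|\varphi_{\mathrm{tens}}(a)\|\le|a|$. Let $\mathcal M_{\mathrm{tens}}=\varphi_{\mathrm{tens}}^{-1}$ be its inverse, defined on the image of $\varphi_{\mathrm{tens}}$, and $\mathcal M_{\mathrm{tens},\mathbf z}=\delta_{1,\mathbf z}\circ\mathcal M_{\mathrm{tens}}$. Let $p_i$ denote the $i$-th coordinate (the $i$-th row, in the case of the series $\mathrm{Log}_{\phi\otimes C^{\otimes k}}$), and put $$\mathcal L_1=\frac{(-\tilde\pi)^k}{\omega_C^k(\theta-t)}\,(\lambda_1,\dots,\lambda_r)\,(\Psi^{\mathrm{tr}})^{(-1)},\qquad \mathcal L_j=\frac{(-\tilde\pi)^k}{\omega_C^k(t-\theta)}\,\bigl(F_{\tau^{r-j+1}}(\lambda_1),\dots,F_{\tau^{r-j+1}}(\lambda_r)\bigr)(\Psi^{\mathrm{tr}})^{(-1)}\quad(2\le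 j\le r).$$ Then for $1\le j\le r$ the vector $\mathcal L_j$ lies in the image of $\varphi_{\mathrm{tens}}$ and $$p_{rk+2-j}\bigl(\mathrm{Log}_{\phi\otimes C^{\otimes k}}\bigr)=\mathcal M_{\mathrm{tens}}(\mathcal L_j).$$ Moreover, for every $\mathbf z$ in the domain of convergence of $\mathrm{Log}_{\phi\otimes C^{\otimes k}}$ the series defining $\mathcal M_{\mathrm{tens},\mathbf z}(\mathcal L_j)$ converges and $$p_{rk+2-j}\bigl(\mathrm{Log}_{\phi\otimes C^{\otimes k}}(\mathbf z)\bigr)=\mathcal M_{\mathrm{tens},\mathbf z}(\mathcal L_j).$$ -/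

import Mathlib

open scoped NNReal WithZero

noncomputable section

namespace TModuleLog

section

variable (Fq : Type*) [Field Fq] [Fintype Fq]

/-! ### The fields `K_∞` and `C_∞` -/

open Classical in
/-- `K_∞ = F_q((1/θ))`, the completion of the rational function field `F_q(θ)` at the infinite
place. -/
abbrev KInfty : Type _ := RatFunc.CompletionAtInfty Fq

namespace KInfty

instance completeSpace : CompleteSpace (KInfty Fq) := by
  classical
  let _ := RatFunc.inftyValued Fq
  exact inferInstanceAs (CompleteSpace (UniformSpace.Completion (RatFunc Fq)))

theorem one_lt_card : (1 : ℝ≥0) < (Fintype.card Fq : ℝ≥0) := by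
  exact_mod_cast Fintype.one_lt_card

theorem v_X : (Valued.v (algebraMap (RatFunc Fq) (KInfty Fq) RatFunc.X) : ℤᵐ⁰)
    = WithZero.exp 1 := by
  classical
  let _ := RatFunc.inftyValued Fq
  have h : (Valued.v (algebraMap (RatFunc Fq) (KInfty Fq) RatFunc.X) : ℤᵐ⁰)
      = Valued.v (RatFunc.X : RatFunc Fq) := Valued.extensionValuation_apply_coe _
  rw [h]
  simp [RatFunc.inftyValued.def, RatFunc.inftyValuationDef, RatFunc.X_ne_zero]

/-- The absolute value of `K_∞` is normalised by `|θ| = q`. -/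
instance rankOne : (Valued.v : Valuation (KInfty Fq) ℤᵐ⁰).RankOne where
  hom' := (WithZeroMulInt.toNNReal (one_lt_card Fq).ne_zero).comp
    MonoidWithZeroHom.ValueGroup₀.embedding
  strictMono' := (WithZeroMulInt.toNNReal_strictMono (one_lt_card Fq)).comp
    MonoidWithZeroHom.ValueGroup₀.embedding_strictMono
  exists_val_nontrivial := ⟨algebraMap (RatFunc Fq) (KInfty Fq) RatFunc.X,
    by rw [v_X]; simp, by rw [v_X]; decide⟩

instance nontriviallyNormedField : NontriviallyNormedField (KInfty Fq) :=
  Valued.toNontriviallyNormedField _ ℤᵐ⁰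

instance isUltrametricDist : IsUltrametricDist (KInfty Fq) :=
  IsUltrametricDist.isUltrametricDist_of_forall_norm_add_le_max_norm
    (Valued.v : Valuation (KInfty Fq) ℤᵐ⁰).norm_add_le

theorem norm_X : ‖algebraMap (RatFunc Fq) (KInfty Fq) RatFunc.X‖ = Fintype.card Fq := by
  change ((WithZeroMulInt.toNNReal (one_lt_card Fq).ne_zero
    (MonoidWithZeroHom.ValueGroup₀.embedding
      ((Valued.v : Valuation (KInfty Fq) ℤᵐ⁰).restrict _)) : ℝ≥0) : ℝ) = _
  rw [Valuation.embedding_restrict, v_X, WithZeroMulInt.toNNReal_neg_apply _ (by simp)]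
  have h : WithZero.unzero (x := (WithZero.exp (1 : ℤ))) (by simp) = Multiplicative.ofAdd (1 : ℤ) :=
    WithZero.unzero_coe _
  rw [h]
  simp

end KInfty

/-- An algebraic closure of `K_∞`, with the unique extension of the absolute value. -/
abbrev KInftyAlg : Type _ := AlgebraicClosure (KInfty Fq)

namespace KInftyAlg

instance normedField : NormedField (KInftyAlg Fq) :=
  spectralNorm.normedField (KInfty Fq) (KInftyAlg Fq)

instance isUltrametricDist : IsUltrametricDist (KInftyAlg Fq) :=
  IsUltrametricDist.isUltrametricDist_of_forall_norm_add_le_max_norm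
    (isNonarchimedean_spectralNorm (K := KInfty Fq) (L := KInftyAlg Fq))

end KInftyAlg

/-- `C_∞`, the completion of an algebraic closure of `K_∞`. -/
abbrev CInfty : Type _ := UniformSpace.Completion (KInftyAlg Fq)

namespace CInfty

instance normedField : NormedField (CInfty Fq) := inferInstance

/-- The variable `θ` of `A = F_q[θ]`, as an element of `C_∞`. -/
def theta : CInfty Fq :=
  algebraMap (KInftyAlg Fq) (CInfty Fq) (algebraMap (KInfty Fq) (KInftyAlg Fq)
    (algebraMap (RatFunc Fq) (KInfty Fq) RatFunc.X))

theorem norm_theta : ‖theta Fq‖ = Fintype.card Fq := by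
  change ‖((algebraMap (KInfty Fq) (KInftyAlg Fq) (algebraMap (RatFunc Fq) (KInfty Fq) RatFunc.X) :
    KInftyAlg Fq) : CInfty Fq)‖ = _
  rw [UniformSpace.Completion.norm_coe]
  exact (spectralNorm_extends _).trans (KInfty.norm_X Fq)

instance isUltrametricDist : IsUltrametricDist (CInfty Fq) := by
  apply IsUltrametricDist.isUltrametricDist_of_forall_norm_add_le_max_norm
  intro x y
  induction x, y using UniformSpace.Completion.induction_on₂ with
  | hp => exact isClosed_le (by fun_prop) (by fun_prop)
  | ih a b =>
    rw [← UniformSpace.Completion.coe_add]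
    simp only [UniformSpace.Completion.norm_coe]
    exact IsUltrametricDist.norm_add_le_max a b

instance algebra : Algebra Fq (CInfty Fq) :=
  ((algebraMap (KInftyAlg Fq) (CInfty Fq)).comp ((algebraMap (KInfty Fq) (KInftyAlg Fq)).comp
    ((algebraMap (RatFunc Fq) (KInfty Fq)).comp RatFunc.C))).toAlgebra

theorem frobenius_bijective :
    Function.Bijective (FiniteField.frobeniusAlgHom Fq (CInfty Fq)) := by
  refine ⟨RingHom.injective _, ?_⟩
  have happ : ∀ x, FiniteField.frobeniusAlgHom Fq (CInfty Fq) x = x ^ Fintype.card Fq := fun x => rfl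
  have hq : Fintype.card Fq ≠ 0 := Fintype.card_ne_zero
  have hd : ∀ x y : CInfty Fq, dist (FiniteField.frobeniusAlgHom Fq (CInfty Fq) x)
      (FiniteField.frobeniusAlgHom Fq (CInfty Fq) y) = dist x y ^ Fintype.card Fq := by
    intro x y
    rw [dist_eq_norm, dist_eq_norm, ← map_sub, happ, norm_pow]
  have hu : IsUniformInducing (FiniteField.frobeniusAlgHom Fq (CInfty Fq)) := by
    rw [Metric.isUniformInducing_iff]
    constructor
    · refine uniformContinuous_addMonoidHom_of_continuous
        (f := (FiniteField.frobeniusAlgHom Fq (CInfty Fq)).toRingHom.toAddMonoidHom) ?_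
      exact continuous_pow (M := CInfty Fq) (Fintype.card Fq)
    · intro δ hδ
      refine ⟨δ ^ Fintype.card Fq, by positivity, fun {a b} h => ?_⟩
      rw [hd] at h
      exact lt_of_pow_lt_pow_left₀ _ hδ.le h
  have hc : IsClosed (Set.range (FiniteField.frobeniusAlgHom Fq (CInfty Fq))) :=
    hu.isComplete_range.isClosed
  intro y
  change y ∈ Set.range (FiniteField.frobeniusAlgHom Fq (CInfty Fq))
  induction y using UniformSpace.Completion.induction_on with
  | hp => exact hc
  | ih a =>
    obtain ⟨b, hb⟩ := IsAlgClosed.exists_pow_nat_eq a (Nat.pos_of_ne_zero hq)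
    exact ⟨(b : CInfty Fq), by
      rw [happ, ← hb]; exact (map_pow (algebraMap (KInftyAlg Fq) (CInfty Fq)) b _).symm⟩

/-- The automorphism `x ↦ x ^ q` of `C_∞`. -/
def frob : RingAut (CInfty Fq) :=
  RingEquiv.ofBijective (FiniteField.frobeniusAlgHom Fq (CInfty Fq)).toRingHom
    (frobenius_bijective Fq)

theorem frob_apply (x : CInfty Fq) : frob Fq x = x ^ Fintype.card Fq := rfl

end CInfty

/-- The `i`-th twist `x ↦ x ^ (q ^ i)` of `C_∞`, for any integer `i`. -/
def twist (i : ℤ) : CInfty Fq →+* CInfty Fq := ((CInfty.frob Fq ^ i : RingAut (CInfty Fq)) :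
  CInfty Fq ≃+* CInfty Fq).toRingHom

theorem twist_natCast (n : ℕ) (x : CInfty Fq) : twist Fq n x = x ^ Fintype.card Fq ^ n := by
  change (CInfty.frob Fq ^ (n : ℤ) : RingAut (CInfty Fq)) x = _
  rw [zpow_natCast]
  induction n generalizing x with
  | zero => simp
  | succ n ih => rw [pow_succ, RingAut.mul_apply, CInfty.frob_apply, ih, ← pow_mul, pow_succ,
      mul_comm]

theorem twist_zero : twist Fq 0 = RingHom.id _ := by
  ext x
  simpa using twist_natCast Fq 0 x

theorem twist_neg_twist (i : ℤ) (x : CInfty Fq) : twist Fq (-i) (twist Fq i x) = x := by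
  change (CInfty.frob Fq ^ (-i) * CInfty.frob Fq ^ i : RingAut (CInfty Fq)) x = x
  simp

/-! ### Anderson `t`-modules, exponential and logarithm -/

/-- An Anderson `t`-module of dimension `d` over `C_∞`, given by the coefficients of the twisted
polynomial `φ_θ = ∑ coeff i τ ^ i`. -/
structure AndersonTModule (d : ℕ) where
  coeff : ℕ → Matrix (Fin d) (Fin d) (CInfty Fq)
  coeff_eventually_zero : ∃ N, ∀ n, N < n → coeff n = 0
  isNilpotent : IsNilpotent (coeff 0 - CInfty.theta Fq • (1 : Matrix (Fin d) (Fin d) (CInfty Fq)))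

variable {Fq}

namespace AndersonTModule

variable {d : ℕ} (G : AndersonTModule Fq d)

/-- `E = ∑ E n τ ^ n` satisfies `E 0 = 1` and `E * d[θ] = φ_θ * E` in the twisted power series
ring `Mat_d(C_∞)[[τ]]`, where `τ M = M^{(1)} τ`. -/
def IsExp (E : ℕ → Matrix (Fin d) (Fin d) (CInfty Fq)) : Prop :=
  E 0 = 1 ∧ ∀ n, E n * (G.coeff 0).map (twist Fq n) =
    ∑ i ∈ Finset.range (n + 1), G.coeff i * (E (n - i)).map (twist Fq i)

theorem exp_step (n : ℕ) (R : Matrix (Fin d) (Fin d) (CInfty Fq)) :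
    ∃! Q, Q * (G.coeff 0).map (twist Fq (n + 1 : ℕ)) - G.coeff 0 * Q = R := by
  set θ := CInfty.theta Fq with hθ
  set f : CInfty Fq →+* CInfty Fq := twist Fq (n + 1 : ℕ) with hf
  set N : Matrix (Fin d) (Fin d) (CInfty Fq) := G.coeff 0 - θ • 1 with hN
  set N' : Matrix (Fin d) (Fin d) (CInfty Fq) := (G.coeff 0).map f - f θ • 1 with hN'
  have hNn : IsNilpotent N := G.isNilpotent
  have hN'n : IsNilpotent N' := by
    have : N' = f.mapMatrix N := by
      ext i j
      simp [hN, hN', Matrix.one_apply, apply_ite f]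
    rw [this]
    exact hNn.map _
  have hc : f θ - θ ≠ 0 := by
    intro h
    have h1 : θ ^ Fintype.card Fq ^ (n + 1) = θ := by
      rw [← twist_natCast]; exact sub_eq_zero.mp h
    have h2 := congrArg norm h1
    rw [norm_pow, hθ, CInfty.norm_theta] at h2
    have h3 : Fintype.card Fq ^ Fintype.card Fq ^ (n + 1) = Fintype.card Fq ^ 1 := by
      rw [pow_one]; exact_mod_cast h2
    have hq : 1 < Fintype.card Fq := Fintype.one_lt_card
    have h4 := Nat.pow_right_injective hq h3
    exact absurd h4 (Nat.one_lt_pow (by omega) hq).ne'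
  let T : Module.End (CInfty Fq) (Matrix (Fin d) (Fin d) (CInfty Fq)) :=
    LinearMap.mulRight (CInfty Fq) N' - LinearMap.mulLeft (CInfty Fq) N
  have hT : IsNilpotent T := by
    refine Commute.isNilpotent_sub ?_ ?_ ?_
    · exact (LinearMap.commute_mulLeft_right (R := CInfty Fq) N N').symm
    · exact LinearMap.isNilpotent_mulRight_iff _ _ |>.2 hN'n
    · exact LinearMap.isNilpotent_mulLeft_iff _ _ |>.2 hNn
  let S : Module.End (CInfty Fq) (Matrix (Fin d) (Fin d) (CInfty Fq)) := algebraMap (CInfty Fq) _ (f θ - θ)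
  have hS : IsUnit S := (isUnit_iff_ne_zero.2 hc).map _
  have hU : IsUnit (S + T) := hT.isUnit_add_left_of_commute hS (Algebra.commutes _ _).symm
  have hb : Function.Bijective (S + T) := (Module.End.isUnit_iff _).1 hU
  have key : ∀ Q : Matrix (Fin d) (Fin d) (CInfty Fq), Q * (G.coeff 0).map f - G.coeff 0 * Q = (S + T) Q := by
    intro Q
    have e1 : (G.coeff 0).map f = N' + f θ • 1 := by simp [hN']
    have e2 : G.coeff 0 = N + θ • 1 := by simp [hN]
    have e3 : (S + T) Q = (f θ - θ) • Q + (Q * N' - N * Q) := by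
      simp [S, T, Algebra.algebraMap_eq_smul_one]
    rw [e3, e1, e2]
    simp only [mul_add, add_mul, Matrix.mul_smul, Matrix.smul_mul, mul_one, one_mul, sub_smul]
    abel
  simp only [key]
  exact hb.existsUnique R

theorem isExp_iff (E : ℕ → Matrix (Fin d) (Fin d) (CInfty Fq)) :
    G.IsExp E ↔ E 0 = 1 ∧ ∀ n : ℕ,
      E (n + 1) * (G.coeff 0).map (twist Fq (n + 1 : ℕ)) - G.coeff 0 * E (n + 1) =
        ∑ i : Fin (n + 1), G.coeff (i + 1) * (E (n - i)).map (twist Fq (i + 1 : ℕ)) := by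
  refine and_congr_right fun h0 => ⟨fun h n => ?_, fun h n => ?_⟩
  · rw [h (n + 1), Finset.sum_range_succ', Finset.sum_range]
    simp [twist_zero, Matrix.map_id]
  · cases n with
    | zero => simp [h0, twist_zero, Matrix.map_id]
    | succ n =>
      rw [sub_eq_iff_eq_add.1 (h n), Finset.sum_range_succ', Finset.sum_range]
      simp [twist_zero, Matrix.map_id]

/-- The solution of the recursion for the exponential series. -/
def expAux : ℕ → Matrix (Fin d) (Fin d) (CInfty Fq)
  | 0 => 1
  | n + 1 => (G.exp_step n
      (∑ i : Fin (n + 1), G.coeff (i + 1) * (expAux (n - i)).map (twist Fq (i + 1 : ℕ)))).choose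

theorem existsUnique_isExp : ∃! E, G.IsExp E := by
  refine ⟨G.expAux, (G.isExp_iff _).2 ⟨by rw [expAux], fun n => ?_⟩, fun E hE => ?_⟩
  · conv_lhs => rw [expAux]
    exact (G.exp_step n (∑ i : Fin (n + 1), G.coeff (i + 1) *
      (G.expAux (n - i)).map (twist Fq (i + 1 : ℕ)))).choose_spec.1
  · replace hE := (G.isExp_iff E).1 hE
    funext n
    induction n using Nat.strong_induction_on with
    | _ n ih =>
      cases n with
      | zero => rw [hE.1, expAux]
      | succ n =>
        rw [expAux]
        refine (G.exp_step n (∑ i : Fin (n + 1), G.coeff (i + 1) *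
          (G.expAux (n - i)).map (twist Fq (i + 1 : ℕ)))).choose_spec.2 _ ((hE.2 n).trans ?_)
        refine Finset.sum_congr rfl fun i _ => ?_
        rw [ih (n - i) (by omega)]

/-- The coefficients of the exponential series `Exp_G` of `G`. -/
def expCoeff : ℕ → Matrix (Fin d) (Fin d) (CInfty Fq) := G.existsUnique_isExp.choose

theorem isExp_expCoeff : G.IsExp G.expCoeff := G.existsUnique_isExp.choose_spec.1

/-- The coefficients of the logarithm series `Log_G`, the inverse of `Exp_G` in `Mat_d(C_∞)[[τ]]`,
computed recursively. -/
def logCoeff (n : ℕ) : Matrix (Fin d) (Fin d) (CInfty Fq) :=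
  if n = 0 then 1 else
    -∑ i : Fin n, logCoeff i * (G.expCoeff (n - i)).map (twist Fq i)

/-- `Log_G * Exp_G = 1`. -/
theorem logCoeff_mul_expCoeff (n : ℕ) :
    ∑ i ∈ Finset.range (n + 1), G.logCoeff i * (G.expCoeff (n - i)).map (twist Fq i) =
      if n = 0 then 1 else 0 := by
  rw [Finset.sum_range_succ, Nat.sub_self, G.isExp_expCoeff.1, Matrix.map_one _ (map_zero _)
    (map_one _), mul_one, logCoeff]
  split_ifs with h
  · subst h; simp
  · rw [Finset.sum_range]; exact add_neg_cancel _

/-- The value `Exp_G(z) = ∑ Q_n z^{(n)}`. -/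
def exp (z : Fin d → CInfty Fq) : Fin d → CInfty Fq :=
  ∑' n, (G.expCoeff n).mulVec fun i => twist Fq n (z i)

/-- The domain of convergence of `Log_G`. -/
def logDomain : Set (Fin d → CInfty Fq) :=
  {z | Summable fun n : ℕ => (G.logCoeff n).mulVec fun i => twist Fq n (z i)}

/-- The value `Log_G(z) = ∑ P_n z^{(n)}`. -/
def log (z : Fin d → CInfty Fq) : Fin d → CInfty Fq :=
  ∑' n : ℕ, (G.logCoeff n).mulVec fun i => twist Fq n (z i)

end AndersonTModule

/-! ### Drinfeld modules and their tensor products with Carlitz tensor powers -/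

/-- The Drinfeld module `φ_θ = θ + κ 1 τ + ⋯ + κ r τ ^ r`. -/
def drinfeld (r : ℕ) (κ : ℕ → CInfty Fq) : AndersonTModule Fq 1 where
  coeff n := Matrix.of fun _ _ =>
    if n = 0 then CInfty.theta Fq else if n ≤ r then κ n else 0
  coeff_eventually_zero := ⟨r, fun n hn => by
    ext i j
    simp [show n ≠ 0 by omega, show ¬ n ≤ r by omega]⟩
  isNilpotent := by
    refine ⟨1, ?_⟩
    rw [pow_one]
    ext i j
    simp [Subsingleton.elim i j]

/-- The exponential function of the Drinfeld module `φ`. -/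
def expPhi (r : ℕ) (κ : ℕ → CInfty Fq) (z : CInfty Fq) : CInfty Fq :=
  (drinfeld r κ).exp (fun _ => z) 0

/-- The logarithm function of the Drinfeld module `φ`. -/
def logPhi (r : ℕ) (κ : ℕ → CInfty Fq) (z : CInfty Fq) : CInfty Fq :=
  (drinfeld r κ).log (fun _ => z) 0

/-- The `θ`-torsion points of `φ`. -/
def thetaTorsion (r : ℕ) (κ : ℕ → CInfty Fq) : Set (CInfty Fq) :=
  {z | CInfty.theta Fq * z + ∑ i ∈ Finset.Icc 1 r, κ i * z ^ Fintype.card Fq ^ i = 0}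

/-- The `t`-module `φ ⊗ C^{⊗ k}` of dimension `r k + 1`: `ρ_θ = d[θ] + A_1 τ`, where `d[θ]` has
`θ` on the diagonal and `1` in the places `(i, i + r)`, the last row of `A_1` is
`(κ 1, …, κ r, 0, …, 0)`, and the `r - 1` rows above it are the first `r - 1` unit vectors. -/
def tensorModule (r k : ℕ) (κ : ℕ → CInfty Fq) : AndersonTModule Fq (r * k + 1) where
  coeff n := Matrix.of fun i j =>
    if n = 0 then
      if i = j then CInfty.theta Fq else if (i : ℕ) + r = j then 1 else 0
    else if n = 1 then
      if (i : ℕ) = r * k then (if (j : ℕ) < r then κ (j + 1) else 0)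
      else if (i : ℕ) + r = j + (r * k + 1) then 1 else 0
    else 0
  coeff_eventually_zero := ⟨1, fun n hn => by
    ext i j
    simp [show n ≠ 0 by omega, show n ≠ 1 by omega]⟩
  isNilpotent := by
    set N : Matrix (Fin (r * k + 1)) (Fin (r * k + 1)) (CInfty Fq) := _ - _ with hN
    have hT : ∀ i j, j ≤ i → N i j = 0 := by
      intro i j hij
      rcases hij.eq_or_lt with rfl | h
      · simp [hN]
      · have h1 : i ≠ j := h.ne'
        have h2 : ¬ (i : ℕ) + r = j := by
          have : (j : ℕ) < i := h
          omega
        simp [hN, h1, h2]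
    have hU : N.BlockTriangular id := fun i j h => hT i j h.le
    have hchar := Matrix.charpoly_of_isUpperTriangular N hU
    refine ⟨r * k + 1, ?_⟩
    have h := Matrix.aeval_self_charpoly N
    rw [hchar] at h
    simpa [hT] using h

/-! ### Periods, Anderson generating functions and rigid analytic trivialisations -/

/-- The twist of power series in `t`, acting on coefficients. -/
def psTwist (Fq : Type*) [Field Fq] [Fintype Fq] (i : ℤ) :
    PowerSeries (CInfty Fq) →+* PowerSeries (CInfty Fq) :=
  PowerSeries.map (twist Fq i)

/-- The Anderson generating function `s_φ(z; t) = ∑ exp_φ(z / θ ^ (i + 1)) t ^ i`. -/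
def agf (r : ℕ) (κ : ℕ → CInfty Fq) (z : CInfty Fq) : PowerSeries (CInfty Fq) :=
  PowerSeries.mk fun i => expPhi r κ (z / CInfty.theta Fq ^ (i + 1))

/-- The matrix `Υ`, with rows the twists of `(f_1, …, f_r)`, where `f_j = s_φ(lam j; t)`. -/
def Upsilon (r : ℕ) (κ : ℕ → CInfty Fq) (lam : Fin r → CInfty Fq) :
    Matrix (Fin r) (Fin r) (PowerSeries (CInfty Fq)) :=
  Matrix.of fun i j => psTwist Fq (i : ℕ) (agf r κ (lam j))

/-- The matrix `V`, with entry `κ_{i + j - 1}^{(1 - j)}` in the place `(i, j)` (counted from `1`)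
if `i + j - 1 ≤ r`, and `0` otherwise. -/
def matV (r : ℕ) (κ : ℕ → CInfty Fq) : Matrix (Fin r) (Fin r) (CInfty Fq) :=
  Matrix.of fun i j =>
    if (i : ℕ) + j + 1 ≤ r then twist Fq (-(j : ℕ)) (κ (i + j + 1)) else 0

/-- The matrix `Ψ = V⁻¹ ((Υ^{(1)})^tr)⁻¹`. -/
def Psi (r : ℕ) (κ : ℕ → CInfty Fq) (lam : Fin r → CInfty Fq) :
    Matrix (Fin r) (Fin r) (PowerSeries (CInfty Fq)) :=
  ((matV r κ).map (PowerSeries.C (R := CInfty Fq)))⁻¹ *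
    (((Upsilon r κ lam).map (psTwist Fq 1)).transpose)⁻¹

open scoped PowerSeries.WithPiTopology in
/-- The Anderson–Thakur element `ω_C = η ∏_{j ≥ 0} (1 - t / θ ^ (q ^ j))⁻¹`, where `η` is a
`(q - 1)`-st root of `-θ`. -/
def omegaC (η : CInfty Fq) : PowerSeries (CInfty Fq) :=
  PowerSeries.C η * (∏' j : ℕ, (1 - PowerSeries.C (CInfty.theta Fq ^ Fintype.card Fq ^ j)⁻¹ *
    (PowerSeries.X : PowerSeries (CInfty Fq))))⁻¹

/-- The Carlitz period `π̃ = θ η ∏_{j ≥ 1} (1 - θ ^ (1 - q ^ j))⁻¹`. -/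
def carlitzPeriod (η : CInfty Fq) : CInfty Fq :=
  CInfty.theta Fq * η *
    (∏' j : ℕ, (1 - CInfty.theta Fq / CInfty.theta Fq ^ Fintype.card Fq ^ (j + 1)))⁻¹

/-- `F` is an entire function without linear term such that
`F(θ z) - θ F(z) = exp_φ(z) ^ (q ^ l)`. -/
def IsQuasiPeriodic (r : ℕ) (κ : ℕ → CInfty Fq) (l : ℕ) (F : CInfty Fq → CInfty Fq) : Prop :=
  (∃ a : ℕ → CInfty Fq, a 1 = 0 ∧ ∀ z, HasSum (fun n => a n * z ^ n) (F z)) ∧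
    ∀ z, F (CInfty.theta Fq * z) - CInfty.theta Fq * F z = expPhi r κ z ^ Fintype.card Fq ^ l

/-! ### The map `φ_tens` and its inverse -/

open Polynomial in
/-- The matrix `Θ` of the action of `τ` on the `t`-motive of `φ`. -/
def Theta (r : ℕ) (κ : ℕ → CInfty Fq) : Matrix (Fin r) (Fin r) (CInfty Fq)[X] :=
  Matrix.of fun i j =>
    if (i : ℕ) + 1 < r then (if (j : ℕ) = i + 1 then 1 else 0)
    else if (j : ℕ) = 0 then C (κ r)⁻¹ * (X - C (CInfty.theta Fq))
    else -C (κ j / κ r)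

open Polynomial in
/-- `thetaProd r κ n = Θ^{(n - 1)} ⋯ Θ^{(1)} Θ`. -/
def thetaProd (r : ℕ) (κ : ℕ → CInfty Fq) : ℕ → Matrix (Fin r) (Fin r) (CInfty Fq)[X]
  | 0 => 1
  | n + 1 => (Theta r κ).map (Polynomial.map (twist Fq n)) * thetaProd r κ n

open Polynomial in
/-- The image in `Mat_{1 × r}(C_∞[t])` of `τ ^ n g_{r u + j + 1}`, where `0 ≤ j < r` and `l = r u + j`:
the row vector `((t - θ) ⋯ (t - θ^{q^{n-1}}))^k (t - θ^{q^n})^u e_{j+1}^tr Θ^{(n-1)} ⋯ Θ` of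
coordinates with respect to the basis `m_1, …, m_r` on which `τ` acts by `(t - θ)^k Θ`, converted to
coordinates with respect to the basis `c = (V^{(-1)})^tr m`. -/
def tensRow (r k : ℕ) (κ : ℕ → CInfty Fq) (n l : ℕ) : Fin r → (CInfty Fq)[X] := fun μ =>
  (∏ i ∈ Finset.range n, (X - C (CInfty.theta Fq ^ Fintype.card Fq ^ i))) ^ k *
    (X - C (CInfty.theta Fq ^ Fintype.card Fq ^ n)) ^ (l / r) *
    (thetaProd r κ n * ((((matV r κ).map (twist Fq (-1))).transpose)⁻¹).map C)
      ⟨l % r, Nat.mod_lt _ μ.pos⟩ μ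

/-- The weight `𝔳_u = q ^ (q ^ (r - 1) / (q ^ r - 1) + u + k / (q - 1))`. -/
def tensWeight (Fq : Type*) [Fintype Fq] (r k u : ℕ) : ℝ :=
  (Fintype.card Fq : ℝ) ^ ((Fintype.card Fq : ℝ) ^ (r - 1) / ((Fintype.card Fq : ℝ) ^ r - 1) + u +
    k / ((Fintype.card Fq : ℝ) - 1))

/-- The space `𝕄_tens` of tuples `(∑ a_{n, l} τ ^ n)_l` of power series in `τ`, such that
`|a_{n, r u + j}| 𝔳_u ^ (q ^ n) → 0`. -/
def MTens (Fq : Type*) [Field Fq] [Fintype Fq] (r k : ℕ) : Set (Fin (r * k + 1) → ℕ → CInfty Fq) :=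
  {a | ∀ l : Fin (r * k + 1), Filter.Tendsto
    (fun n => ‖a l n‖ * tensWeight Fq r k (l / r) ^ Fintype.card Fq ^ n) Filter.atTop (nhds 0)}

/-- The `n`-th term of the series defining the coefficient of `t ^ ν` in the `μ`-th entry of the
image of `a` under `φ_tens`. -/
def phiTensTerm (r k : ℕ) (κ : ℕ → CInfty Fq) (a : Fin (r * k + 1) → ℕ → CInfty Fq) (μ : Fin r)
    (ν n : ℕ) : CInfty Fq :=
  ∑ l : Fin (r * k + 1), a l n * (tensRow r k κ n l μ).coeff ν

/-- The map `φ_tens`, which sends `(∑ a_{n, l} τ ^ n)_l` to `∑ a_{n, l} φ_tens(τ ^ n g_l)`. -/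
def phiTens (r k : ℕ) (κ : ℕ → CInfty Fq) (a : Fin (r * k + 1) → ℕ → CInfty Fq) :
    Fin r → PowerSeries (CInfty Fq) := fun μ =>
  PowerSeries.mk fun ν => ∑' n, phiTensTerm r k κ a μ ν n

/-- The map `𝓜_tens`, the inverse of `φ_tens : 𝕄_tens → Mat_{1 × r}(𝕋)` on its image. -/
def mellinTens (r k : ℕ) (κ : ℕ → CInfty Fq) (f : Fin r → PowerSeries (CInfty Fq)) :
    Fin (r * k + 1) → ℕ → CInfty Fq :=
  Function.invFunOn (phiTens r k κ) (MTens Fq r k) f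

/-- The `n`-th term of `δ_{1, z}(a) = ∑ a_{n, l} z_l ^ (q ^ n)`. -/
def deltaOneTerm {d : ℕ} (z : Fin d → CInfty Fq) (a : Fin d → ℕ → CInfty Fq) (n : ℕ) : CInfty Fq :=
  ∑ l, a l n * z l ^ Fintype.card Fq ^ n

/-- The map `δ_{1, z}`. -/
def deltaOne {d : ℕ} (z : Fin d → CInfty Fq) (a : Fin d → ℕ → CInfty Fq) : CInfty Fq :=
  ∑' n, deltaOneTerm z a n

/-- The map `𝓜_{tens, z} = δ_{1, z} ∘ φ_tens⁻¹`. -/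
def mellinTensAt (r k : ℕ) (κ : ℕ → CInfty Fq) (z : Fin (r * k + 1) → CInfty Fq)
    (f : Fin r → PowerSeries (CInfty Fq)) : CInfty Fq :=
  deltaOne z (mellinTens r k κ f)

/-- The row vector `v (Ψ^tr)^{(-1)}`. -/
def rowPsi (r : ℕ) (κ : ℕ → CInfty Fq) (lam v : Fin r → CInfty Fq) :
    Fin r → PowerSeries (CInfty Fq) :=
  Matrix.vecMul (fun i => PowerSeries.C (v i)) ((Psi r κ lam).transpose.map (psTwist Fq (-1)))

/-- The row vector `(-π̃)^k / (ω_C^k (θ - t)) (λ_1, …, λ_r) (Ψ^tr)^{(-1)}`. -/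
def periodImage (r k : ℕ) (κ : ℕ → CInfty Fq) (η : CInfty Fq) (lam : Fin r → CInfty Fq) :
    Fin r → PowerSeries (CInfty Fq) := fun μ =>
  PowerSeries.C ((-carlitzPeriod η) ^ k) *
    (omegaC η ^ k * (PowerSeries.C (CInfty.theta Fq) - PowerSeries.X))⁻¹ * rowPsi r κ lam lam μ

/-- The row vector `(-π̃)^k / (ω_C^k (t - θ)) (F(λ_1), …, F(λ_r)) (Ψ^tr)^{(-1)}`. -/
def quasiPeriodImage (r k : ℕ) (κ : ℕ → CInfty Fq) (η : CInfty Fq) (lam : Fin r → CInfty Fq)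
    (F : CInfty Fq → CInfty Fq) : Fin r → PowerSeries (CInfty Fq) := fun μ =>
  PowerSeries.C ((-carlitzPeriod η) ^ k) *
    (omegaC η ^ k * (PowerSeries.X - PowerSeries.C (CInfty.theta Fq)))⁻¹ *
      rowPsi r κ lam (fun i => F (lam i)) μ

/-- The Tate algebra `𝕋` of power series in `t` converging on the closed unit disc. -/
def tateAlgebra (Fq : Type*) [Field Fq] [Fintype Fq] : Set (PowerSeries (CInfty Fq)) :=
  {f | Filter.Tendsto (fun n => ‖f.coeff n‖) Filter.atTop (nhds 0)}

end

end TModuleLog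

end

open scoped NNReal WithZero

noncomputable section

set_option linter.unusedSectionVars false

namespace TModuleLog

/-! ### Twisted convolution -/

section TwistedConvolution

variable {R : Type*} [Ring R] (σ : R →+* R)

/-! The images under `phiTens` of the last `r` rows of the logarithm can be computed in closed form;
injectivity of `phiTens` then turns this into a formula for the rows, and evaluating the
coefficients at `z` gives the statement on values.

The rows: since `Log ρ_θ = d[θ] Log` and the last `r` rows of `d[θ]` are diagonal, each such row
`p_n` obeys `p_{n+1} d[θ]^{(n+1)} + p_n A_1^{(n)} = θ p_{n+1}`. In the solution a Carlitz factor
splits off (`invDiffProd`), and what remains (`logRow`) depends on `φ` alone. It encodes a series `S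
= ∑ s_n τ^n` (`logSeq`) with `S φ_θ = θ S` for the last row (`l = 0`, `S = log_φ`) and `S φ_θ = θ S
- τ^l`, `1 ≤ l < r`, for the others. Composing with `exp_φ` gives the identity if `l = 0` and
`-F_{τ^l}` otherwise; the latter also proves that `F_{τ^l}` exists.

Their images: `t` acts on the elements `τ^n g_l` through `d[θ]` and `A_1` (`X_smul_motRow`), so `t -
θ` times a partial sum of the image telescopes (`IsLogRow.sub_smul_sum`). Pairing with the twists of
the Anderson generating function `f` of a period `λ` and passing to the limit (`IsLogRow.pairing`)
leaves `(-π̃ / ω_C)^k ((t - θ) H + f^{(l)})` with `H = ∑ s_m f^{(m)}`, the term `f^{(l)}` being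
absent if `l = 0`. The coefficients of `H` are `S(exp_φ(λ / θ^{ν+1}))`, so the bracket collapses to
the constant `-λ` or `F_{τ^l}(λ)`. For `λ = λ_1, …, λ_r` this is a linear system with matrix
`(V^{(-1)})^tr Υ`. It is invertible because the constant term of `Υ` is a Moore matrix, and its
inverse is `(Ψ^tr)^{(-1)}`.

Injectivity: the coordinate at level `n` with respect to the `τ^n g_l` is bounded for the Gauss norm
of radius `q^{q^n}`. If a series vanishes, its partial sums are minus its tails, which are small for
every such norm, so all coordinates are zero.

The estimates rest on `α = q^{1/(q^r-1)}`, for which `α^{q^r} = α q`: on the disc `‖z‖ < α q` the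
functions `exp_φ` and `log_φ` are mutually inverse isometries, and this disc contains the
`θ`-torsion and the `λ_i / θ`. -/

/-- The product of the twisted power series `∑ a i τ ^ i` and `∑ b j τ ^ j`, where
`τ x = σ x τ`. -/
def twistMul (a b : ℕ → R) (n : ℕ) : R :=
  ∑ p ∈ Finset.HasAntidiagonal.antidiagonal n, a p.1 * (σ ^ p.1) (b p.2)

theorem twistMul_eq_sum_range (a b : ℕ → R) (n : ℕ) :
    twistMul σ a b n = ∑ i ∈ Finset.range (n + 1), a i * (σ ^ i) (b (n - i)) :=
  Finset.Nat.sum_antidiagonal_eq_sum_range_succ (fun i j => a i * (σ ^ i) (b j)) n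

/-- Both sides sum over triples of indices with total `n`, and the twists agree because `σ ^ i` is
multiplicative and powers of `σ` compose. Functional equations pass between exponentials and
logarithms through this. -/
theorem twistMul_assoc (a b c : ℕ → R) :
    twistMul σ (twistMul σ a b) c = twistMul σ a (twistMul σ b c) := by
  funext n
  simp only [twistMul, Finset.sum_mul, Finset.mul_sum, map_sum, map_mul]
  rw [Finset.sum_sigma', Finset.sum_sigma']
  refine Finset.sum_nbij' (fun x => ⟨(x.2.1, x.2.2 + x.1.2), (x.2.2, x.1.2)⟩)
    (fun x => ⟨(x.1.1 + x.2.1, x.2.2), (x.1.1, x.2.1)⟩) ?_ ?_ ?_ ?_ ?_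
  · rintro ⟨⟨a, b⟩, ⟨c, d⟩⟩ h
    simp only [Finset.mem_sigma, Finset.HasAntidiagonal.mem_antidiagonal] at h ⊢
    exact ⟨by omega, trivial⟩
  · rintro ⟨⟨a, b⟩, ⟨c, d⟩⟩ h
    simp only [Finset.mem_sigma, Finset.HasAntidiagonal.mem_antidiagonal] at h ⊢
    exact ⟨by omega, trivial⟩
  · rintro ⟨⟨a, b⟩, ⟨c, d⟩⟩ h
    simp only [Finset.mem_sigma, Finset.HasAntidiagonal.mem_antidiagonal] at h
    obtain ⟨h1, rfl⟩ := h
    rfl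
  · rintro ⟨⟨a, b⟩, ⟨c, d⟩⟩ h
    simp only [Finset.mem_sigma, Finset.HasAntidiagonal.mem_antidiagonal] at h
    obtain ⟨h1, rfl⟩ := h
    rfl
  · rintro ⟨⟨a, b⟩, ⟨c, d⟩⟩ h
    simp only [Finset.mem_sigma, Finset.HasAntidiagonal.mem_antidiagonal] at h
    obtain ⟨h1, rfl⟩ := h
    simp only [mul_assoc, pow_add, RingHom.mul_def, RingHom.comp_apply]

theorem twistMul_right_cancel {a a' b : ℕ → R} (hb : b 0 = 1)
    (h : twistMul σ a b = twistMul σ a' b) : a = a' := by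
  funext n
  induction n using Nat.strong_induction_on with
  | _ n ih =>
    have h1 := congrFun h n
    rw [twistMul_eq_sum_range, twistMul_eq_sum_range, Finset.sum_range_succ, Finset.sum_range_succ,
      Nat.sub_self, hb, map_one, mul_one, mul_one] at h1
    have h2 : ∑ i ∈ Finset.range n, a i * (σ ^ i) (b (n - i)) =
        ∑ i ∈ Finset.range n, a' i * (σ ^ i) (b (n - i)) :=
      Finset.sum_congr rfl fun i hi => by rw [ih i (Finset.mem_range.1 hi)]
    rw [h2] at h1
    exact add_left_cancel h1

theorem twistMul_single_left (x : R) (b : ℕ → R) :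
    twistMul σ (Pi.single 0 x) b = fun n => x * b n := by
  funext n
  rw [twistMul_eq_sum_range, Finset.sum_eq_single 0]
  · simp
  · intro i _ hi; simp [hi]
  · simp

theorem twistMul_single_right (x : R) (a : ℕ → R) :
    twistMul σ a (Pi.single 0 x) = fun n => a n * (σ ^ n) x := by
  funext n
  rw [twistMul_eq_sum_range, Finset.sum_eq_single n]
  · simp
  · intro i hi hin
    have : n - i ≠ 0 := by have := Finset.mem_range.1 hi; omega
    simp [this]
  · simp

theorem twistMul_sub_left (a a' b : ℕ → R) :
    twistMul σ (a - a') b = twistMul σ a b - twistMul σ a' b := by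
  funext n
  simp [twistMul, sub_mul]

end TwistedConvolution

/-! ### `q`-power series over a complete ultrametric field -/

section QPowerSeries

variable {C : Type*} [NormedField C] {q : ℕ}

/-- The value at `z` of the power series `∑ a n z ^ (q ^ n)`. -/
def evq (q : ℕ) (a : ℕ → C) (z : C) : C := ∑' n, a n * z ^ q ^ n

theorem frob_pow_apply {σ : C →+* C} (hσ : ∀ x, σ x = x ^ q) (n : ℕ) (x : C) :
    (σ ^ n) x = x ^ q ^ n := by
  induction n generalizing x with
  | zero => simp
  | succ n ih => rw [pow_succ, RingHom.mul_def, RingHom.comp_apply, ih, hσ, ← pow_mul, pow_succ,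
      mul_comm]

theorem pow_le_pow_of_le {x : ℝ} (hx0 : 0 ≤ x) (hx1 : x < 1) (hq : 1 < q) (n : ℕ) :
    x ^ q ^ n ≤ x ^ n :=
  pow_le_pow_of_le_one hx0 hx1.le (Nat.lt_pow_self hq).le

theorem norm_qterm_le {a : ℕ → C} {ρ K : ℝ} {z : C} (hz : ‖z‖ < ρ)
    (ha : ∀ n, ‖a n‖ * ρ ^ q ^ n ≤ K) (n : ℕ) :
    ‖a n * z ^ q ^ n‖ ≤ K * (‖z‖ / ρ) ^ q ^ n := by
  have hρ : 0 < ρ := (norm_nonneg z).trans_lt hz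
  rw [norm_mul, norm_pow, div_pow]
  calc ‖a n‖ * ‖z‖ ^ q ^ n = ‖a n‖ * ρ ^ q ^ n * (‖z‖ ^ q ^ n / ρ ^ q ^ n) := by
        field_simp
    _ ≤ _ := by gcongr; exact ha n

theorem summable_qterm [CompleteSpace C] (hq : 1 < q) {a : ℕ → C} {ρ K : ℝ} {z : C} (hz : ‖z‖ < ρ)
    (ha : ∀ n, ‖a n‖ * ρ ^ q ^ n ≤ K) : Summable fun n => a n * z ^ q ^ n := by
  have hρ : 0 < ρ := (norm_nonneg z).trans_lt hz
  have hx0 : 0 ≤ ‖z‖ / ρ := by positivity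
  have hx1 : ‖z‖ / ρ < 1 := (div_lt_one hρ).2 hz
  have hK : 0 ≤ K := le_trans (by positivity) (ha 0)
  refine Summable.of_norm_bounded
    ((summable_geometric_of_lt_one hx0 hx1).mul_left K) fun n => ?_
  exact (norm_qterm_le hz ha n).trans
    (mul_le_mul_of_nonneg_left (pow_le_pow_of_le hx0 hx1 hq n) hK)

theorem evq_add [CompleteSpace C] {σ : C →+* C} (hσ : ∀ x, σ x = x ^ q) {a : ℕ → C} {x y : C}
    (hx : Summable fun n => a n * x ^ q ^ n) (hy : Summable fun n => a n * y ^ q ^ n) :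
    evq q a (x + y) = evq q a x + evq q a y := by
  rw [evq, evq, evq, ← hx.tsum_add hy]
  congr 1
  funext n
  rw [← frob_pow_apply hσ, map_add, frob_pow_apply hσ, frob_pow_apply hσ, mul_add]

/-- Each nonlinear term is at most `ρ (‖z‖ / ρ)^2 < ‖z‖`, so the linear term decides the norm.
Together with `evq_add` this makes the function injective on the disc. -/
theorem norm_evq [IsUltrametricDist C] [CompleteSpace C] (hq : 1 < q) {a : ℕ → C} {ρ : ℝ} {z : C}
    (hz : ‖z‖ < ρ) (h0 : a 0 = 1) (ha : ∀ n, ‖a n‖ * ρ ^ q ^ n ≤ ρ) :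
    ‖evq q a z‖ = ‖z‖ := by
  have hρ : 0 < ρ := (norm_nonneg z).trans_lt hz
  have hs := summable_qterm hq hz ha
  rcases eq_or_ne z 0 with rfl | hz0
  · rw [evq]; simp [zero_pow (pow_ne_zero _ (by omega : q ≠ 0))]
  have hzp : 0 < ‖z‖ := norm_pos_iff.2 hz0
  have hx1 : ‖z‖ / ρ < 1 := (div_lt_one hρ).2 hz
  have htail : ‖∑' n, a (n + 1) * z ^ q ^ (n + 1)‖ < ‖z‖ := by
    refine (IsUltrametricDist.norm_tsum_le_of_forall_le_of_nonneg (C := ρ * (‖z‖ / ρ) ^ 2)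
      (by positivity) fun n => ?_).trans_lt ?_
    · refine (norm_qterm_le hz ha (n + 1)).trans ?_
      refine mul_le_mul_of_nonneg_left ?_ hρ.le
      refine pow_le_pow_of_le_one (by positivity) hx1.le ?_
      calc 2 ≤ q := hq
        _ = q ^ 1 := (pow_one q).symm
        _ ≤ q ^ (n + 1) := Nat.pow_le_pow_right (by omega) (by omega)
    · rw [pow_two, ← mul_assoc, mul_div_cancel₀ _ hρ.ne']
      exact mul_lt_of_lt_one_right hzp hx1
  rw [evq, hs.tsum_eq_zero_add, h0, pow_zero, pow_one, one_mul]
  rw [IsUltrametricDist.norm_add_eq_max_of_norm_ne_norm htail.ne']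
  exact max_eq_left htail.le

/-- The bound on `b` sends the disc of radius `ρ` into that of radius `ρ'`, and the double series is
dominated by a product of two geometric series in `‖z‖ / ρ`. Summing it along antidiagonals instead
of rows turns composition of functions into the twisted product. -/
theorem hasSum_twistMul [CompleteSpace C] (hq : 1 < q) {σ : C →+* C} (hσ : ∀ x, σ x = x ^ q)
    {a b : ℕ → C} {ρ ρ' K : ℝ} {z : C} (hz : ‖z‖ < ρ) (ha : ∀ n, ‖a n‖ * ρ' ^ q ^ n ≤ K)
    (hb : ∀ n, ‖b n‖ * ρ ^ q ^ n ≤ ρ') :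
    HasSum (fun n => twistMul σ a b n * z ^ q ^ n) (evq q a (evq q b z)) := by
  have hρ : 0 < ρ := (norm_nonneg z).trans_lt hz
  have hx0 : 0 ≤ ‖z‖ / ρ := by positivity
  have hx1 : ‖z‖ / ρ < 1 := (div_lt_one hρ).2 hz
  have hρ' : 0 ≤ ρ' := le_trans (by positivity) (hb 0)
  have hK : 0 ≤ K := le_trans (by positivity) (ha 0)
  set x := ‖z‖ / ρ with hx
  have hbound : ∀ p : ℕ × ℕ, ‖a p.1 * (b p.2 * z ^ q ^ p.2) ^ q ^ p.1‖ ≤ K * (x ^ p.1 * x ^ p.2) := by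
    rintro ⟨n, m⟩
    have h1 : ‖(b m * z ^ q ^ m) ^ q ^ n‖ ≤ (ρ' * x ^ q ^ m) ^ q ^ n := by
      rw [norm_pow]
      exact pow_le_pow_left₀ (norm_nonneg _) (norm_qterm_le hz hb m) _
    rw [norm_mul]
    calc ‖a n‖ * ‖(b m * z ^ q ^ m) ^ q ^ n‖ ≤ ‖a n‖ * (ρ' * x ^ q ^ m) ^ q ^ n := by gcongr
      _ = (‖a n‖ * ρ' ^ q ^ n) * x ^ q ^ (n + m) := by
        rw [mul_pow, ← pow_mul, ← pow_add, mul_assoc, add_comm m n]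
      _ ≤ K * x ^ (n + m) := by
        exact mul_le_mul (ha n) (pow_le_pow_of_le hx0 hx1 hq _) (by positivity) hK
      _ = _ := by rw [pow_add]
  have hgeo := summable_geometric_of_lt_one hx0 hx1
  have hsum : Summable fun p : ℕ × ℕ => a p.1 * (b p.2 * z ^ q ^ p.2) ^ q ^ p.1 := by
    refine Summable.of_norm_bounded (g := fun p : ℕ × ℕ => K * (x ^ p.1 * x ^ p.2)) ?_ hbound
    exact (hgeo.mul_of_nonneg hgeo (fun n => by positivity) (fun n => by positivity)).mul_left K
  have hsb := summable_qterm hq hz hb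
  have hinner : ∀ n, HasSum (fun m => a n * (b m * z ^ q ^ m) ^ q ^ n)
      (a n * (evq q b z) ^ q ^ n) := by
    intro n
    refine HasSum.mul_left _ ?_
    have h := hsb.hasSum.map (σ ^ n) (by
      have : ((σ ^ n : C →+* C) : C → C) = fun x => x ^ q ^ n := funext (frob_pow_apply hσ n)
      rw [this]; fun_prop)
    rw [frob_pow_apply hσ] at h
    refine h.congr_fun fun m => ?_
    exact (frob_pow_apply hσ n _).symm
  have htot : HasSum (fun p : ℕ × ℕ => a p.1 * (b p.2 * z ^ q ^ p.2) ^ q ^ p.1)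
      (evq q a (evq q b z)) := by
    have h := hsum.hasSum
    have h2 := h.prod_fiberwise hinner
    rwa [← h2.tsum_eq] at h
  rw [← Finset.HasAntidiagonal.sigmaAntidiagonalEquivProd.hasSum_iff] at htot
  refine (htot.sigma fun n => hasSum_fintype _).congr_fun fun n => ?_
  rw [twistMul, Finset.sum_mul, ← Finset.sum_coe_sort (Finset.HasAntidiagonal.antidiagonal n)]
  refine Finset.sum_congr rfl fun p _ => ?_
  obtain ⟨⟨i, j⟩, hp⟩ := p
  have hij : i + j = n := Finset.HasAntidiagonal.mem_antidiagonal.1 hp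
  simp only [Function.comp, Finset.HasAntidiagonal.sigmaAntidiagonalEquivProd_apply, frob_pow_apply hσ]
  rw [mul_pow, ← pow_mul, ← pow_add, ← hij, add_comm j i, mul_assoc]

end QPowerSeries

/-! ### The radius of convergence -/

section Radius

/-- The real number `q ^ (1 / (q ^ r - 1))`. -/
def baseRadius (q r : ℕ) : ℝ := (q : ℝ) ^ ((1 : ℝ) / ((q : ℝ) ^ r - 1))

variable {q r : ℕ}

theorem one_lt_baseRadius (hq : 1 < q) (hr : 1 ≤ r) : 1 < baseRadius q r := by
  have h1 : (1 : ℝ) < q := by exact_mod_cast hq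
  have h2 : (1 : ℝ) < (q : ℝ) ^ r := one_lt_pow₀ h1 (by omega)
  exact Real.one_lt_rpow h1 (by apply div_pos one_pos; linarith)

theorem baseRadius_pow (hq : 1 < q) (hr : 1 ≤ r) :
    baseRadius q r ^ q ^ r = baseRadius q r * q := by
  have h1 : (1 : ℝ) < q := by exact_mod_cast hq
  have h2 : (1 : ℝ) < (q : ℝ) ^ r := one_lt_pow₀ h1 (by omega)
  have h3 : (q : ℝ) ^ r - 1 ≠ 0 := by linarith
  have h0 : (0 : ℝ) < q := by linarith
  rw [baseRadius, ← Real.rpow_natCast, ← Real.rpow_mul h0.le, ← Real.rpow_add_one h0.ne']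
  congr 1
  push_cast
  field_simp
  ring

/-- The norm of `θ - θ^{q^n}` is `q^{q^n}`; measured in powers of `α`, multiplying by it shifts the
index by exactly `r`. All growth estimates below use this. -/
theorem baseRadius_pow_mul (hq : 1 < q) (hr : 1 ≤ r) (n : ℕ) :
    baseRadius q r ^ q ^ n * (q : ℝ) ^ q ^ n = baseRadius q r ^ q ^ (n + r) := by
  rw [← mul_pow, ← baseRadius_pow hq hr, ← pow_mul, ← pow_add, add_comm]

end Radius

/-! ### Recursion for the logarithm -/

section Defs

variable {C : Type*} [Field C]

/-- The coefficients of `θ + κ 1 τ + ⋯ + κ r τ ^ r`. -/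
def drinfeldSeq (θ : C) (κ : ℕ → C) (r n : ℕ) : C :=
  if n = 0 then θ else if n ≤ r then κ n else 0

/-- `1 / (θ - θ ^ (q ^ n))` for `n ≥ 1`, and `1` for `n = 0`. -/
def invDiff (q : ℕ) (θ : C) (n : ℕ) : C :=
  if n = 0 then 1 else (θ - θ ^ q ^ n)⁻¹

/-- The sequence of row vectors with initial value the unit vector `l` that describes the last rows
of the logarithm of a tensor product. -/
def logRow (q : ℕ) (θ : C) (κ : ℕ → C) (r l : ℕ) : ℕ → ℕ → C
  | 0, m => if m = l then 1 else 0
  | n + 1, m => if m < r then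
      invDiff q θ n * logRow q θ κ r l n 0 * κ (m + 1) ^ q ^ n + logRow q θ κ r l n (m + 1) else 0

/-- The coefficients of the series `S` such that `S φ_θ = θ S`, if `l = 0`, and
`S φ_θ = θ S - τ ^ l`, if `l ≥ 1`. -/
def logSeq (q : ℕ) (θ : C) (κ : ℕ → C) (r l n : ℕ) : C :=
  invDiff q θ n * logRow q θ κ r l n 0

variable {q : ℕ} {θ : C} {κ : ℕ → C} {r l : ℕ}

theorem logRow_eq_zero (hl : l < r) {n m : ℕ} (hm : r ≤ m) : logRow q θ κ r l n m = 0 := by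
  cases n with
  | zero => simp [logRow, show m ≠ l by omega]
  | succ n => simp [logRow, show ¬ m < r by omega]

theorem logRow_succ {n m : ℕ} (hm : m < r) : logRow q θ κ r l (n + 1) m =
    logSeq q θ κ r l n * κ (m + 1) ^ q ^ n + logRow q θ κ r l n (m + 1) := by
  simp [logRow, hm, logSeq]

/-- `logRow n m` is a sliding window: it collects the part of coefficient `n + m` of `S φ_θ` that
`s_0, …, s_{n-1}` already determine, plus the inhomogeneous `1` at `n + m = l`. -/
theorem logRow_eq_sum (hl : l < r) (hq : q ≠ 0) (n m : ℕ) : logRow q θ κ r l n m =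
    ∑ i ∈ Finset.range n, logSeq q θ κ r l (n - 1 - i) *
      (if m + i + 1 ≤ r then κ (m + i + 1) else 0) ^ q ^ (n - 1 - i) + if m + n = l then 1 else 0 := by
  induction n generalizing m with
  | zero => simp [logRow]
  | succ n ih =>
    rcases lt_or_ge m r with hm | hm
    · rw [logRow_succ hm, ih, Finset.sum_range_succ']
      have h1 : (m + (n + 1) = l) = (m + 1 + n = l) := by congr 1; omega
      simp only [h1]
      rw [← add_assoc]
      congr 1
      rw [add_comm]
      congr 1
      · refine Finset.sum_congr rfl fun i _ => ?_
        rw [show n + 1 - 1 - (i + 1) = n - 1 - i by omega, show m + 1 + i + 1 = m + (i + 1) + 1 by omega]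
      · simp [Nat.succ_le_of_lt hm]
    · rw [logRow_eq_zero hl hm, Finset.sum_eq_zero, if_neg (by omega), add_zero]
      intro i _
      rw [if_neg (by omega), zero_pow (pow_ne_zero _ hq), mul_zero]

end Defs

/-! ### Norms of the recursion, and the functional equation of `S` -/

section Analysis

variable {C : Type*} [NormedField C] [IsUltrametricDist C] {q : ℕ} {θ : C}

theorem norm_theta_sub (hq : 1 < q) (hθ : ‖θ‖ = q) {n : ℕ} (hn : n ≠ 0) :
    ‖θ - θ ^ q ^ n‖ = (q : ℝ) ^ q ^ n := by
  have h1 : (1 : ℝ) < q := by exact_mod_cast hq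
  have h2 : 1 < q ^ n := Nat.one_lt_pow hn hq
  have h3 : ‖θ‖ < ‖θ ^ q ^ n‖ := by
    rw [norm_pow, hθ]
    calc (q : ℝ) = (q : ℝ) ^ 1 := (pow_one _).symm
      _ < _ := pow_lt_pow_right₀ h1 h2
  rw [sub_eq_add_neg, IsUltrametricDist.norm_add_eq_max_of_norm_ne_norm (by rw [norm_neg]; exact h3.ne),
    norm_neg, max_eq_right h3.le, norm_pow, hθ]

theorem theta_sub_ne_zero (hq : 1 < q) (hθ : ‖θ‖ = q) {n : ℕ} (hn : n ≠ 0) : θ - θ ^ q ^ n ≠ 0 := by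
  rw [← norm_ne_zero_iff, norm_theta_sub hq hθ hn]
  positivity

theorem norm_invDiff (hq : 1 < q) (hθ : ‖θ‖ = q) {n : ℕ} (hn : n ≠ 0) :
    ‖invDiff q θ n‖ = ((q : ℝ) ^ q ^ n)⁻¹ := by
  rw [invDiff, if_neg hn, norm_inv, norm_theta_sub hq hθ hn]

variable {κ : ℕ → C} {r l : ℕ}

theorem norm_logRow_zero_le (n : ℕ) : ‖logRow q θ κ r l 0 n‖ ≤ 1 := by
  rw [logRow]; split_ifs <;> simp

/-- Division of `logRow n 0` by `θ - θ^{q^n}` raises the weight from `α^{q^n}` to `α^{q^{n+r}}`,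
enough for every column since `n + 1 + m ≤ n + r`. The other summand comes from the next column and
keeps `n + m` fixed. -/
theorem norm_logRow_le (hq : 1 < q) (hθ : ‖θ‖ = q) (hr : 1 ≤ r)
    (hκ : ∀ i, 1 ≤ i → i ≤ r → ‖κ i‖ ≤ 1) (n : ℕ) {m : ℕ} (hm : m < r) (hl : l < r) :
    ‖logRow q θ κ r l n m‖ * baseRadius q r ^ q ^ (n + m) ≤ baseRadius q r ^ q ^ r := by
  have hα := one_lt_baseRadius hq hr
  set α := baseRadius q r
  have hα0 : 0 < α := by linarith
  have h1 : (1 : ℝ) < q := by exact_mod_cast hq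
  induction n generalizing m with
  | zero =>
    calc _ ≤ 1 * α ^ q ^ (0 + m) := by gcongr; exact norm_logRow_zero_le _
      _ ≤ α ^ q ^ r := by
        rw [one_mul]
        exact pow_le_pow_right₀ hα.le (Nat.pow_le_pow_right (by omega) (by omega))
  | succ n ih =>
    rw [logRow_succ hm]
    have hle : ∀ x y : C, ‖x‖ * α ^ q ^ (n + 1 + m) ≤ α ^ q ^ r → ‖y‖ * α ^ q ^ (n + 1 + m) ≤ α ^ q ^ r →
        ‖x + y‖ * α ^ q ^ (n + 1 + m) ≤ α ^ q ^ r := by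
      intro x y hx hy
      have := IsUltrametricDist.norm_add_le_max x y
      rcases le_max_iff.1 this with h | h
      · exact (mul_le_mul_of_nonneg_right h (by positivity)).trans hx
      · exact (mul_le_mul_of_nonneg_right h (by positivity)).trans hy
    apply hle
    · have hk : ‖κ (m + 1) ^ q ^ n‖ ≤ 1 := by
        rw [norm_pow]
        exact pow_le_one₀ (norm_nonneg _) (hκ _ (by omega) (by omega))
      have hpow : α ^ q ^ (n + 1 + m) ≤ α ^ q ^ (n + r) :=
        pow_le_pow_right₀ hα.le (Nat.pow_le_pow_right (by omega) (by omega))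
      have hs : ‖logSeq q θ κ r l n‖ * α ^ q ^ (n + r) ≤ α ^ q ^ r := by
        rcases eq_or_ne n 0 with rfl | hn
        · rw [logSeq, invDiff, if_pos rfl, one_mul, zero_add]
          exact mul_le_of_le_one_left (by positivity) (norm_logRow_zero_le _)
        · rw [logSeq, norm_mul, norm_invDiff hq hθ hn, ← baseRadius_pow_mul hq hr]
          have := ih (m := 0) (by omega)
          rw [add_zero] at this
          calc _ = ‖logRow q θ κ r l n 0‖ * α ^ q ^ n := by field_simp; rfl
            _ ≤ _ := this
      calc _ ≤ ‖logSeq q θ κ r l n‖ * 1 * α ^ q ^ (n + r) := by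
            rw [norm_mul]; gcongr
        _ ≤ _ := by rwa [mul_one]
    · rcases lt_or_ge (m + 1) r with hm' | hm'
      · have := ih hm'
        rwa [show n + (m + 1) = n + 1 + m by omega] at this
      · rw [logRow_eq_zero hl hm', norm_zero, zero_mul]; positivity

/-- `(α q)^{q^n} = α^{q^{n+r}}`, so this is the previous bound in column `0`. The constant `α q` is
the one that `norm_evq` requires. -/
theorem norm_logSeq_le (hq : 1 < q) (hθ : ‖θ‖ = q) (hr : 1 ≤ r)
    (hκ : ∀ i, 1 ≤ i → i ≤ r → ‖κ i‖ ≤ 1) (hl : l < r) (n : ℕ) :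
    ‖logSeq q θ κ r l n‖ * (baseRadius q r * q) ^ q ^ n ≤ baseRadius q r * q := by
  have hα := one_lt_baseRadius hq hr
  have hα0 : 0 < baseRadius q r := by linarith
  have h1 : (1 : ℝ) < q := by exact_mod_cast hq
  rcases eq_or_ne n 0 with rfl | hn
  · rw [logSeq, invDiff, if_pos rfl, one_mul, pow_zero, pow_one]
    exact mul_le_of_le_one_left (by positivity) (norm_logRow_zero_le _)
  · rw [logSeq, norm_mul, norm_invDiff hq hθ hn]
    have := norm_logRow_le hq hθ hr hκ n (m := 0) (by omega) hl
    rw [add_zero, baseRadius_pow hq hr] at this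
    rw [mul_pow]
    calc _ = ‖logRow q θ κ r l n 0‖ * baseRadius q r ^ q ^ n := by field_simp
      _ ≤ _ := this

/-- The terms below the top one add up to `logRow n 0 - [n = l]`, and `logRow n 0 = (θ - θ^{q^n})
s_n` for `n ≥ 1`. At `n = 0` there is no difference to invert: `invDiff` is `1` there, and for `l =
0` no term `τ^l` arises. -/
theorem logSeq_mul_drinfeldSeq (hq : 1 < q) (hθ : ‖θ‖ = q) {σ : C →+* C} (hσ : ∀ x, σ x = x ^ q)
    (hl : l < r) : twistMul σ (logSeq q θ κ r l) (drinfeldSeq θ κ r) =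
      fun n => θ * logSeq q θ κ r l n - if l ≠ 0 ∧ n = l then 1 else 0 := by
  funext n
  rw [twistMul, Finset.Nat.sum_antidiagonal_eq_sum_range_succ
    (fun i j => logSeq q θ κ r l i * (σ ^ i) (drinfeldSeq θ κ r j)), Finset.sum_range_succ,
    Nat.sub_self, ← Finset.sum_range_reflect]
  simp only [frob_pow_apply hσ]
  have h1 : ∑ j ∈ Finset.range n, logSeq q θ κ r l (n - 1 - j) *
      drinfeldSeq θ κ r (n - (n - 1 - j)) ^ q ^ (n - 1 - j) =
      logRow q θ κ r l n 0 - if n = l then 1 else 0 := by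
    rw [logRow_eq_sum hl (by omega), zero_add, add_sub_cancel_right]
    refine Finset.sum_congr rfl fun i hi => ?_
    have := Finset.mem_range.1 hi
    rw [show n - (n - 1 - i) = i + 1 by omega, drinfeldSeq, if_neg (by omega), zero_add]
  rw [h1]
  rcases eq_or_ne n 0 with rfl | hn
  · by_cases hl0 : l = 0
    · subst hl0; simp [logRow, drinfeldSeq, logSeq, invDiff]
    · simp [logRow, drinfeldSeq, logSeq, invDiff, Ne.symm hl0]
  · have h2 : logRow q θ κ r l n 0 = (θ - θ ^ q ^ n) * logSeq q θ κ r l n := by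
      rw [logSeq, invDiff, if_neg hn, mul_inv_cancel_left₀ (theta_sub_ne_zero hq hθ hn)]
    have h3 : (l ≠ 0 ∧ n = l) = (n = l) := propext ⟨fun h => h.2, fun h => ⟨h ▸ hn, h⟩⟩
    simp only [h3]
    rw [h2, drinfeldSeq, if_pos rfl]
    ring

end Analysis

/-! ### The exponential series of a Drinfeld module -/

section ExpSeq

variable {C : Type*} [NormedField C] {q : ℕ} {θ : C} {κ : ℕ → C} {r l : ℕ} {e : ℕ → C}

/-- `e` is the sequence of coefficients of the exponential of `θ + κ 1 τ + ⋯ + κ r τ ^ r`. -/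
def IsExpSeq (q : ℕ) (θ : C) (κ : ℕ → C) (r : ℕ) (e : ℕ → C) : Prop :=
  e 0 = 1 ∧ ∀ n, e n * θ ^ q ^ n =
    ∑ i ∈ Finset.range (n + 1), drinfeldSeq θ κ r i * e (n - i) ^ q ^ i

theorem IsExpSeq.twistMul (he : IsExpSeq q θ κ r e) {σ : C →+* C} (hσ : ∀ x, σ x = x ^ q) :
    twistMul σ (drinfeldSeq θ κ r) e = fun n => e n * θ ^ q ^ n := by
  funext n
  rw [he.2, twistMul_eq_sum_range]
  simp only [frob_pow_apply hσ]

variable [IsUltrametricDist C]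

/-- The recursion reads `e_n (θ - θ^{q^n}) = -∑ κ_i e_{n-i}^{q^i}`, so each step gains a factor
`q^{q^n}`. -/
theorem IsExpSeq.norm_le_of_forall (he : IsExpSeq q θ κ r e) (hq : 1 < q) (hθ : ‖θ‖ = q)
    (hκ : ∀ i, 1 ≤ i → i ≤ r → ‖κ i‖ ≤ 1) {n : ℕ} (hn : n ≠ 0) {B : ℝ} (hB : 0 ≤ B)
    (h : ∀ i, 1 ≤ i → i ≤ r → i ≤ n → ‖e (n - i)‖ ^ q ^ i ≤ B) :
    ‖e n‖ * (q : ℝ) ^ q ^ n ≤ B := by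
  have h1 := he.2 n
  rw [Finset.sum_range_succ', pow_zero, pow_one, Nat.sub_zero] at h1
  have h2 : e n * (θ - θ ^ q ^ n) =
      -∑ i ∈ Finset.range n, drinfeldSeq θ κ r (i + 1) * e (n - (i + 1)) ^ q ^ (i + 1) := by
    rw [mul_sub, h1, drinfeldSeq, if_pos rfl]; ring
  rw [← norm_theta_sub hq hθ hn, ← norm_mul, h2, norm_neg]
  refine IsUltrametricDist.norm_sum_le_of_forall_le_of_nonneg hB fun i hi => ?_
  have hi := Finset.mem_range.1 hi
  rw [drinfeldSeq, if_neg (by omega)]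
  split_ifs with hir
  · rw [norm_mul, norm_pow]
    calc _ ≤ 1 * B := mul_le_mul (hκ _ (by omega) hir) (h _ (by omega) hir (by omega))
          (by positivity) zero_le_one
      _ = B := one_mul _
  · rw [zero_mul, norm_zero]; exact hB

/-- With `R = α q` the induction needs `R^{q^i} ≤ R q^{q^n}` for `i ≤ r` and `i ≤ n`, which follows
from `α^{q^i} ≤ α^{q^r} = R`. The exponential is thus isometric on the same disc as the logarithm.
-/
theorem IsExpSeq.norm_mul_radius_le (he : IsExpSeq q θ κ r e) (hq : 1 < q) (hθ : ‖θ‖ = q)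
    (hr : 1 ≤ r) (hκ : ∀ i, 1 ≤ i → i ≤ r → ‖κ i‖ ≤ 1) (n : ℕ) :
    ‖e n‖ * (baseRadius q r * q) ^ q ^ n ≤ baseRadius q r * q := by
  have hα := one_lt_baseRadius hq hr
  have hαR := baseRadius_pow hq hr
  have h1 : (1 : ℝ) < q := by exact_mod_cast hq
  have hαm := baseRadius_pow_mul hq hr
  set α := baseRadius q r
  set R := α * q with hR
  have hα0 : 0 < α := by linarith
  have hR1 : 1 < R := by nlinarith
  have hR0 : 0 < R := by linarith
  induction n using Nat.strong_induction_on with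
  | _ n ih =>
    rcases eq_or_ne n 0 with rfl | hn
    · rw [he.1]; simp
    have key : ‖e n‖ * (q : ℝ) ^ q ^ n ≤ R * (q : ℝ) ^ q ^ n / R ^ q ^ n := by
      refine he.norm_le_of_forall hq hθ hκ hn (by positivity) fun i hi hir hin => ?_
      have h2 := pow_le_pow_left₀ (by positivity) (ih (n - i) (by omega)) (q ^ i)
      rw [mul_pow, ← pow_mul, ← pow_add, show n - i + i = n by omega] at h2
      rw [le_div_iff₀ (by positivity)]
      refine h2.trans ?_
      have h3 : R ^ q ^ i ≤ R * (q : ℝ) ^ q ^ i := by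
        rw [hR, mul_pow, hαm, ← hR]
        have h4 : α ^ q ^ (i + r) = R ^ q ^ i := by
          rw [add_comm, pow_add, pow_mul, hαR]
        have h5 : R ^ q ^ i * α ^ q ^ i ≤ R ^ q ^ i * R := by
          rw [← hαR]
          gcongr
          · exact hα.le
          · omega
        calc α ^ q ^ (i + r) = R ^ q ^ i * α ^ q ^ i / α ^ q ^ i := by rw [h4]; field_simp
          _ ≤ R ^ q ^ i * R / α ^ q ^ i := by gcongr
          _ = _ := by rw [hR, mul_pow]; field_simp
      refine h3.trans ?_
      gcongr
      · exact h1.le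
      · omega
    rw [mul_comm R, mul_div_assoc, mul_comm, mul_le_mul_iff_right₀ (by positivity),
      le_div_iff₀ (by positivity)] at key
    exact key

/-- The exponential is entire by a bootstrap: a bound `K` at radius `q^N` and the gain `q^{q^n}` of
one recursion step give the bound `K^{q^r}` at radius `q^{N+1}` for `n ≥ 1`. -/
theorem IsExpSeq.exists_norm_mul_pow_le (he : IsExpSeq q θ κ r e) (hq : 1 < q) (hθ : ‖θ‖ = q)
    (hκ : ∀ i, 1 ≤ i → i ≤ r → ‖κ i‖ ≤ 1) (ρ : ℝ) (hρ : 0 ≤ ρ) :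
    ∃ K, 1 ≤ K ∧ ∀ n, ‖e n‖ * ρ ^ q ^ n ≤ K := by
  have h1 : (1 : ℝ) < q := by exact_mod_cast hq
  have hpow : ∀ N : ℕ, ∃ K, 1 ≤ K ∧ ∀ n, ‖e n‖ * ((q : ℝ) ^ N) ^ q ^ n ≤ K := by
    intro N
    induction N with
    | zero =>
      refine ⟨1, le_rfl, fun n => ?_⟩
      rw [pow_zero, one_pow, mul_one]
      induction n using Nat.strong_induction_on with
      | _ n ih =>
        rcases eq_or_ne n 0 with rfl | hn
        · rw [he.1, norm_one]
        have := he.norm_le_of_forall hq hθ hκ hn (B := 1) zero_le_one fun i hi hir hin =>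
          pow_le_one₀ (norm_nonneg _) (ih (n - i) (by omega))
        refine le_trans ?_ this
        exact le_mul_of_one_le_right (norm_nonneg _) (one_le_pow₀ h1.le)
    | succ N ih =>
      obtain ⟨K, hK1, hK⟩ := ih
      refine ⟨max (K ^ q ^ r) ((q : ℝ) ^ (N + 1)), le_max_of_le_left (one_le_pow₀ hK1), fun n => ?_⟩
      rcases eq_or_ne n 0 with rfl | hn
      · rw [he.1, norm_one, one_mul, pow_zero, pow_one]; exact le_max_right _ _
      refine le_max_of_le_left ?_
      have := he.norm_le_of_forall hq hθ hκ hn (B := K ^ q ^ r / ((q : ℝ) ^ N) ^ q ^ n)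
        (by positivity) fun i hi hir hin => ?_
      · rw [le_div_iff₀ (by positivity)] at this
        rwa [pow_succ, mul_pow, mul_comm (((q : ℝ) ^ N) ^ q ^ n), ← mul_assoc]
      · rw [le_div_iff₀ (by positivity)]
        have h2 := pow_le_pow_left₀ (by positivity) (hK (n - i)) (q ^ i)
        rw [mul_pow, ← pow_mul ((q : ℝ) ^ N), ← pow_add, show n - i + i = n by omega] at h2
        exact h2.trans (pow_le_pow_right₀ hK1 (Nat.pow_le_pow_right (by omega) hir))
  obtain ⟨N, hN⟩ := pow_unbounded_of_one_lt ρ h1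
  obtain ⟨K, hK1, hK⟩ := hpow N
  exact ⟨K, hK1, fun n => (by gcongr : ‖e n‖ * ρ ^ q ^ n ≤ _).trans (hK n)⟩

variable [CompleteSpace C]

theorem summable_of_forall_bounded (hq : 1 < q) {a : ℕ → C}
    (h : ∀ ρ : ℝ, 0 ≤ ρ → ∃ K, 1 ≤ K ∧ ∀ n, ‖a n‖ * ρ ^ q ^ n ≤ K) (z : C) :
    Summable fun n => a n * z ^ q ^ n := by
  obtain ⟨K, -, hK⟩ := h (‖z‖ + 1) (by positivity)
  exact summable_qterm hq (lt_add_one _) hK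

theorem IsExpSeq.summable (he : IsExpSeq q θ κ r e) (hq : 1 < q) (hθ : ‖θ‖ = q)
    (hκ : ∀ i, 1 ≤ i → i ≤ r → ‖κ i‖ ≤ 1) (z : C) : Summable fun n => e n * z ^ q ^ n :=
  summable_of_forall_bounded hq (he.exists_norm_mul_pow_le hq hθ hκ) z

/-- The functional equation of the exponential function. -/
theorem IsExpSeq.evq_theta_mul (he : IsExpSeq q θ κ r e) (hq : 1 < q) (hθ : ‖θ‖ = q)
    (hκ : ∀ i, 1 ≤ i → i ≤ r → ‖κ i‖ ≤ 1) {σ : C →+* C} (hσ : ∀ x, σ x = x ^ q) (z : C) :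
    evq q e (θ * z) = θ * evq q e z + ∑ i ∈ Finset.range r, κ (i + 1) * evq q e z ^ q ^ (i + 1) := by
  obtain ⟨K, hK1, hK⟩ := he.exists_norm_mul_pow_le hq hθ hκ (‖z‖ + 1) (by positivity)
  have hφ : ∀ n, n ∉ Finset.range (r + 1) → drinfeldSeq θ κ r n = 0 := by
    intro n hn
    rw [Finset.mem_range] at hn
    rw [drinfeldSeq, if_neg (by omega), if_neg (by omega)]
  -- A polynomial in `τ` is bounded at every radius, in particular at the radius `K` that bounds the
  -- terms of the exponential.
  have hb : ∀ n, ‖drinfeldSeq θ κ r n‖ * K ^ q ^ n ≤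
      ∑ i ∈ Finset.range (r + 1), ‖drinfeldSeq θ κ r i‖ * K ^ q ^ i := by
    intro n
    by_cases hn : n ∈ Finset.range (r + 1)
    · exact Finset.single_le_sum (f := fun i => ‖drinfeldSeq θ κ r i‖ * K ^ q ^ i)
        (fun i _ => by positivity) hn
    · rw [hφ n hn, norm_zero, zero_mul]
      exact Finset.sum_nonneg fun i _ => by positivity
  have h := hasSum_twistMul hq hσ (lt_add_one ‖z‖) hb hK
  rw [he.twistMul hσ] at h
  have h2 : evq q e (θ * z) = evq q (drinfeldSeq θ κ r) (evq q e z) := by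
    rw [← h.tsum_eq, evq]
    congr 1
    funext n
    rw [mul_pow, mul_assoc]
  rw [h2, evq, tsum_eq_sum (s := Finset.range (r + 1)) (fun n hn => by rw [hφ n hn, zero_mul]),
    Finset.sum_range_succ']
  simp only [drinfeldSeq, if_pos, pow_zero, pow_one]
  rw [add_comm]
  congr 1
  refine Finset.sum_congr rfl fun i hi => ?_
  have := Finset.mem_range.1 hi
  rw [if_neg (by omega), if_pos (by omega)]

/-- The coefficients of the composition of `∑ s n τ ^ n` and the exponential. -/
theorem twistMul_logSeq_recursion (he : IsExpSeq q θ κ r e) (hq : 1 < q) (hθ : ‖θ‖ = q)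
    (hl : l < r) {σ : C →+* C} (hσ : ∀ x, σ x = x ^ q) (n : ℕ) :
    twistMul σ (logSeq q θ κ r l) e n * (θ - θ ^ q ^ n) =
      if l ≠ 0 ∧ l ≤ n then e (n - l) ^ q ^ l else 0 := by
  -- Associativity in `S φ_θ exp`: one bracketing is `S exp θ`, the other is `θ S exp - τ^l exp`
  -- (without `τ^l exp` if `l = 0`).
  have h1 := twistMul_assoc σ (logSeq q θ κ r l) (drinfeldSeq θ κ r) e
  have h2 : twistMul σ (drinfeldSeq θ κ r) e = twistMul σ e (Pi.single 0 θ) := by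
    rw [he.twistMul hσ, twistMul_single_right]
    simp only [frob_pow_apply hσ]
  rw [h2, ← twistMul_assoc, twistMul_single_right, logSeq_mul_drinfeldSeq hq hθ hσ hl] at h1
  have h3 := congrFun h1 n
  have h4 : (fun n => θ * logSeq q θ κ r l n - if l ≠ 0 ∧ n = l then 1 else 0) =
      (fun n => θ * logSeq q θ κ r l n) - fun n => if l ≠ 0 ∧ n = l then 1 else 0 := rfl
  rw [h4, twistMul_sub_left, ← twistMul_single_left σ, twistMul_assoc, twistMul_single_left,
    Pi.sub_apply, frob_pow_apply hσ] at h3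
  rw [mul_sub, ← h3, mul_comm, sub_sub_cancel, twistMul_eq_sum_range]
  simp only [frob_pow_apply hσ]
  split_ifs with h
  · rw [Finset.sum_eq_single l]
    · simp [h.1]
    · intro b _ hb; simp [hb]
    · intro hb; rw [Finset.mem_range] at hb; omega
  · refine Finset.sum_eq_zero fun i hi => ?_
    have := Finset.mem_range.1 hi
    rw [if_neg (by omega), zero_mul]

theorem twistMul_logSeq_zero (he : IsExpSeq q θ κ r e) {σ : C →+* C} :
    twistMul σ (logSeq q θ κ r l) e 0 = if l = 0 then 1 else 0 := by
  simp [twistMul_eq_sum_range, he.1, logSeq, invDiff, logRow, eq_comm]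

theorem twistMul_logSeq_eq_single (he : IsExpSeq q θ κ r e) (hq : 1 < q) (hθ : ‖θ‖ = q)
    (hr : 0 < r) {σ : C →+* C} (hσ : ∀ x, σ x = x ^ q) :
    twistMul σ (logSeq q θ κ r 0) e = Pi.single 0 1 := by
  funext n
  rcases eq_or_ne n 0 with rfl | hn
  · rw [twistMul_logSeq_zero he]; simp
  · have := twistMul_logSeq_recursion he hq hθ hr hσ n
    rw [if_neg (by simp), mul_eq_zero, or_iff_left (theta_sub_ne_zero hq hθ hn)] at this
    rw [this]; simp [hn]

/-- The logarithm is inverse to the exponential. -/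
theorem evq_logSeq_evq (he : IsExpSeq q θ κ r e) (hq : 1 < q) (hθ : ‖θ‖ = q)
    (hr : 1 ≤ r) (hκ : ∀ i, 1 ≤ i → i ≤ r → ‖κ i‖ ≤ 1) {σ : C →+* C} (hσ : ∀ x, σ x = x ^ q)
    {z : C} (hz : ‖z‖ < baseRadius q r * q) :
    evq q (logSeq q θ κ r 0) (evq q e z) = z := by
  have h := hasSum_twistMul hq hσ hz (norm_logSeq_le hq hθ hr hκ hr)
    (he.norm_mul_radius_le hq hθ hr hκ)
  rw [twistMul_logSeq_eq_single he hq hθ hr hσ] at h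
  refine h.unique ?_
  have := hasSum_single (f := fun n => (Pi.single 0 1 : ℕ → C) n * z ^ q ^ n) 0
    (fun n hn => by simp [hn])
  simpa using this

/-- Put `w = exp (log y)`. The other composition gives `log w = log y`, hence `log (w - y) = 0`, and
`log` is isometric on the disc. -/
theorem evq_evq_logSeq (he : IsExpSeq q θ κ r e) (hq : 1 < q) (hθ : ‖θ‖ = q)
    (hr : 1 ≤ r) (hκ : ∀ i, 1 ≤ i → i ≤ r → ‖κ i‖ ≤ 1) {σ : C →+* C} (hσ : ∀ x, σ x = x ^ q)
    {y : C} (hy : ‖y‖ < baseRadius q r * q) :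
    evq q e (evq q (logSeq q θ κ r 0) y) = y := by
  have hL := norm_logSeq_le hq hθ hr hκ (show 0 < r from hr)
  have hL0 : logSeq q θ κ r 0 0 = 1 := by simp [logSeq, invDiff, logRow]
  have hE := he.norm_mul_radius_le hq hθ hr hκ
  set z := evq q (logSeq q θ κ r 0) y with hz
  have hzn : ‖z‖ = ‖y‖ := norm_evq hq hy hL0 hL
  have hzR : ‖z‖ < baseRadius q r * q := hzn ▸ hy
  have hwn : ‖evq q e z‖ = ‖y‖ := (norm_evq hq hzR he.1 hE).trans hzn
  have hwR : ‖evq q e z‖ < baseRadius q r * q := hwn ▸ hy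
  have h1 : evq q (logSeq q θ κ r 0) (evq q e z) = z := evq_logSeq_evq he hq hθ hr hκ hσ hzR
  have hd : ‖evq q e z - y‖ < baseRadius q r * q := by
    rw [sub_eq_add_neg]
    exact (IsUltrametricDist.norm_add_le_max _ _).trans_lt (max_lt hwR (by rwa [norm_neg]))
  have h2 := evq_add hσ (summable_qterm hq hd hL) (summable_qterm hq hy hL)
  rw [sub_add_cancel, h1, ← hz, right_eq_add] at h2
  have h3 := norm_evq hq hd hL0 hL
  rw [h2, norm_zero, eq_comm, norm_eq_zero, sub_eq_zero] at h3
  exact h3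

end ExpSeq

/-! ### Quasi-periodic functions -/

section QuasiPeriodic

variable {C : Type*} [NormedField C] {q : ℕ} {θ : C} {κ : ℕ → C} {r l : ℕ} {e : ℕ → C}

theorem hasSum_frob_pow {σ : C →+* C} (hσ : ∀ x, σ x = x ^ q) {f : ℕ → C} {x : C} (h : HasSum f x)
    (n : ℕ) : HasSum (fun m => f m ^ q ^ n) (x ^ q ^ n) := by
  have h := h.map (σ ^ n) (by
    have : ((σ ^ n : C →+* C) : C → C) = fun x => x ^ q ^ n := funext (frob_pow_apply hσ n)
    rw [this]; fun_prop)
  rw [frob_pow_apply hσ] at h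
  exact h.congr_fun fun m => (frob_pow_apply hσ n _).symm

/-- A power series over an ultrametric field that vanishes identically is zero. -/
theorem coeff_eq_zero_of_hasSum_zero [IsUltrametricDist C] (hq : 1 < q) (hθ : ‖θ‖ = q) {c : ℕ → C}
    (h : ∀ z, HasSum (fun n => c n * z ^ n) 0) (N : ℕ) : c N = 0 := by
  have h1 : (1 : ℝ) < q := by exact_mod_cast hq
  induction N using Nat.strong_induction_on with
  | _ N ih =>
    obtain ⟨K, hK⟩ : ∃ K, ∀ n, ‖c n‖ ≤ K := by
      have h2 := (h 1).summable.tendsto_atTop_zero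
      simp only [one_pow, mul_one] at h2
      obtain ⟨K, hK⟩ := h2.norm.bddAbove_range
      exact ⟨K, fun n => hK ⟨n, rfl⟩⟩
    have hK0 : 0 ≤ K := (norm_nonneg _).trans (hK 0)
    have hle : ∀ M : ℕ, ‖c N‖ ≤ K * ((q : ℝ)⁻¹) ^ M := by
      intro M
      -- Since the lower coefficients vanish, `c N * z ^ N` is minus the tail, of norm at most `K
      -- ‖z‖^{N+1}`; then `M` tends to infinity.
      set z : C := θ⁻¹ ^ M with hz
      have hzn : ‖z‖ = (q : ℝ)⁻¹ ^ M := by rw [hz, norm_pow, norm_inv, hθ]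
      have hz1 : ‖z‖ ≤ 1 := by
        rw [hzn]
        exact pow_le_one₀ (by positivity) (inv_le_one_of_one_le₀ h1.le)
      have hz0 : z ≠ 0 := by
        rw [← norm_ne_zero_iff, hzn]
        positivity
      have h3 := (hasSum_nat_add_iff' (N + 1)).2 (h z)
      rw [Finset.sum_range_succ, Finset.sum_eq_zero (fun i hi => by
        rw [ih i (Finset.mem_range.1 hi), zero_mul]), zero_add, zero_sub] at h3
      have h4 : ‖c N * z ^ N‖ ≤ K * ‖z‖ ^ (N + 1) := by
        rw [← norm_neg, ← h3.tsum_eq]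
        refine IsUltrametricDist.norm_tsum_le_of_forall_le_of_nonneg (by positivity) fun n => ?_
        rw [norm_mul, norm_pow, pow_add ‖z‖ n]
        have : ‖z‖ ^ n ≤ 1 := pow_le_one₀ (norm_nonneg _) hz1
        calc ‖c (n + (N + 1))‖ * (‖z‖ ^ n * ‖z‖ ^ (N + 1)) ≤ K * (1 * ‖z‖ ^ (N + 1)) := by
              gcongr
              exact hK _
          _ = _ := by rw [one_mul]
      rw [norm_mul, norm_pow, pow_succ', ← mul_assoc] at h4
      rw [← hzn]
      exact le_of_mul_le_mul_right h4 (pow_pos (norm_pos_iff.2 hz0) _)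
    have hlim : Filter.Tendsto (fun M : ℕ => K * ((q : ℝ)⁻¹) ^ M) Filter.atTop (nhds 0) := by
      have := (tendsto_pow_atTop_nhds_zero_of_lt_one (inv_nonneg.2 (by linarith : (0 : ℝ) ≤ q))
        (inv_lt_one_of_one_lt₀ h1)).const_mul K
      rwa [mul_zero] at this
    have := ge_of_tendsto' hlim hle
    exact norm_le_zero_iff.1 this

/-- `F` is an entire function without linear term such that
`F (θ z) - θ F z = (∑ e n z ^ (q ^ n)) ^ (q ^ l)`. -/
def IsQuasiPeriodicFor (q : ℕ) (θ : C) (e : ℕ → C) (l : ℕ) (F : C → C) : Prop :=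
  (∃ a : ℕ → C, a 1 = 0 ∧ ∀ z, HasSum (fun n => a n * z ^ n) (F z)) ∧
    ∀ z, F (θ * z) - θ * F z = evq q e z ^ q ^ l

/-- The functional equation forces `(a_n - b_n)(θ^n - θ) = 0`. The second factor vanishes only at `n
= 1`, which is where the normalisation of the linear term enters. -/
theorem IsQuasiPeriodicFor.unique [IsUltrametricDist C] (hq : 1 < q) (hθ : ‖θ‖ = q)
    {F G : C → C} (hF : IsQuasiPeriodicFor q θ e l F) (hG : IsQuasiPeriodicFor q θ e l G) :
    F = G := by
  have h1 : (1 : ℝ) < q := by exact_mod_cast hq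
  obtain ⟨⟨a, ha1, ha⟩, hF⟩ := hF
  obtain ⟨⟨b, hb1, hb⟩, hG⟩ := hG
  have h2 : ∀ z, HasSum (fun n => (a n - b n) * (θ ^ n - θ) * z ^ n) 0 := by
    intro z
    have h3 := ((ha (θ * z)).sub ((ha z).mul_left θ)).sub ((hb (θ * z)).sub ((hb z).mul_left θ))
    rw [hF, hG, sub_self] at h3
    refine h3.congr_fun fun n => ?_
    rw [mul_pow]; ring
  have h3 := coeff_eq_zero_of_hasSum_zero hq hθ h2
  have hab : a = b := by
    funext n
    rcases eq_or_ne n 1 with rfl | hn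
    · rw [ha1, hb1]
    · have h4 : θ ^ n - θ ≠ 0 := by
        intro h
        have h5 := congrArg norm (sub_eq_zero.1 h)
        rw [norm_pow, hθ] at h5
        exact hn (pow_right_injective₀ (by linarith) h1.ne' (h5.trans (pow_one _).symm))
      exact sub_eq_zero.1 ((mul_eq_zero.1 (h3 n)).resolve_right h4)
  funext z
  exact (ha z).unique (hab ▸ hb z)

variable [IsUltrametricDist C] [CompleteSpace C]

/-- Away from `n = 0` the recursion bounds the coefficients of `S exp` by those of `exp^{q^l}`. The
composite is therefore entire, although the bounds on `S` itself only give convergence on a disc. -/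
theorem twistMul_logSeq_bounded (he : IsExpSeq q θ κ r e) (hq : 1 < q) (hθ : ‖θ‖ = q)
    (hκ : ∀ i, 1 ≤ i → i ≤ r → ‖κ i‖ ≤ 1) {σ : C →+* C} (hσ : ∀ x, σ x = x ^ q) (hl : l < r)
    (ρ : ℝ) (hρ : 0 ≤ ρ) :
    ∃ K, 1 ≤ K ∧ ∀ n, ‖twistMul σ (logSeq q θ κ r l) e n‖ * ρ ^ q ^ n ≤ K := by
  have h1 : (1 : ℝ) < q := by exact_mod_cast hq
  obtain ⟨K, hK1, hK⟩ := he.exists_norm_mul_pow_le hq hθ hκ ρ hρ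
  refine ⟨max (K ^ q ^ l) (max 1 ρ), le_max_of_le_right (le_max_left _ _), fun n => ?_⟩
  rcases eq_or_ne n 0 with rfl | hn
  · rw [twistMul_logSeq_zero he, pow_zero, pow_one]
    split_ifs
    · simp
    · simp only [norm_zero, zero_mul, le_sup_iff, zero_le_one, true_or, or_true]
  · refine le_max_of_le_left ?_
    have h2 := congrArg norm (twistMul_logSeq_recursion he hq hθ hl hσ n)
    rw [norm_mul, norm_theta_sub hq hθ hn] at h2
    have h3 : ‖twistMul σ (logSeq q θ κ r l) e n‖ ≤
        ‖if l ≠ 0 ∧ l ≤ n then e (n - l) ^ q ^ l else 0‖ := by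
      rw [← h2]
      exact le_mul_of_one_le_right (norm_nonneg _) (one_le_pow₀ h1.le)
    refine (mul_le_mul_of_nonneg_right h3 (by positivity)).trans ?_
    split_ifs with h
    · rw [norm_pow]
      have h4 := pow_le_pow_left₀ (by positivity) (hK (n - l)) (q ^ l)
      rwa [mul_pow, ← pow_mul ρ, ← pow_add, Nat.sub_add_cancel h.2] at h4
    · rw [norm_zero, zero_mul]; positivity

/-- `twistMul_logSeq_recursion` is the functional equation read off coefficient by coefficient. The
linear term is the coefficient of `τ^0`, which vanishes because `l ≠ 0`. -/
theorem isQuasiPeriodicFor_neg_evq (he : IsExpSeq q θ κ r e) (hq : 1 < q) (hθ : ‖θ‖ = q)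
    (hκ : ∀ i, 1 ≤ i → i ≤ r → ‖κ i‖ ≤ 1) {σ : C →+* C} (hσ : ∀ x, σ x = x ^ q) (hl : l < r)
    (hl1 : l ≠ 0) :
    IsQuasiPeriodicFor q θ e l fun z => -evq q (twistMul σ (logSeq q θ κ r l) e) z := by
  set h := twistMul σ (logSeq q θ κ r l) e with hh
  have hs := summable_of_forall_bounded hq (twistMul_logSeq_bounded he hq hθ hκ hσ hl)
  have hinj : Function.Injective fun n : ℕ => q ^ n := Nat.pow_right_injective hq
  have hrec := twistMul_logSeq_recursion he hq hθ hl hσ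
  refine ⟨⟨Function.extend (fun n : ℕ => q ^ n) (-h) 0, ?_, fun z => ?_⟩, fun z => ?_⟩
  · have := hinj.extend_apply (-h) 0 0
    rw [pow_zero] at this
    rw [this, Pi.neg_apply, hh, twistMul_logSeq_zero he, if_neg hl1, neg_zero]
  · rw [← hinj.hasSum_iff]
    · refine (hs z).hasSum.neg.congr_fun fun n => ?_
      simp only [Function.comp, hinj.extend_apply, Pi.neg_apply, neg_mul]
      rfl
    · intro x hx
      rw [Function.extend_apply' _ _ _ (by simpa using hx), Pi.zero_apply, zero_mul]
  · have h1 := hasSum_frob_pow hσ (he.summable hq hθ hκ z).hasSum l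
    have h2 : HasSum (fun n => h n * (θ - θ ^ q ^ n) * z ^ q ^ n) (evq q e z ^ q ^ l) := by
      rw [← (add_left_injective l).hasSum_iff]
      · refine h1.congr_fun fun n => ?_
        simp only [Function.comp]
        rw [hrec, if_pos ⟨hl1, by omega⟩, Nat.add_sub_cancel, mul_pow, ← pow_mul z, ← pow_add]
      · intro n hn
        rw [hrec, if_neg, zero_mul]
        rintro ⟨-, h3⟩
        exact hn ⟨n - l, Nat.sub_add_cancel h3⟩
    change -evq q h (θ * z) - θ * -evq q h z = _
    rw [← h2.tsum_eq, mul_neg, sub_neg_eq_add]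
    unfold evq
    rw [← tsum_mul_left, neg_add_eq_sub, ← ((hs z).mul_left θ).tsum_sub (hs (θ * z))]
    congr 1
    funext n
    rw [mul_pow]; ring

theorem existsUnique_isQuasiPeriodicFor (he : IsExpSeq q θ κ r e) (hq : 1 < q) (hθ : ‖θ‖ = q)
    (hκ : ∀ i, 1 ≤ i → i ≤ r → ‖κ i‖ ≤ 1) {σ : C →+* C} (hσ : ∀ x, σ x = x ^ q) (hl : l < r)
    (hl1 : l ≠ 0) : ∃! F, IsQuasiPeriodicFor q θ e l F :=
  ⟨_, isQuasiPeriodicFor_neg_evq he hq hθ hκ hσ hl hl1, fun _ hG =>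
    hG.unique hq hθ (isQuasiPeriodicFor_neg_evq he hq hθ hκ hσ hl hl1)⟩

/-- Uniqueness identifies `F` with minus the formal composite of `S` and `exp`; the disc is needed
for the formal composite to be the composite of functions. -/
theorem IsQuasiPeriodicFor.evq_logSeq_evq {F : C → C} (hF : IsQuasiPeriodicFor q θ e l F)
    (he : IsExpSeq q θ κ r e) (hq : 1 < q) (hθ : ‖θ‖ = q)
    (hr : 1 ≤ r) (hκ : ∀ i, 1 ≤ i → i ≤ r → ‖κ i‖ ≤ 1) {σ : C →+* C} (hσ : ∀ x, σ x = x ^ q)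
    (hl : l < r) (hl1 : l ≠ 0) {z : C} (hz : ‖z‖ < baseRadius q r * q) :
    evq q (logSeq q θ κ r l) (evq q e z) = -F z := by
  have h := hasSum_twistMul hq hσ hz (norm_logSeq_le hq hθ hr hκ hl)
    (he.norm_mul_radius_le hq hθ hr hκ)
  rw [hF.unique hq hθ (isQuasiPeriodicFor_neg_evq he hq hθ hκ hσ hl hl1), neg_neg, ← h.tsum_eq, evq]

end QuasiPeriodic

/-! ### The `t`-motive of the tensor product -/

section Motive

open Polynomial

variable {K : Type*} [Field K]

/-- The entry `(i, j)` of `d[θ]^{(n)}` for the tensor product. -/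
def tensD (q : ℕ) (θ : K) (r n i j : ℕ) : K :=
  if i = j then θ ^ q ^ n else if i + r = j then 1 else 0

/-- The entry `(i, j)` of `A_1^{(n)}` for the tensor product. -/
def tensA (q : ℕ) (κ : ℕ → K) (r k n i j : ℕ) : K :=
  if i = r * k then (if j < r then κ (j + 1) ^ q ^ n else 0)
  else if i + r = j + (r * k + 1) then 1 else 0

variable {q : ℕ} {θ : K} {κ : ℕ → K} {r k : ℕ}

theorem sum_tensD_smul {Y : Type*} [AddCommGroup Y] [Module K Y] (hr : 1 ≤ r) (n : ℕ) {i : ℕ}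
    (hi : i ≤ r * k) (y : ℕ → Y) : ∑ j ∈ Finset.range (r * k + 1), tensD q θ r n i j • y j =
      θ ^ q ^ n • y i + if i + r ≤ r * k then y (i + r) else 0 := by
  have h : ∀ j, tensD q θ r n i j • y j =
      (if i = j then θ ^ q ^ n • y j else 0) + if i + r = j then y j else 0 := by
    intro j
    unfold tensD
    by_cases h1 : i = j
    · simp [h1, show r ≠ 0 by omega]
    · by_cases h2 : i + r = j <;> simp [h1, h2]
  simp only [h, Finset.sum_add_distrib, Finset.sum_ite_eq, Finset.mem_range]
  rw [if_pos (by omega)]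
  simp only [Nat.lt_succ_iff]

theorem sum_tensA_smul {Y : Type*} [AddCommGroup Y] [Module K Y] (hk : 1 ≤ k) (n : ℕ)
    {i : ℕ} (hi : i ≤ r * k) (y : ℕ → Y) :
    ∑ j ∈ Finset.range (r * k + 1), tensA q κ r k n i j • y j =
      if i = r * k then ∑ j ∈ Finset.range r, κ (j + 1) ^ q ^ n • y j
      else if r * k + 1 ≤ i + r then y (i + r - (r * k + 1)) else 0 := by
  have hrk : r ≤ r * k := Nat.le_mul_of_pos_right _ (by omega)
  by_cases h1 : i = r * k
  · simp only [tensA, h1, if_true, ite_smul, zero_smul]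
    rw [← Finset.sum_filter]
    congr 1
    ext j
    simp only [Finset.mem_filter, Finset.mem_range]
    omega
  · simp only [tensA, h1, if_false, ite_smul, zero_smul, one_smul]
    split_ifs with h2
    · rw [Finset.sum_eq_single (i + r - (r * k + 1))]
      · rw [if_pos (by omega)]
      · intro j _ hj
        rw [if_neg (by omega)]
      · intro h
        rw [Finset.mem_range] at h
        omega
    · exact Finset.sum_eq_zero fun j _ => if_neg (by omega)

theorem sum_mul_tensD (hr : 1 ≤ r) (n : ℕ) {j : ℕ} (hj : j ≤ r * k) (p : ℕ → K) :
    ∑ i ∈ Finset.range (r * k + 1), p i * tensD q θ r n i j =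
      p j * θ ^ q ^ n + if r ≤ j then p (j - r) else 0 := by
  have h : ∀ i, p i * tensD q θ r n i j =
      (if i = j then p i * θ ^ q ^ n else 0) + if i + r = j then p i else 0 := by
    intro i
    unfold tensD
    by_cases h1 : i = j
    · simp [h1, show r ≠ 0 by omega]
    · by_cases h2 : i + r = j <;> simp [h1, h2]
  simp only [h, Finset.sum_add_distrib, Finset.sum_ite_eq', Finset.mem_range]
  rw [if_pos (by omega)]
  congr 1
  split_ifs with h2
  · rw [Finset.sum_eq_single (j - r)]
    · rw [if_pos (by omega)]
    · intro i _ hi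
      rw [if_neg (by omega)]
    · intro h
      rw [Finset.mem_range] at h
      omega
  · exact Finset.sum_eq_zero fun i _ => if_neg (by omega)

theorem sum_mul_tensA (hk : 1 ≤ k) (n : ℕ) (j : ℕ) (p : ℕ → K) :
    ∑ i ∈ Finset.range (r * k + 1), p i * tensA q κ r k n i j =
      if j < r then p (r * k) * κ (j + 1) ^ q ^ n +
        if j + 1 < r then p (r * (k - 1) + (j + 1)) else 0 else 0 := by
  have hrk : r * (k - 1) + r = r * k := by
    rw [← Nat.mul_succ, Nat.succ_eq_add_one, Nat.sub_add_cancel hk]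
  rw [Finset.sum_range_succ]
  have h1 : ∑ i ∈ Finset.range (r * k), p i * tensA q κ r k n i j =
      if j + 1 < r then p (r * (k - 1) + (j + 1)) else 0 := by
    split_ifs with h
    · rw [Finset.sum_eq_single (r * (k - 1) + (j + 1))]
      · rw [tensA, if_neg (by omega), if_pos (by omega), mul_one]
      · intro i hi hij
        rw [Finset.mem_range] at hi
        rw [tensA, if_neg (by omega), if_neg (by omega), mul_zero]
      · intro hi
        rw [Finset.mem_range] at hi
        omega
    · refine Finset.sum_eq_zero fun i hi => ?_
      rw [Finset.mem_range] at hi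
      rw [tensA, if_neg (by omega), if_neg (by omega), mul_zero]
  rw [h1, tensA, if_pos rfl]
  by_cases h2 : j < r
  · rw [if_pos h2, if_pos h2, add_comm]
  · rw [if_neg h2, if_neg h2, if_neg (by omega), mul_zero, add_zero]

/-- The sequence of row vectors of polynomials `τ ^ m` expressed in the basis `1, …, τ ^ (r - 1)` of
the `t`-motive of `φ`. -/
structure IsMotiveSeq (q : ℕ) (θ : K) (κ : ℕ → K) (r : ℕ) (ε : ℕ → Fin r → K[X]) : Prop where
  init : ∀ m < r, ∀ μ : Fin r, ε m μ = if m = μ then 1 else 0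
  recursion : ∀ n μ, ∑ i ∈ Finset.range r, κ (i + 1) ^ q ^ n • ε (n + i + 1) μ =
    (X - C (θ ^ q ^ n)) * ε n μ

/-- The product `(t - θ) ⋯ (t - θ ^ (q ^ (n - 1)))`. -/
def carlitzProd (q : ℕ) (θ : K) (n : ℕ) : K[X] := ∏ i ∈ Finset.range n, (X - C (θ ^ q ^ i))

/-- The coordinates of `τ ^ n g_l` with respect to the basis `m_1, …, m_r` of the `t`-motive of the
tensor product. -/
def motRow (q : ℕ) (θ : K) (r k : ℕ) (ε : ℕ → Fin r → K[X]) (n l : ℕ) : Fin r → K[X] := fun μ =>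
  carlitzProd q θ n ^ k * (X - C (θ ^ q ^ n)) ^ (l / r) * ε (n + l % r) μ

variable {ε : ℕ → Fin r → K[X]}

/-- The action of `t` on the motive. -/
theorem X_smul_motRow (hε : IsMotiveSeq q θ κ r ε) (hr : 1 ≤ r) (hk : 1 ≤ k) (n : ℕ) {l : ℕ}
    (hl : l ≤ r * k) : (X : K[X]) • motRow q θ r k ε n l =
      ∑ j ∈ Finset.range (r * k + 1), tensD q θ r n l j • motRow q θ r k ε n j +
      ∑ j ∈ Finset.range (r * k + 1), tensA q κ r k n l j • motRow q θ r k ε (n + 1) j := by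
  have hrk : r * (k - 1) + r = r * k := by
    rw [← Nat.mul_succ, Nat.succ_eq_add_one, Nat.sub_add_cancel hk]
  rw [sum_tensD_smul hr n hl, sum_tensA_smul hk n hl, add_assoc, ← sub_eq_iff_eq_add']
  funext μ
  have h0 : ((X : K[X]) • motRow q θ r k ε n l - θ ^ q ^ n • motRow q θ r k ε n l) μ =
      (X - C (θ ^ q ^ n)) * motRow q θ r k ε n l μ := by
    simp only [Pi.sub_apply, Pi.smul_apply, smul_eq_mul, smul_eq_C_mul]
    ring
  rw [h0]
  have hD : carlitzProd q θ (n + 1) = carlitzProd q θ n * (X - C (θ ^ q ^ n)) :=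
    Finset.prod_range_succ _ _
  rcases lt_or_ge (r * k) (l + r) with h1 | h1
  -- Here multiplication by `t - θ^{q^n}` completes a `k`-th power, so `carlitzProd n ^ k` becomes
  -- `carlitzProd (n + 1) ^ k` and the level rises by one. For `l = r k` a further factor remains,
  -- and the recursion of `ε` absorbs it.
  · rw [if_neg (by omega), zero_add]
    split_ifs with h2 h3
    · subst h2
      simp only [Finset.sum_apply, Pi.smul_apply, motRow]
      rw [Nat.mul_div_cancel_left _ (by omega), Nat.mul_mod_right, add_zero, hD, mul_pow]
      have h4 : ∀ i ∈ Finset.range r, κ (i + 1) ^ q ^ n •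
          ((carlitzProd q θ n ^ k * (X - C (θ ^ q ^ n)) ^ k) *
            (X - C (θ ^ q ^ (n + 1))) ^ (i / r) * ε (n + 1 + i % r) μ) =
          (carlitzProd q θ n ^ k * (X - C (θ ^ q ^ n)) ^ k) *
            (κ (i + 1) ^ q ^ n • ε (n + i + 1) μ) := by
        intro i hi
        have hi := Finset.mem_range.1 hi
        rw [Nat.div_eq_of_lt hi, Nat.mod_eq_of_lt hi, pow_zero, mul_one, mul_smul_comm,
          show n + 1 + i = n + i + 1 by omega]
      rw [Finset.sum_congr rfl h4, ← Finset.mul_sum, hε.recursion]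
      ring
    · obtain ⟨m, rfl⟩ : ∃ m, l = r * (k - 1) + (m + 1) := ⟨l - r * (k - 1) - 1, by omega⟩
      have hm : m + 1 < r := by omega
      rw [show r * (k - 1) + (m + 1) + r - (r * k + 1) = m by omega]
      simp only [motRow]
      rw [Nat.mul_add_div (by omega), Nat.mul_add_mod, Nat.div_eq_of_lt hm, Nat.mod_eq_of_lt hm,
        Nat.div_eq_of_lt (by omega : m < r), Nat.mod_eq_of_lt (by omega : m < r), hD, mul_pow,
        show n + 1 + m = n + (m + 1) by omega, add_zero, pow_zero, mul_one]
      conv_rhs => rw [show k = k - 1 + 1 by omega, pow_succ (X - C (θ ^ q ^ n)), ← show k = k - 1 + 1 by omega]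
      ring
    · omega
  · rw [if_pos h1, if_neg (by omega), if_neg (by omega), add_zero]
    simp only [motRow]
    rw [Nat.add_div_right _ (by omega), Nat.add_mod_right, pow_succ]
    ring

/-- A family that satisfies the relations of the `t`-action is determined by its first members. -/
theorem eq_zero_of_relations {Y : Type*} [AddCommGroup Y] [Module K Y] (T : Y →ₗ[K] Y)
    (hr : 1 ≤ r) (hk : 1 ≤ k) (hκr : κ r ≠ 0) (y : ℕ → ℕ → Y)
    (h : ∀ n l, l ≤ r * k → T (y n l) =
      ∑ j ∈ Finset.range (r * k + 1), tensD q θ r n l j • y n j +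
      ∑ j ∈ Finset.range (r * k + 1), tensA q κ r k n l j • y (n + 1) j)
    (h0 : ∀ l < r, y 0 l = 0) (n l : ℕ) (hl : l ≤ r * k) : y n l = 0 := by
  have hrk : r * (k - 1) + r = r * k := by
    rw [← Nat.mul_succ, Nat.succ_eq_add_one, Nat.sub_add_cancel hk]
  -- Within a level, the entries `1` of `d[θ]` in the places `(l - r, l)` propagate the vanishing
  -- from the first `r` members to all.
  have hstep : ∀ n, (∀ l < r, y n l = 0) → ∀ l, l ≤ r * k → y n l = 0 := by
    intro n hn l
    induction l using Nat.strong_induction_on with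
    | _ l ih =>
      intro hl
      rcases lt_or_ge l r with hlr | hlr
      · exact hn l hlr
      · have h1 := h n (l - r) (by omega)
        rw [sum_tensD_smul hr n (by omega), sum_tensA_smul hk n (by omega),
          ih (l - r) (by omega) (by omega), map_zero, smul_zero, zero_add, if_pos (by omega),
          if_neg (by omega), if_neg (by omega), add_zero, Nat.sub_add_cancel hlr] at h1
        exact h1.symm
  induction n generalizing l with
  | zero => exact hstep 0 h0 l hl
  | succ n ih =>
    refine hstep (n + 1) ?_ l hl
    -- The unit rows of `A_1` give the members `0, …, r - 2` of the next level; the last row then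
    -- gives member `r - 1`, because `κ r ≠ 0`.
    have h2 : ∀ m, m + 1 < r → y (n + 1) m = 0 := by
      intro m hm
      have h1 := h n (r * (k - 1) + (m + 1)) (by omega)
      rw [sum_tensD_smul hr n (by omega), sum_tensA_smul hk n (by omega),
        ih _ (by omega), map_zero, smul_zero, zero_add, if_neg (by omega),
        if_neg (by omega), if_pos (by omega), zero_add,
        show r * (k - 1) + (m + 1) + r - (r * k + 1) = m by omega] at h1
      exact h1.symm
    intro m hm
    rcases Nat.lt_or_ge (m + 1) r with h3 | h3
    · exact h2 m h3
    · have h1 := h n (r * k) le_rfl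
      rw [sum_tensD_smul hr n le_rfl, sum_tensA_smul hk n le_rfl, ih _ le_rfl, map_zero,
        smul_zero, zero_add, if_neg (by omega), if_pos rfl, zero_add,
        Finset.sum_eq_single m] at h1
      · rw [show m + 1 = r by omega] at h1
        exact (smul_eq_zero.1 h1.symm).resolve_left (pow_ne_zero _ hκr)
      · intro j hj hjm
        rw [Finset.mem_range] at hj
        rw [h2 j (by omega), smul_zero]
      · intro hj
        rw [Finset.mem_range] at hj
        omega

end Motive

/-! ### Gauss norms -/

section Gauss

open Polynomial

variable {K : Type*} [NormedField K] [IsUltrametricDist K]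

/-- The Gauss norm of radius `ρ` of the polynomial `f` is at most `B`. -/
def GaussLe (ρ : ℝ) (f : K[X]) (B : ℝ) : Prop := ∀ ν, ‖f.coeff ν‖ * ρ ^ ν ≤ B

variable {ρ : ℝ} {f g : K[X]} {A B : ℝ}

theorem GaussLe.nonneg (h : GaussLe ρ f B) : 0 ≤ B := (by positivity : 0 ≤ ‖f.coeff 0‖ * ρ ^ 0).trans (h 0)

theorem GaussLe.mono (h : GaussLe ρ f A) (hAB : A ≤ B) : GaussLe ρ f B := fun ν => (h ν).trans hAB

theorem GaussLe.zero (hB : 0 ≤ B) : GaussLe ρ (0 : K[X]) B := fun ν => by simpa using hB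

theorem GaussLe.add (hρ : 0 ≤ ρ) (hf : GaussLe ρ f B) (hg : GaussLe ρ g B) :
    GaussLe ρ (f + g) B := by
  intro ν
  rw [coeff_add]
  rcases le_max_iff.1 (IsUltrametricDist.norm_add_le_max (f.coeff ν) (g.coeff ν)) with h | h
  · exact (mul_le_mul_of_nonneg_right h (by positivity)).trans (hf ν)
  · exact (mul_le_mul_of_nonneg_right h (by positivity)).trans (hg ν)

theorem GaussLe.neg (hf : GaussLe ρ f B) : GaussLe ρ (-f) B := by
  intro ν
  rw [coeff_neg, norm_neg]; exact hf ν

theorem GaussLe.sub (hρ : 0 ≤ ρ) (hf : GaussLe ρ f B) (hg : GaussLe ρ g B) :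
    GaussLe ρ (f - g) B := by
  rw [sub_eq_add_neg]; exact hf.add hρ hg.neg

theorem GaussLe.sum {ι : Type*} (hρ : 0 ≤ ρ) (hB : 0 ≤ B) (s : Finset ι) (F : ι → K[X])
    (h : ∀ i ∈ s, GaussLe ρ (F i) B) : GaussLe ρ (∑ i ∈ s, F i) B := by
  classical
  induction s using Finset.induction_on with
  | empty => simpa using GaussLe.zero hB
  | insert a s ha ih =>
    rw [Finset.sum_insert ha]
    exact (h a (Finset.mem_insert_self _ _)).add hρ
      (ih fun i hi => h i (Finset.mem_insert_of_mem hi))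

theorem GaussLe.mul (hρ : 0 ≤ ρ) (hf : GaussLe ρ f A) (hg : GaussLe ρ g B) :
    GaussLe ρ (f * g) (A * B) := by
  have hA := hf.nonneg
  have hB := hg.nonneg
  intro ν
  rcases (pow_nonneg hρ ν).eq_or_lt with h0 | h0
  · rw [← h0, mul_zero]; positivity
  rw [coeff_mul, ← le_div_iff₀ h0]
  refine IsUltrametricDist.norm_sum_le_of_forall_le_of_nonneg (by positivity) fun p hp => ?_
  rw [le_div_iff₀ h0, norm_mul, ← Finset.HasAntidiagonal.mem_antidiagonal.1 hp, pow_add]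
  calc _ = (‖f.coeff p.1‖ * ρ ^ p.1) * (‖g.coeff p.2‖ * ρ ^ p.2) := by ring
    _ ≤ A * B := mul_le_mul (hf _) (hg _) (by positivity) hA

theorem GaussLe.smul {c : K} (hρ : 0 ≤ ρ) (hf : GaussLe ρ f B) (hc : ‖c‖ ≤ 1) :
    GaussLe ρ (c • f) B := by
  intro ν
  rw [coeff_smul, smul_eq_mul, norm_mul, mul_assoc]
  exact (mul_le_of_le_one_left (by positivity) hc).trans (hf ν)

theorem GaussLe.one : GaussLe ρ (1 : K[X]) 1 := by
  intro ν
  rcases eq_or_ne ν 0 with rfl | h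
  · simp
  · rw [coeff_one, if_neg h]; simp

theorem GaussLe.pow (hρ : 0 ≤ ρ) (hf : GaussLe ρ f B) (n : ℕ) : GaussLe ρ (f ^ n) (B ^ n) := by
  induction n with
  | zero => simpa using GaussLe.one
  | succ n ih => rw [pow_succ, pow_succ]; exact ih.mul hρ hf

theorem GaussLe.X_sub_C {a : K} (hρ : ρ ≤ B) (ha : ‖a‖ ≤ B) :
    GaussLe ρ (X - C a) B := by
  intro ν
  rcases ν with _ | _ | ν
  · simpa using ha
  · simpa [coeff_X, coeff_C] using hρ
  · have : (X - C a : K[X]).coeff (ν + 2) = 0 := by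
      rw [coeff_sub, coeff_X, coeff_C]; simp
    rw [this]
    simpa using (norm_nonneg a).trans ha

end Gauss

/-! ### Gauss norms of the elements `τ^n g_l` -/

section MotiveGauss

open Polynomial

variable {K : Type*} [NormedField K] [IsUltrametricDist K] {q : ℕ} {θ : K} {κ : ℕ → K} {r k : ℕ}
  {ε : ℕ → Fin r → K[X]} {ρ P : ℝ} {x : ℕ → ℝ}

theorem prod_pow_le (hq : 1 < q) (n : ℕ) :
    ∏ i ∈ Finset.range n, (q : ℝ) ^ q ^ i ≤ baseRadius q 1 ^ q ^ n := by
  induction n with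
  | zero => simpa using (one_lt_baseRadius hq le_rfl).le
  | succ n ih =>
    rw [Finset.prod_range_succ, ← baseRadius_pow_mul hq le_rfl]
    gcongr

/-- The slack factors `x i` pay for radii `ρ > 1`. Only the finitely many `i` with `q^{q^i} < ρ`
need `x i > 1`, so enlarging the radius costs a constant and does not change the growth in `n`. -/
theorem gaussLe_carlitzProd (hq : 1 < q) (hθ : ‖θ‖ = q) (hρ : 0 ≤ ρ) (hx : ∀ i, 1 ≤ x i)
    (hρx : ∀ i, ρ ≤ (q : ℝ) ^ q ^ i * x i) (n : ℕ) :
    GaussLe ρ (carlitzProd q θ n) (baseRadius q 1 ^ q ^ n * ∏ i ∈ Finset.range n, x i) := by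
  have h : GaussLe ρ (carlitzProd q θ n) (∏ i ∈ Finset.range n, ((q : ℝ) ^ q ^ i * x i)) := by
    induction n with
    | zero => simpa [carlitzProd] using GaussLe.one
    | succ n ih =>
      rw [carlitzProd, Finset.prod_range_succ, Finset.prod_range_succ]
      refine ih.mul hρ (GaussLe.X_sub_C (hρx n) ?_)
      rw [norm_pow, hθ]
      exact le_mul_of_one_le_right (by positivity) (hx n)
  refine h.mono ?_
  rw [Finset.prod_mul_distrib]
  have : 0 ≤ ∏ i ∈ Finset.range n, x i := Finset.prod_nonneg fun i _ => zero_le_one.trans (hx i)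
  gcongr
  exact prod_pow_le hq n

/-- Solving the recursion for `ε (n + r)` loses nothing because `‖κ r‖ = 1`. The factor `t -
θ^{q^n}` costs `q^{q^n} x n`, and `α^{q^n} q^{q^n} = α^{q^{n+r}}`. -/
theorem IsMotiveSeq.gaussLe (hε : IsMotiveSeq q θ κ r ε) (hq : 1 < q) (hθ : ‖θ‖ = q) (hr : 1 ≤ r)
    (hκ : ∀ i, 1 ≤ i → i ≤ r → ‖κ i‖ ≤ 1) (hκr : ‖κ r‖ = 1)
    (hρ : 0 ≤ ρ) (hx : ∀ i, 1 ≤ x i) (hρx : ∀ i, ρ ≤ (q : ℝ) ^ q ^ i * x i) (m : ℕ) (μ : Fin r) :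
    GaussLe ρ (ε m μ) (baseRadius q r ^ q ^ m * ∏ i ∈ Finset.range m, x i) := by
  have hα := one_lt_baseRadius hq hr
  have hαm := baseRadius_pow_mul hq hr
  set α := baseRadius q r
  have hα0 : 0 < α := by linarith
  have hP1 : ∀ n, 1 ≤ ∏ i ∈ Finset.range n, x i := fun n => by
    induction n with
    | zero => simp
    | succ n ih => rw [Finset.prod_range_succ]; exact one_le_mul_of_one_le_of_one_le ih (hx n)
  have hPm : Monotone fun n => ∏ i ∈ Finset.range n, x i := monotone_nat_of_le_succ fun n => by
    rw [Finset.prod_range_succ]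
    exact le_mul_of_one_le_right (zero_le_one.trans (hP1 n)) (hx n)
  have hB0 : ∀ n, 0 ≤ α ^ q ^ n * ∏ i ∈ Finset.range n, x i := fun n =>
    mul_nonneg (by positivity) (zero_le_one.trans (hP1 n))
  have hB1 : ∀ n, 1 ≤ α ^ q ^ n * ∏ i ∈ Finset.range n, x i := fun n =>
    one_le_mul_of_one_le_of_one_le (one_le_pow₀ hα.le) (hP1 n)
  have hBm : ∀ a b, a ≤ b → α ^ q ^ a * ∏ i ∈ Finset.range a, x i ≤
      α ^ q ^ b * ∏ i ∈ Finset.range b, x i := fun a b hab =>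
    mul_le_mul (pow_le_pow_right₀ hα.le (Nat.pow_le_pow_right (by omega) hab)) (hPm hab)
      (zero_le_one.trans (hP1 a)) (by positivity)
  induction m using Nat.strong_induction_on with
  | _ m ih =>
    rcases lt_or_ge m r with hm | hm
    · rw [hε.init m hm]
      split_ifs
      · exact GaussLe.one.mono (hB1 m)
      · exact GaussLe.zero (hB0 m)
    · obtain ⟨n, rfl⟩ : ∃ n, m = n + r := ⟨m - r, by omega⟩
      obtain ⟨r', rfl⟩ : ∃ r', r = r' + 1 := ⟨r - 1, by omega⟩
      have h1 := hε.recursion n μ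
      rw [Finset.sum_range_succ, ← eq_sub_iff_add_eq'] at h1
      have h2 : ε (n + (r' + 1)) μ = (κ (r' + 1) ^ q ^ n)⁻¹ • ((X - C (θ ^ q ^ n)) * ε n μ -
          ∑ i ∈ Finset.range r', κ (i + 1) ^ q ^ n • ε (n + i + 1) μ) := by
        rw [← h1, smul_smul, inv_mul_cancel₀, one_smul, add_assoc]
        rw [← norm_ne_zero_iff, norm_pow, hκr, one_pow]
        exact one_ne_zero
      rw [h2]
      refine GaussLe.smul hρ ?_ ?_
      · refine GaussLe.sub hρ ?_ (GaussLe.sum hρ (hB0 _) _ _ fun i hi => ?_)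
        · refine (GaussLe.mul hρ (GaussLe.X_sub_C (hρx n) ?_) (ih n (by omega))).mono ?_
          · rw [norm_pow, hθ]
            exact le_mul_of_one_le_right (by positivity) (hx n)
          · calc _ = (α ^ q ^ n * (q : ℝ) ^ q ^ n) * ∏ i ∈ Finset.range (n + 1), x i := by
                  rw [Finset.prod_range_succ]; ring
              _ = α ^ q ^ (n + (r' + 1)) * ∏ i ∈ Finset.range (n + 1), x i := by rw [hαm]
              _ ≤ _ := mul_le_mul_of_nonneg_left (hPm (by omega)) (by positivity)
        · have hi := Finset.mem_range.1 hi
          refine GaussLe.smul hρ ((ih (n + i + 1) (by omega)).mono (hBm _ _ (by omega))) ?_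
          rw [norm_pow]
          exact pow_le_one₀ (norm_nonneg _) (hκ _ (by omega) (by omega))
      · rw [norm_inv, norm_pow, hκr]; simp

/-- The weight `q ^ (q ^ (r - 1) / (q ^ r - 1) + u + k / (q - 1))`. -/
def motWeight (q r k u : ℕ) : ℝ :=
  baseRadius q r ^ q ^ (r - 1) * (q : ℝ) ^ u * baseRadius q 1 ^ k

theorem motWeight_pos (hq : 1 < q) (hr : 1 ≤ r) (k u : ℕ) : 0 < motWeight q r k u := by
  have := one_lt_baseRadius hq hr
  have := one_lt_baseRadius hq le_rfl
  unfold motWeight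
  positivity

theorem motWeight_pow (hr : 1 ≤ r) (u n : ℕ) : motWeight q r k u ^ q ^ n =
    baseRadius q r ^ q ^ (n + r - 1) * ((q : ℝ) ^ q ^ n) ^ u * (baseRadius q 1 ^ q ^ n) ^ k := by
  rw [motWeight, mul_pow, mul_pow, ← pow_mul, ← pow_add, show r - 1 + n = n + r - 1 by omega,
    ← pow_mul, ← pow_mul, ← pow_mul, ← pow_mul, mul_comm u, mul_comm k]

/-- The exponent `2 k + 1` counts slack: `k` from the Carlitz product, at most `k` from `(t -
θ^{q^n})^u`, one from `ε`. The power `q^{r-1}` in the weight reflects the largest index `n + r - 1`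
of `ε`. -/
theorem gaussLe_motRow (hε : IsMotiveSeq q θ κ r ε) (hq : 1 < q) (hθ : ‖θ‖ = q) (hr : 1 ≤ r)
    (hκ : ∀ i, 1 ≤ i → i ≤ r → ‖κ i‖ ≤ 1) (hκr : ‖κ r‖ = 1)
    (hρ : 0 ≤ ρ) (hx : ∀ i, 1 ≤ x i) (hρx : ∀ i, ρ ≤ (q : ℝ) ^ q ^ i * x i)
    (hP : ∀ n, ∏ i ∈ Finset.range n, x i ≤ P) (n : ℕ) {l : ℕ} (hl : l ≤ r * k) (μ : Fin r) :
    GaussLe ρ (motRow q θ r k ε n l μ) (P ^ (2 * k + 1) * motWeight q r k (l / r) ^ q ^ n) := by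
  have hα := one_lt_baseRadius hq hr
  have hβ := one_lt_baseRadius hq le_rfl
  have hP1 : 1 ≤ P := by simpa using hP 0
  have hP1' : ∀ n, 1 ≤ ∏ i ∈ Finset.range n, x i := fun n => by
    induction n with
    | zero => simp
    | succ n ih => rw [Finset.prod_range_succ]; exact one_le_mul_of_one_le_of_one_le ih (hx n)
  have hxP : x n ≤ P := by
    refine le_trans ?_ (hP (n + 1))
    rw [Finset.prod_range_succ]
    exact le_mul_of_one_le_left (zero_le_one.trans (hx n)) (hP1' n)
  have hu : l / r ≤ k := Nat.div_le_of_le_mul hl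
  have h1 := (gaussLe_carlitzProd hq hθ hρ hx hρx n).mono
    (mul_le_mul_of_nonneg_left (hP n) (by positivity))
  have h2 : GaussLe ρ (X - C (θ ^ q ^ n)) ((q : ℝ) ^ q ^ n * P) := by
    refine (GaussLe.X_sub_C (hρx n) ?_).mono (mul_le_mul_of_nonneg_left hxP (by positivity))
    rw [norm_pow, hθ]
    exact le_mul_of_one_le_right (by positivity) (hx n)
  have h3 : GaussLe ρ (ε (n + l % r) μ) (baseRadius q r ^ q ^ (n + r - 1) * P) := by
    refine (hε.gaussLe hq hθ hr hκ hκr hρ hx hρx _ μ).mono ?_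
    have := Nat.mod_lt l hr
    exact mul_le_mul (pow_le_pow_right₀ hα.le (Nat.pow_le_pow_right (by omega) (by omega))) (hP _)
      (zero_le_one.trans (hP1' _)) (by positivity)
  refine (((h1.pow hρ k).mul hρ (h2.pow hρ (l / r))).mul hρ h3).mono ?_
  rw [motWeight_pow hr]
  calc _ = P ^ (k + l / r + 1) * (baseRadius q r ^ q ^ (n + r - 1) * ((q : ℝ) ^ q ^ n) ^ (l / r) *
        (baseRadius q 1 ^ q ^ n) ^ k) := by ring
    _ ≤ _ := by
      refine mul_le_mul_of_nonneg_right ?_ (by positivity)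
      exact pow_le_pow_right₀ hP1 (by omega)

end MotiveGauss

/-! ### Series of polynomials -/

section PolySeries

open Polynomial Filter Topology

variable {K : Type*} [NormedField K] [IsUltrametricDist K] {ι M : Type*} [Fintype ι]
  {q : ℕ} {v : ι → ℝ}

/-- The `n`-th term of the coefficient of `t ^ ν` in the `μ`-th entry of `∑ a l n R n l`. -/
def rowTerm (R : ℕ → ι → M → K[X]) (a : ι → ℕ → K) (μ : M) (ν n : ℕ) : K :=
  ∑ l, a l n * (R n l μ).coeff ν

variable {R : ℕ → ι → M → K[X]} {a : ι → ℕ → K}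

theorem tendsto_sum_norm_mul (ha : ∀ l, Tendsto (fun n => ‖a l n‖ * v l ^ q ^ n) atTop (𝓝 0)) :
    Tendsto (fun n => ∑ l, ‖a l n‖ * v l ^ q ^ n) atTop (𝓝 0) := by
  simpa using tendsto_finsetSum Finset.univ fun l _ => ha l

theorem norm_rowTerm_mul_pow_le {ρ P B : ℝ} (hρ : 0 ≤ ρ) {n : ℕ} {μ : M}
    (hR : ∀ l, GaussLe ρ (R n l μ) (P * v l ^ q ^ n)) (hB : 0 ≤ B)
    (ha : ∀ l, ‖a l n‖ * (P * v l ^ q ^ n) ≤ B) (ν : ℕ) : ‖rowTerm R a μ ν n‖ * ρ ^ ν ≤ B := by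
  rcases (pow_nonneg hρ ν).eq_or_lt with h0 | h0
  · rw [← h0, mul_zero]; exact hB
  rw [← le_div_iff₀ h0]
  refine IsUltrametricDist.norm_sum_le_of_forall_le_of_nonneg (by positivity) fun l _ => ?_
  rw [le_div_iff₀ h0, norm_mul, mul_assoc]
  exact (mul_le_mul_of_nonneg_left (hR l ν) (norm_nonneg _)).trans (ha l)

theorem norm_rowTerm_mul_pow_le_sum {ρ P : ℝ} (hρ : 0 ≤ ρ) (hP : 0 ≤ P) (hv : ∀ l, 0 < v l) {n : ℕ}
    {μ : M} (hR : ∀ l, GaussLe ρ (R n l μ) (P * v l ^ q ^ n)) (ν : ℕ) :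
    ‖rowTerm R a μ ν n‖ * ρ ^ ν ≤ P * ∑ l, ‖a l n‖ * v l ^ q ^ n := by
  have hnn : ∀ l, 0 ≤ ‖a l n‖ * v l ^ q ^ n := fun l =>
    mul_nonneg (norm_nonneg _) (pow_nonneg (hv l).le _)
  refine norm_rowTerm_mul_pow_le hρ hR (mul_nonneg hP (Finset.sum_nonneg fun l _ => hnn l))
    (fun l => ?_) ν
  rw [mul_left_comm]
  exact mul_le_mul_of_nonneg_left (Finset.single_le_sum (f := fun l => ‖a l n‖ * v l ^ q ^ n)
    (fun l _ => hnn l) (Finset.mem_univ l)) hP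

theorem norm_rowTerm_le (hv : ∀ l, 0 < v l) {n : ℕ}
    {μ : M} (hR : ∀ l, GaussLe 1 (R n l μ) (v l ^ q ^ n)) (ν : ℕ) :
    ‖rowTerm R a μ ν n‖ ≤ ∑ l, ‖a l n‖ * v l ^ q ^ n := by
  simpa using norm_rowTerm_mul_pow_le_sum (a := a) zero_le_one zero_le_one hv
    (fun l => by simpa using hR l) ν

theorem summable_rowTerm [CompleteSpace K] (hv : ∀ l, 0 < v l) (μ : M)
    (hR : ∀ n l, GaussLe 1 (R n l μ) (v l ^ q ^ n))
    (ha : ∀ l, Tendsto (fun n => ‖a l n‖ * v l ^ q ^ n) atTop (𝓝 0)) (ν : ℕ) :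
    Summable (rowTerm R a μ ν) := by
  refine NonarchimedeanAddGroup.summable_of_tendsto_cofinite_zero ?_
  rw [Nat.cofinite_eq_atTop]
  exact squeeze_zero_norm (fun n => norm_rowTerm_le hv (hR n) ν) (tendsto_sum_norm_mul ha)

/-- The terms with large `n` are small uniformly in `ν`; the finitely many others are polynomials
and do not contribute for large `ν`. -/
theorem tendsto_norm_tsum_rowTerm [CompleteSpace K] (hv : ∀ l, 0 < v l) (μ : M)
    (hR : ∀ n l, GaussLe 1 (R n l μ) (v l ^ q ^ n))
    (ha : ∀ l, Tendsto (fun n => ‖a l n‖ * v l ^ q ^ n) atTop (𝓝 0)) :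
    Tendsto (fun ν => ‖∑' n, rowTerm R a μ ν n‖) atTop (𝓝 0) := by
  rw [Metric.tendsto_atTop]
  intro δ hδ
  obtain ⟨N, hN⟩ := (Metric.tendsto_atTop.1 (tendsto_sum_norm_mul ha)) (δ / 2) (by positivity)
  refine ⟨(∑ n ∈ Finset.range N, ∑ l, (R n l μ).natDegree) + 1, fun ν hν => ?_⟩
  rw [dist_zero_right, norm_norm]
  refine (IsUltrametricDist.norm_tsum_le_of_forall_le_of_nonneg (C := δ / 2) (by positivity)
    fun n => ?_).trans_lt (by linarith)
  rcases lt_or_ge n N with hn | hn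
  · have : rowTerm R a μ ν n = 0 := by
      refine Finset.sum_eq_zero fun l _ => ?_
      rw [coeff_eq_zero_of_natDegree_lt, mul_zero]
      have h1 : (R n l μ).natDegree ≤ ∑ l, (R n l μ).natDegree :=
        Finset.single_le_sum (f := fun l => (R n l μ).natDegree) (fun _ _ => Nat.zero_le _)
          (Finset.mem_univ l)
      have h2 : ∑ l, (R n l μ).natDegree ≤ ∑ n ∈ Finset.range N, ∑ l, (R n l μ).natDegree :=
        Finset.single_le_sum (f := fun n => ∑ l, (R n l μ).natDegree) (fun _ _ => Nat.zero_le _)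
          (Finset.mem_range.2 hn)
      omega
    rw [this, norm_zero]; positivity
  · have h := hN n hn
    rw [Real.dist_eq, sub_zero] at h
    exact (norm_rowTerm_le hv (hR n) ν).trans ((le_abs_self _).trans h.le)

theorem norm_tsum_rowTerm_le (μ : M)
    (hR : ∀ n l, GaussLe 1 (R n l μ) (v l ^ q ^ n)) {B : ℝ} (hB : 0 ≤ B)
    (ha : ∀ l n, ‖a l n‖ * v l ^ q ^ n ≤ B) (ν : ℕ) : ‖∑' n, rowTerm R a μ ν n‖ ≤ B := by
  refine IsUltrametricDist.norm_tsum_le_of_forall_le_of_nonneg hB fun n => ?_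
  simpa using norm_rowTerm_mul_pow_le (P := 1) zero_le_one (fun l => by simpa using hR n l) hB
    (fun l => by simpa using ha l n) ν

end PolySeries

/-! ### Injectivity -/

section Coordinates

open Polynomial Filter Topology

variable {K : Type*} [NormedField K] [IsUltrametricDist K] {q : ℕ} {θ : K} {κ : ℕ → K} {r k : ℕ}
  {ε : ℕ → Fin r → K[X]}

/-- The action of `t` on the sequences of coordinates with respect to the elements `τ ^ n g_l`. -/
def shiftAction (q : ℕ) (θ : K) (κ : ℕ → K) (r k : ℕ) : Module.End K (ℕ → ℕ → K) where
  toFun y n j := if j ≤ r * k then ∑ i ∈ Finset.range (r * k + 1), y n i * tensD q θ r n i j +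
    (if n = 0 then 0 else ∑ i ∈ Finset.range (r * k + 1), y (n - 1) i * tensA q κ r k (n - 1) i j)
    else 0
  map_add' x y := by
    funext n j
    simp only [Pi.add_apply, add_mul, Finset.sum_add_distrib]
    split_ifs <;> ring
  map_smul' c y := by
    funext n j
    simp only [Pi.smul_apply, smul_eq_mul, mul_assoc, RingHom.id_apply, ← Finset.mul_sum]
    split_ifs <;> ring

theorem shiftAction_apply (y : ℕ → ℕ → K) (n : ℕ) {j : ℕ} (hj : j ≤ r * k) :
    shiftAction q θ κ r k y n j = ∑ i ∈ Finset.range (r * k + 1), y n i * tensD q θ r n i j +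
      if n = 0 then 0 else
        ∑ i ∈ Finset.range (r * k + 1), y (n - 1) i * tensA q κ r k (n - 1) i j :=
  if_pos hj

/-- The sequence with entry `1` in the place `(n, l)`. -/
def unitSeq (n l : ℕ) : ℕ → ℕ → K := Pi.single n (Pi.single l 1)

theorem unitSeq_apply (n l m j : ℕ) : (unitSeq n l m j : K) = if m = n ∧ j = l then 1 else 0 := by
  unfold unitSeq
  by_cases h : m = n
  · subst h; simp [Pi.single_apply]
  · simp [h]

/-- The coordinates of a row vector of polynomials with respect to the elements `τ ^ n g_l`. -/
def coords (q : ℕ) (θ : K) (κ : ℕ → K) (r k : ℕ) : (Fin r → K[X]) →ₗ[K] (ℕ → ℕ → K) where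
  toFun f := ∑ i, aeval (shiftAction q θ κ r k) (f i) (unitSeq 0 i)
  map_add' f g := by simp [Finset.sum_add_distrib]
  map_smul' c f := by simp [Finset.smul_sum]

theorem coords_X_smul (f : Fin r → K[X]) : coords q θ κ r k ((X : K[X]) • f) =
    shiftAction q θ κ r k (coords q θ κ r k f) := by
  simp [coords]

theorem shiftAction_unitSeq {n l : ℕ} (hl : l ≤ r * k) :
    shiftAction q θ κ r k (unitSeq n l) =
      ∑ j ∈ Finset.range (r * k + 1), tensD q θ r n l j • unitSeq n j +
      ∑ j ∈ Finset.range (r * k + 1), tensA q κ r k n l j • unitSeq (n + 1) j := by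
  have hmem : ∀ {j}, j ≤ r * k → j ∈ Finset.range (r * k + 1) := fun h =>
    Finset.mem_range.2 (by omega)
  have h1 : ∀ (m : ℕ) (f : ℕ → K), ∑ i ∈ Finset.range (r * k + 1), unitSeq n l m i * f i =
      if m = n then f l else 0 := by
    intro m f
    simp only [unitSeq_apply]
    by_cases h : m = n
    · simp [h, hl]
    · simp [h]
  have h2 : ∀ (n m j : ℕ) (f : ℕ → K),
      (∑ i ∈ Finset.range (r * k + 1), f i • unitSeq n i : ℕ → ℕ → K) m j =
      if j ≤ r * k then if m = n then f j else 0 else 0 := by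
    intro n m j f
    simp only [Finset.sum_apply, Pi.smul_apply, smul_eq_mul, unitSeq_apply]
    by_cases h : m = n
    · simp [h]
    · simp [h]
  funext m j
  rw [Pi.add_apply, Pi.add_apply, h2, h2]
  by_cases hj : j ≤ r * k
  · rw [shiftAction_apply _ _ hj, h1, h1, if_pos hj, if_pos hj]
    rcases m with _ | m
    · simp only [if_true]
      rw [if_neg (by omega : ¬ 0 = n + 1)]
      split_ifs with h3
      · rw [← h3]
      · rfl
    · simp only [Nat.add_sub_cancel, Nat.add_eq_zero_iff, one_ne_zero, and_false, if_false,
        Nat.add_right_cancel_iff]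
      congr 1
      · split_ifs with h3
        · rw [h3]
        · rfl
      · split_ifs with h3
        · rw [h3]
        · rfl
  · rw [if_neg hj, if_neg hj, add_zero]
    exact if_neg hj

/-- Both families satisfy the relations of the `t`-action and agree for `n = 0`, `l < r`, so
`eq_zero_of_relations` applies to their difference. -/
theorem coords_motRow (hε : IsMotiveSeq q θ κ r ε) (hr : 1 ≤ r) (hk : 1 ≤ k) (hκr : κ r ≠ 0)
    (n : ℕ) {l : ℕ} (hl : l ≤ r * k) :
    coords q θ κ r k (motRow q θ r k ε n l) = unitSeq n l := by
  rw [← sub_eq_zero]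
  refine eq_zero_of_relations (q := q) (θ := θ) (shiftAction q θ κ r k) hr hk hκr
    (fun n l => coords q θ κ r k (motRow q θ r k ε n l) - unitSeq n l) (fun n l hl => ?_)
    (fun l hl => ?_) n l hl
  · rw [map_sub, ← coords_X_smul, X_smul_motRow hε hr hk n hl, shiftAction_unitSeq hl, map_add,
      map_sum, map_sum]
    simp only [map_smul, smul_sub, Finset.sum_sub_distrib]
    abel
  · rw [sub_eq_zero]
    have : motRow q θ r k ε 0 l = fun μ : Fin r => if l = (μ : ℕ) then (1 : K[X]) else 0 := by
      funext μ
      rw [motRow, carlitzProd, Finset.prod_range_zero, Nat.div_eq_of_lt hl, Nat.mod_eq_of_lt hl,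
        one_pow, pow_zero, one_mul, one_mul, zero_add, hε.init l hl]
    rw [this]
    change ∑ i : Fin r, aeval (shiftAction q θ κ r k) (if l = (i : ℕ) then (1 : K[X]) else 0)
      (unitSeq 0 i) = _
    rw [Finset.sum_eq_single ⟨l, hl⟩]
    · simp
    · intro i _ hi
      rw [if_neg (fun h => hi (Fin.ext h.symm)), map_zero, LinearMap.zero_apply]
    · simp

/-- After applying `t`, level `m` depends only on levels `m` and `m - 1`, so the levels up to `n`
can be estimated alone; the matrix entries met there have norm at most `q^{q^n}`. -/
theorem norm_shiftAction_pow_le (hq : 1 < q) (hθ : ‖θ‖ = q) (hκ : ∀ i, 1 ≤ i → i ≤ r → ‖κ i‖ ≤ 1)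
    (n : ℕ) (y : ℕ → ℕ → K) (hy : ∀ m ≤ n, ∀ j, ‖y m j‖ ≤ 1) (ν : ℕ) :
    ∀ m ≤ n, ∀ j, ‖((shiftAction q θ κ r k) ^ ν) y m j‖ ≤ ((q : ℝ) ^ q ^ n) ^ ν := by
  have h1 : (1 : ℝ) < q := by exact_mod_cast hq
  induction ν with
  | zero => simpa using hy
  | succ ν ih =>
    intro m hm j
    rw [pow_succ', Module.End.mul_apply]
    by_cases hj : j ≤ r * k
    · rw [shiftAction_apply _ _ hj]
      have hB : 0 ≤ ((q : ℝ) ^ q ^ n) ^ (ν + 1) := by positivity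
      have hcomb : ∀ c x : K, ‖c‖ ≤ ((q : ℝ) ^ q ^ n) ^ ν → ‖x‖ ≤ (q : ℝ) ^ q ^ n →
          ‖c * x‖ ≤ ((q : ℝ) ^ q ^ n) ^ (ν + 1) := by
        intro c x hc hx
        rw [norm_mul, pow_succ]
        exact mul_le_mul hc hx (norm_nonneg _) (by positivity)
      have hone : (1 : ℝ) ≤ (q : ℝ) ^ q ^ n := one_le_pow₀ h1.le
      refine (IsUltrametricDist.norm_add_le_max _ _).trans (max_le ?_ ?_)
      · refine IsUltrametricDist.norm_sum_le_of_forall_le_of_nonneg hB fun i _ => ?_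
        refine hcomb _ _ (ih m hm i) ?_
        unfold tensD
        split_ifs
        · rw [norm_pow, hθ]
          exact pow_le_pow_right₀ h1.le (Nat.pow_le_pow_right (by omega) hm)
        · rwa [norm_one]
        · rw [norm_zero]; positivity
      · split_ifs
        · rwa [norm_zero]
        · refine IsUltrametricDist.norm_sum_le_of_forall_le_of_nonneg hB fun i _ => ?_
          refine hcomb _ _ (ih (m - 1) (by omega) i) (le_trans ?_ hone)
          unfold tensA
          split_ifs
          · rw [norm_pow]
            exact pow_le_one₀ (norm_nonneg _) (hκ _ (by omega) (by omega))
          all_goals simp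
    · have : shiftAction q θ κ r k (((shiftAction q θ κ r k) ^ ν) y) m j = 0 := if_neg hj
      rw [this, norm_zero]
      positivity

/-- Continuity of the coordinates at level `n`. The radius grows with `n`, which is why Gauss norms
beyond the unit disc are needed. -/
theorem norm_coords_le (hq : 1 < q) (hθ : ‖θ‖ = q) (hκ : ∀ i, 1 ≤ i → i ≤ r → ‖κ i‖ ≤ 1)
    (n j : ℕ) (f : Fin r → K[X]) {B : ℝ} (hB : 0 ≤ B) (hf : ∀ i, GaussLe ((q : ℝ) ^ q ^ n) (f i) B) :
    ‖coords q θ κ r k f n j‖ ≤ B := by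
  change ‖(∑ i, aeval (shiftAction q θ κ r k) (f i) (unitSeq 0 i) : ℕ → ℕ → K) n j‖ ≤ B
  rw [Finset.sum_apply, Finset.sum_apply]
  refine IsUltrametricDist.norm_sum_le_of_forall_le_of_nonneg hB fun i _ => ?_
  rw [aeval_eq_sum_range, LinearMap.sum_apply, Finset.sum_apply, Finset.sum_apply]
  refine IsUltrametricDist.norm_sum_le_of_forall_le_of_nonneg hB fun ν _ => ?_
  rw [LinearMap.smul_apply, Pi.smul_apply, Pi.smul_apply, smul_eq_mul, norm_mul]
  refine le_trans (mul_le_mul_of_nonneg_left ?_ (norm_nonneg _)) (hf i ν)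
  refine norm_shiftAction_pow_le hq hθ hκ n _ (fun m _ j => ?_) ν n le_rfl j
  rw [unitSeq_apply]
  split_ifs <;> simp

/-- A series `∑ a l n τ ^ n g_l` in the completed motive that vanishes is trivial. -/
theorem eq_zero_of_tsum_rowTerm_eq_zero [CompleteSpace K] (hε : IsMotiveSeq q θ κ r ε) (hq : 1 < q)
    (hθ : ‖θ‖ = q) (hr : 1 ≤ r) (hk : 1 ≤ k) (hκ : ∀ i, 1 ≤ i → i ≤ r → ‖κ i‖ ≤ 1)
    (hκr : ‖κ r‖ = 1) {a : Fin (r * k + 1) → ℕ → K}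
    (ha : ∀ l : Fin (r * k + 1),
      Tendsto (fun n => ‖a l n‖ * motWeight q r k (l / r) ^ q ^ n) atTop (𝓝 0))
    (h : ∀ μ ν, HasSum (rowTerm (fun n (l : Fin (r * k + 1)) => motRow q θ r k ε n l) a μ ν) 0) :
    a = 0 := by
  have h1 : (1 : ℝ) < q := by exact_mod_cast hq
  have hκr0 : κ r ≠ 0 := by rw [← norm_ne_zero_iff, hκr]; exact one_ne_zero
  funext l n
  set ρ : ℝ := (q : ℝ) ^ q ^ n with hρ
  have hρ1 : 1 ≤ ρ := one_le_pow₀ h1.le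
  -- Slack `ρ` is needed only for the `n` indices with `q^{q^i} < ρ = q^{q^n}`, so all products stay
  -- below `ρ ^ n`.
  set x : ℕ → ℝ := fun i => if i < n then ρ else 1 with hx
  have hx1 : ∀ i, 1 ≤ x i := fun i => by rw [hx]; dsimp only; split_ifs; exacts [hρ1, le_rfl]
  have hρx : ∀ i, ρ ≤ (q : ℝ) ^ q ^ i * x i := fun i => by
    rw [hx]; dsimp only
    split_ifs with hi
    · exact le_mul_of_one_le_left (by positivity) (one_le_pow₀ h1.le)
    · rw [mul_one]
      exact pow_le_pow_right₀ h1.le (Nat.pow_le_pow_right (by omega) (by omega))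
  have hP : ∀ N, ∏ i ∈ Finset.range N, x i ≤ ρ ^ n := by
    intro N
    rw [hx, Finset.prod_ite, Finset.prod_const_one, mul_one, Finset.prod_const]
    refine pow_le_pow_right₀ hρ1 ?_
    calc _ ≤ (Finset.range n).card := Finset.card_le_card fun i => by
          simp only [Finset.mem_filter, Finset.mem_range]; exact fun h => h.2
      _ = n := Finset.card_range n
  set R := fun n (l : Fin (r * k + 1)) => motRow q θ r k ε n l with hR
  have hgauss : ∀ m (l : Fin (r * k + 1)) μ, GaussLe ρ (R m l μ)
      ((ρ ^ n) ^ (2 * k + 1) * motWeight q r k (l / r) ^ q ^ m) := fun m l μ =>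
    gaussLe_motRow hε hq hθ hr hκ hκr (by positivity) hx1 hρx hP m (by omega) μ
  have hv : ∀ l : Fin (r * k + 1), 0 < motWeight q r k (l / r) := fun l => motWeight_pos hq hr _ _
  have hlim := (tendsto_sum_norm_mul ha).const_mul ((ρ ^ n) ^ (2 * k + 1))
  rw [mul_zero] at hlim
  have hsmall : ∀ δ : ℝ, 0 < δ → ‖a l n‖ ≤ δ := by
    intro δ hδ
    obtain ⟨N, hN⟩ := eventually_atTop.1 (hlim.eventually_lt_const hδ)
    -- At least `n + 1` terms, so that level `n` occurs in the partial sum.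
    set N' := max N (n + 1)
    have hcoord : coords q θ κ r k (∑ m ∈ Finset.range N', ∑ l, a l m • R m l) n l = a l n := by
      have : coords q θ κ r k (∑ m ∈ Finset.range N', ∑ l, a l m • R m l) =
          ∑ m ∈ Finset.range N', ∑ l : Fin (r * k + 1), a l m • unitSeq m l := by
        simp only [map_sum, map_smul, hR]
        refine Finset.sum_congr rfl fun m _ => Finset.sum_congr rfl fun l _ => ?_
        rw [coords_motRow hε hr hk hκr0 m (by omega)]
      rw [this]
      simp only [Finset.sum_apply, Pi.smul_apply, smul_eq_mul, unitSeq_apply]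
      rw [Finset.sum_eq_single n]
      · rw [Finset.sum_eq_single l]
        · simp
        · intro i _ hi
          rw [if_neg (fun h => hi (Fin.ext h.2.symm)), mul_zero]
        · simp
      · intro m _ hm
        exact Finset.sum_eq_zero fun i _ => by rw [if_neg (fun h => hm h.1.symm), mul_zero]
      · intro hn
        exact absurd (Finset.mem_range.2 (lt_of_lt_of_le (Nat.lt_succ_self n) (le_max_right _ _))) hn
    rw [← hcoord]
    refine norm_coords_le hq hθ hκ n l _ hδ.le fun μ ν => ?_
    have hc : ((∑ m ∈ Finset.range N', ∑ l, a l m • R m l) μ).coeff ν =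
        ∑ m ∈ Finset.range N', rowTerm R a μ ν m := by
      simp only [Finset.sum_apply, finsetSum_coeff, Pi.smul_apply, coeff_smul, smul_eq_mul, rowTerm]
    have htail := (hasSum_nat_add_iff' N').2 (h μ ν)
    rw [zero_sub] at htail
    -- As the whole series vanishes, the partial sum is minus its tail, and the tail is below `δ` in
    -- the Gauss norm of radius `ρ`.
    rw [hc, ← norm_neg, ← htail.tsum_eq, ← le_div_iff₀ (by positivity)]
    refine IsUltrametricDist.norm_tsum_le_of_forall_le_of_nonneg (by positivity) fun m => ?_
    rw [le_div_iff₀ (by positivity)]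
    refine (norm_rowTerm_mul_pow_le_sum (by positivity) (by positivity) hv
      (fun l => hgauss (m + N') l μ) ν).trans (hN _ ?_).le
    exact le_trans (le_max_left _ _) (Nat.le_add_left _ _)
  have : ‖a l n‖ ≤ 0 := le_of_forall_pos_le_add fun δ hδ => by simpa using hsmall δ hδ
  exact norm_le_zero_iff.1 this

end Coordinates

/-! ### The last rows of the logarithm of the tensor product -/

section LogRow

open Polynomial Filter Topology

variable {K : Type*} {q : ℕ} {r k l : ℕ}

/-- `p` is the sequence of row vectors that form a row of the logarithm of the tensor product. -/
structure IsLogRow [Field K] (q : ℕ) (θ : K) (κ : ℕ → K) (r k l : ℕ) (p : ℕ → ℕ → K) : Prop where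
  init : ∀ j ≤ r * k, p 0 j = if j = if l = 0 then r * k else r * (k - 1) + l then 1 else 0
  recursion : ∀ n, ∀ j ≤ r * k, ∑ i ∈ Finset.range (r * k + 1), p (n + 1) i * tensD q θ r (n + 1) i j +
    ∑ i ∈ Finset.range (r * k + 1), p n i * tensA q κ r k n i j = θ * p (n + 1) j

/-- The product of the `k`-th powers of `1 / (θ - θ ^ (q ^ i))` for `1 ≤ i < n`. -/
def invDiffProd [Field K] (q : ℕ) (θ : K) (k n : ℕ) : K :=
  (∏ i ∈ Finset.range n, invDiff q θ i) ^ k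

theorem invDiffProd_succ [Field K] (θ : K) (n : ℕ) :
    invDiffProd q θ k (n + 1) = invDiffProd q θ k n * invDiff q θ n ^ k := by
  rw [invDiffProd, Finset.prod_range_succ, mul_pow]; rfl

variable [NormedField K] [IsUltrametricDist K] {θ : K} {κ : ℕ → K} {p : ℕ → ℕ → K}

/-- In a column `j ≥ r` the recursion is `(θ - θ^{q^{n+1}}) p_j = p_{j-r}`, while in the first `r`
columns `A_1` provides the right-hand side. Column `r u + m` therefore carries `u + 1` inverse
differences. -/
theorem IsLogRow.apply_succ_of_sum (hp : IsLogRow q θ κ r k l p) (hq : 1 < q) (hθ : ‖θ‖ = q)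
    (hr : 1 ≤ r) (hk : 1 ≤ k) (n : ℕ) (h : ∀ j < r,
      ∑ i ∈ Finset.range (r * k + 1), p n i * tensA q κ r k n i j =
        invDiffProd q θ k (n + 1) * logRow q θ κ r l (n + 1) j) (j : ℕ) (hj : j ≤ r * k) :
    p (n + 1) j = invDiff q θ (n + 1) ^ (j / r + 1) *
      (invDiffProd q θ k (n + 1) * logRow q θ κ r l (n + 1) (j % r)) := by
  have hne := theta_sub_ne_zero hq hθ (Nat.succ_ne_zero n)
  have hinv : invDiff q θ (n + 1) = (θ - θ ^ q ^ (n + 1))⁻¹ := if_neg (by omega)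
  have hrec := hp.recursion n j hj
  rw [sum_mul_tensD hr _ hj] at hrec
  have hsolve : ∀ s, (θ - θ ^ q ^ (n + 1)) * p (n + 1) j = s → p (n + 1) j = invDiff q θ (n + 1) * s := by
    rintro s rfl
    rw [hinv, inv_mul_cancel_left₀ hne]
  induction j using Nat.strong_induction_on with
  | _ j ih =>
    rcases lt_or_ge j r with hjr | hjr
    · rw [h j hjr, if_neg (by omega), add_zero] at hrec
      rw [Nat.div_eq_of_lt hjr, Nat.mod_eq_of_lt hjr, zero_add, pow_one]
      apply hsolve
      linear_combination -hrec
    · rw [if_pos hjr, sum_mul_tensA hk, if_neg (by omega : ¬ j < r), add_zero] at hrec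
      have hj' : j - r ≤ r * k := by omega
      have hrec' := hp.recursion n (j - r) hj'
      rw [sum_mul_tensD hr _ hj'] at hrec'
      have h1 := ih (j - r) (by omega) hj' hrec' (by
        rintro s rfl
        rw [hinv, inv_mul_cancel_left₀ hne])
      obtain ⟨i, rfl⟩ : ∃ i, j = i + r := ⟨j - r, by omega⟩
      rw [Nat.add_sub_cancel] at h1 hrec
      rw [Nat.add_div_right _ (by omega), Nat.add_mod_right, pow_succ', mul_assoc, ← h1]
      apply hsolve
      linear_combination -hrec

/-- `A_1` reads entry `r k`, with `k + 1` inverse differences, and entry `r (k - 1) + j + 1`, with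
`k` of them. The common `k`-th power joins `invDiffProd`; what is left is the recursion of `logRow`.
-/
theorem IsLogRow.sum_mul_tensA_eq (hp : IsLogRow q θ κ r k l p) (hq : 1 < q) (hθ : ‖θ‖ = q)
    (hr : 1 ≤ r) (hk : 1 ≤ k) (hl : l < r) (n : ℕ) {j : ℕ} (hj : j < r) :
    ∑ i ∈ Finset.range (r * k + 1), p n i * tensA q κ r k n i j =
      invDiffProd q θ k (n + 1) * logRow q θ κ r l (n + 1) j := by
  have hrk : r * (k - 1) + r = r * k := by
    rw [← Nat.mul_succ, Nat.succ_eq_add_one, Nat.sub_add_cancel hk]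
  induction n generalizing j with
  | zero =>
    rw [sum_mul_tensA hk, if_pos hj, hp.init _ le_rfl]
    have h1 : invDiffProd q θ k (0 + 1) = 1 := by simp [invDiffProd, invDiff]
    rw [h1, one_mul, logRow_succ hj, logSeq, logRow, logRow, invDiff, if_pos rfl, one_mul]
    congr 1
    · congr 1
      rcases eq_or_ne l 0 with rfl | hl0
      · simp
      · rw [if_neg hl0, if_neg (by omega), if_neg (by omega)]
    · split_ifs with h2 h3 h3
      · rw [hp.init _ (by omega), if_neg (by omega : l ≠ 0), if_pos (by omega)]
      · rw [hp.init _ (by omega)]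
        rcases eq_or_ne l 0 with rfl | hl0
        · rw [if_pos rfl, if_neg (by omega)]
        · rw [if_neg hl0, if_neg (by omega)]
      · omega
      · rfl
  | succ n ih =>
    have hf := hp.apply_succ_of_sum hq hθ hr hk n (fun j hj => ih hj)
    rw [sum_mul_tensA hk, if_pos hj, hf _ le_rfl, Nat.mul_div_cancel_left _ (by omega),
      Nat.mul_mod_right, logRow_succ hj, invDiffProd_succ _ (n + 1), logSeq]
    have h2 : (if j + 1 < r then p (n + 1) (r * (k - 1) + (j + 1)) else 0) =
        invDiff q θ (n + 1) ^ k *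
          (invDiffProd q θ k (n + 1) * logRow q θ κ r l (n + 1) (j + 1)) := by
      split_ifs with h3
      · rw [hf _ (by omega), Nat.mul_add_div (by omega), Nat.mul_add_mod, Nat.div_eq_of_lt h3,
          Nat.mod_eq_of_lt h3, add_zero, Nat.sub_add_cancel hk]
      · rw [logRow_eq_zero hl (by omega), mul_zero, mul_zero]
    rw [h2]
    ring

theorem IsLogRow.apply_succ (hp : IsLogRow q θ κ r k l p) (hq : 1 < q) (hθ : ‖θ‖ = q)
    (hr : 1 ≤ r) (hk : 1 ≤ k) (hl : l < r) (n : ℕ) {j : ℕ} (hj : j ≤ r * k) :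
    p (n + 1) j = invDiff q θ (n + 1) ^ (j / r + 1) *
      (invDiffProd q θ k (n + 1) * logRow q θ κ r l (n + 1) (j % r)) :=
  hp.apply_succ_of_sum hq hθ hr hk n (fun _ hj => hp.sum_mul_tensA_eq hq hθ hr hk hl n hj) j hj

theorem norm_invDiffProd_mul (hq : 1 < q) (hθ : ‖θ‖ = q) (n : ℕ) :
    ‖invDiffProd q θ k (n + 1)‖ * (baseRadius q 1 ^ q ^ (n + 1)) ^ k = (baseRadius q 1 * q) ^ k := by
  induction n with
  | zero =>
    have := baseRadius_pow (r := 1) hq le_rfl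
    have h1 : invDiffProd q θ k (0 + 1) = 1 := by simp [invDiffProd, invDiff]
    rw [h1, norm_one, one_mul, zero_add, this]
  | succ n ih =>
    rw [invDiffProd_succ, norm_mul, norm_pow, norm_invDiff hq hθ (by omega),
      ← baseRadius_pow_mul hq le_rfl (n + 1), ← ih, mul_pow _ ((q : ℝ) ^ q ^ (n + 1)), inv_pow]
    field_simp

/-- The Carlitz parts of coefficient and weight cancel to a constant (`norm_invDiffProd_mul`), as do
the powers with exponent `u = j / r`. The one inverse difference left over supplies
`α^{-q^{n+1+r}}`, which beats the factor `α^{q^{n+r}}` of the weight. -/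
theorem IsLogRow.tendsto (hp : IsLogRow q θ κ r k l p) (hq : 1 < q) (hθ : ‖θ‖ = q)
    (hr : 1 ≤ r) (hk : 1 ≤ k) (hκ : ∀ i, 1 ≤ i → i ≤ r → ‖κ i‖ ≤ 1) (hl : l < r) {j : ℕ}
    (hj : j ≤ r * k) :
    Tendsto (fun n => ‖p n j‖ * motWeight q r k (j / r) ^ q ^ n) atTop (𝓝 0) := by
  have hα := one_lt_baseRadius hq hr
  have hβ := one_lt_baseRadius (r := 1) hq le_rfl
  have h1 : (1 : ℝ) < q := by exact_mod_cast hq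
  rw [← tendsto_add_atTop_iff_nat 1]
  set α := baseRadius q r with hαdef
  have hα0 : 0 < α := by linarith
  have hlim : Tendsto (fun n : ℕ => (baseRadius q 1 * q) ^ k * α ^ q ^ r * α⁻¹ ^ n) atTop (𝓝 0) := by
    have := (tendsto_pow_atTop_nhds_zero_of_lt_one (inv_nonneg.2 hα0.le)
      (inv_lt_one_of_one_lt₀ hα)).const_mul ((baseRadius q 1 * q) ^ k * α ^ q ^ r)
    rwa [mul_zero] at this
  refine squeeze_zero (fun n => ?_) (fun n => ?_) hlim
  · exact mul_nonneg (norm_nonneg _) (pow_nonneg (motWeight_pos hq hr _ _).le _)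
  rw [hp.apply_succ hq hθ hr hk hl n hj, motWeight_pow hr, norm_mul, norm_mul, norm_pow,
    norm_invDiff hq hθ (by omega), ← hαdef]
  have hB := norm_logRow_le hq hθ hr hκ (n + 1) (Nat.mod_lt j hr) hl
  rw [← hαdef] at hB
  set B := ‖logRow q θ κ r l (n + 1) (j % r)‖
  have hB' : B * α ^ q ^ (n + 1) ≤ α ^ q ^ r := by
    refine le_trans (mul_le_mul_of_nonneg_left ?_ (norm_nonneg _)) hB
    exact pow_le_pow_right₀ hα.le (Nat.pow_le_pow_right (by omega) (by omega))
  have hc := norm_invDiffProd_mul (k := k) hq hθ n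
  have hQ : ((q : ℝ) ^ q ^ (n + 1))⁻¹ = α ^ q ^ (n + 1) * (α ^ q ^ (n + 1 + r))⁻¹ := by
    rw [← baseRadius_pow_mul hq hr, ← hαdef]
    field_simp
  have hexp : α ^ q ^ (n + 1 + r - 1) * (α ^ q ^ (n + 1 + r))⁻¹ ≤ α⁻¹ ^ n := by
    rw [inv_pow, ← div_eq_mul_inv, div_le_iff₀ (by positivity), inv_mul_eq_div, le_div_iff₀ (by positivity),
      ← pow_add]
    refine pow_le_pow_right₀ hα.le ?_
    have h2 : n + r < q ^ (n + r) := Nat.lt_pow_self hq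
    have h3 : q ^ (n + 1 + r) = q * q ^ (n + r) := by rw [← pow_succ']; congr 1; omega
    have h4 : 2 * q ^ (n + r) ≤ q * q ^ (n + r) := Nat.mul_le_mul_right _ hq
    rw [h3, show n + 1 + r - 1 = n + r by omega]
    omega
  calc _ = (‖invDiffProd q θ k (n + 1)‖ * (baseRadius q 1 ^ q ^ (n + 1)) ^ k) * B *
        ((q : ℝ) ^ q ^ (n + 1))⁻¹ * α ^ q ^ (n + 1 + r - 1) := by
        rw [pow_succ ((q : ℝ) ^ q ^ (n + 1))⁻¹, inv_pow]
        field_simp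
    _ = (baseRadius q 1 * q) ^ k * (B * α ^ q ^ (n + 1)) *
        (α ^ q ^ (n + 1 + r - 1) * (α ^ q ^ (n + 1 + r))⁻¹) := by
        rw [hc, hQ]; ring
    _ ≤ _ := by gcongr

/-- The partial sums of the image of a row of the logarithm telescope. -/
theorem IsLogRow.sub_smul_sum (hp : IsLogRow q θ κ r k l p) (hq : 1 < q) (hθ : ‖θ‖ = q)
    (hr : 1 ≤ r) (hk : 1 ≤ k) (hl : l < r) {ε : ℕ → Fin r → K[X]} (hε : IsMotiveSeq q θ κ r ε)
    (N : ℕ) :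
    (X - C θ : K[X]) • ∑ n ∈ Finset.range (N + 1), ∑ j ∈ Finset.range (r * k + 1),
        p n j • motRow q θ r k ε n j =
      ∑ j ∈ Finset.range r, (invDiffProd q θ k (N + 1) * logRow q θ κ r l (N + 1) j) •
        motRow q θ r k ε (N + 1) j := by
  have hrk : r * (k - 1) + r = r * k := by
    rw [← Nat.mul_succ, Nat.succ_eq_add_one, Nat.sub_add_cancel hk]
  set R := motRow q θ r k ε
  have hfinal : ∑ j ∈ Finset.range (r * k + 1),
      (∑ i ∈ Finset.range (r * k + 1), p N i * tensA q κ r k N i j) • R (N + 1) j =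
      ∑ j ∈ Finset.range r, (invDiffProd q θ k (N + 1) * logRow q θ κ r l (N + 1) j) • R (N + 1) j := by
    rw [← Finset.sum_subset (Finset.range_subset_range.2 (by omega : r ≤ r * k + 1))]
    · refine Finset.sum_congr rfl fun j hj => ?_
      rw [hp.sum_mul_tensA_eq hq hθ hr hk hl N (Finset.mem_range.1 hj)]
    · intro j _ hj
      rw [Finset.mem_range] at hj
      rw [sum_mul_tensA hk, if_neg hj, zero_smul]
  rw [← hfinal]
  -- The first sum stays at level `n` and the second moves to level `n + 1`; the recursion of `p`
  -- cancels them between consecutive levels. At level `0` the first sum is zero, because `p 0` is a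
  -- unit vector in one of the last `r` places.
  have hX : ∀ n, (X - C θ : K[X]) • ∑ j ∈ Finset.range (r * k + 1), p n j • R n j =
      ∑ j ∈ Finset.range (r * k + 1),
        (∑ i ∈ Finset.range (r * k + 1), p n i * tensD q θ r n i j - θ * p n j) • R n j +
      ∑ j ∈ Finset.range (r * k + 1),
        (∑ i ∈ Finset.range (r * k + 1), p n i * tensA q κ r k n i j) • R (n + 1) j := by
    intro n
    have hC : ∀ v : Fin r → K[X], (C θ : K[X]) • v = θ • v := fun v => by
      funext μ; simp [smul_eq_C_mul]
    have h1 : (X : K[X]) • ∑ j ∈ Finset.range (r * k + 1), p n j • R n j =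
        ∑ i ∈ Finset.range (r * k + 1), p n i •
          (∑ j ∈ Finset.range (r * k + 1), tensD q θ r n i j • R n j +
            ∑ j ∈ Finset.range (r * k + 1), tensA q κ r k n i j • R (n + 1) j) := by
      rw [Finset.smul_sum]
      refine Finset.sum_congr rfl fun i hi => ?_
      rw [smul_comm, X_smul_motRow hε hr hk n (by rw [Finset.mem_range] at hi; omega)]
    rw [sub_smul, hC, h1]
    simp only [smul_add, Finset.smul_sum, Finset.sum_add_distrib, sub_smul, Finset.sum_smul,
      smul_smul, Finset.sum_sub_distrib]
    rw [Finset.sum_comm (f := fun i j => (p n i * tensD q θ r n i j) • R n j),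
      Finset.sum_comm (f := fun i j => (p n i * tensA q κ r k n i j) • R (n + 1) j)]
    abel
  clear hfinal
  induction N with
  | zero =>
    rw [zero_add, Finset.sum_range_one, hX, Finset.sum_eq_zero, zero_add]
    intro j hj
    have hj : j ≤ r * k := by rw [Finset.mem_range] at hj; omega
    rw [sum_mul_tensD hr _ hj, pow_zero, pow_one]
    have : (if r ≤ j then p 0 (j - r) else 0) = 0 := by
      split_ifs with h
      · rw [hp.init _ (by omega), if_neg]
        split_ifs <;> omega
      · rfl
    rw [this, add_zero, mul_comm, sub_self, zero_smul]
  | succ N ih =>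
    rw [Finset.sum_range_succ, smul_add, ih, hX, ← add_assoc, ← Finset.sum_add_distrib,
      Finset.sum_eq_zero, zero_add]
    intro j hj
    rw [← add_smul, ← add_sub_assoc, add_comm, ← hp.recursion N j (by rw [Finset.mem_range] at hj; omega)]
    simp

end LogRow

/-! ### Pairing with Anderson generating functions -/

section Pairing

open Polynomial Filter Topology
open scoped PowerSeries.WithPiTopology

variable {K : Type*} {q : ℕ} {r k l : ℕ}

/-- `F` is a sequence of power series that satisfies the same recursion as the twists of an Anderson
generating function. -/
def IsTwistSeq [Field K] (q : ℕ) (θ : K) (κ : ℕ → K) (r : ℕ) (F : ℕ → PowerSeries K) : Prop :=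
  ∀ n, ∑ i ∈ Finset.range r, κ (i + 1) ^ q ^ n • F (n + i + 1) =
    (PowerSeries.X - PowerSeries.C (θ ^ q ^ n)) * F n

theorem IsTwistSeq.eq_zero [Field K] {θ : K} {κ : ℕ → K} {F : ℕ → PowerSeries K}
    (hF : IsTwistSeq q θ κ r F) (hr : 1 ≤ r) (hκr : κ r ≠ 0) (h0 : ∀ m < r, F m = 0) (m : ℕ) :
    F m = 0 := by
  induction m using Nat.strong_induction_on with
  | _ m ih =>
    rcases lt_or_ge m r with hm | hm
    · exact h0 m hm
    · obtain ⟨n, rfl⟩ : ∃ n, m = n + r := ⟨m - r, by omega⟩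
      have h := hF n
      rw [ih n (by omega), mul_zero, Finset.sum_eq_single (r - 1)] at h
      · rw [show r - 1 + 1 = r by omega, show n + (r - 1) + 1 = n + r by omega] at h
        exact (smul_eq_zero.1 h).resolve_left (pow_ne_zero _ hκr)
      · intro i hi hir
        rw [Finset.mem_range] at hi
        rw [ih _ (by omega), smul_zero]
      · intro h
        rw [Finset.mem_range] at h
        omega

/-- Both sides obey the recursion of `F` and agree for `m < r`. Pairing with `F` thus sends `τ^m` to
`F m`. -/
theorem IsMotiveSeq.sum_mul [Field K] {θ : K} {κ : ℕ → K} {ε : ℕ → Fin r → K[X]}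
    (hε : IsMotiveSeq q θ κ r ε) {F : ℕ → PowerSeries K} (hF : IsTwistSeq q θ κ r F) (hr : 1 ≤ r)
    (hκr : κ r ≠ 0) (m : ℕ) : ∑ μ : Fin r, (ε m μ : PowerSeries K) * F μ = F m := by
  rw [← sub_eq_zero]
  refine IsTwistSeq.eq_zero (q := q) (θ := θ)
    (F := fun m => ∑ μ : Fin r, (ε m μ : PowerSeries K) * F μ - F m)
    (fun n => ?_) hr hκr (fun m hm => ?_) m
  · simp only [smul_sub, Finset.sum_sub_distrib, mul_sub, hF n, Finset.smul_sum]
    congr 1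
    rw [Finset.sum_comm, Finset.mul_sum]
    refine Finset.sum_congr rfl fun μ _ => ?_
    have h := congrArg (fun f : K[X] => (f : PowerSeries K)) (hε.recursion n μ)
    simp only [Polynomial.coe_mul, Polynomial.coe_sub, Polynomial.coe_X, Polynomial.coe_C] at h
    rw [← mul_assoc, ← h, ← Polynomial.coeToPowerSeries.ringHom_apply, map_sum, Finset.sum_mul]
    refine Finset.sum_congr rfl fun i _ => ?_
    rw [Polynomial.coeToPowerSeries.ringHom_apply, Polynomial.coe_smul, smul_mul_assoc]
  · rw [sub_eq_zero, Finset.sum_eq_single ⟨m, hm⟩]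
    · rw [hε.init m hm, if_pos rfl, Polynomial.coe_one, one_mul]
    · intro μ _ hμ
      rw [hε.init m hm, if_neg (fun h => hμ (Fin.ext h.symm)), Polynomial.coe_zero, zero_mul]
    · simp

variable [NormedField K] [IsUltrametricDist K] {θ : K} {κ : ℕ → K}

/-- One step `n` adds `s_n (t - θ^{q^n}) F_n` by the recursion of `F` and drops the entry `logRow n
0 = (θ - θ^{q^n}) s_n` from the window; the balance is `(t - θ) s_n F_n`. The window starts as
`F_l`, which for `l = 0` is itself the entry dropped at `n = 0`. -/
theorem sum_logRow_smul {F : ℕ → PowerSeries K} (hF : IsTwistSeq q θ κ r F) (hq : 1 < q)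
    (hθ : ‖θ‖ = q) (hl : l < r) (n : ℕ) :
    ∑ j ∈ Finset.range r, logRow q θ κ r l (n + 1) j • F (n + 1 + j) =
      (PowerSeries.X - PowerSeries.C θ) * ∑ m ∈ Finset.range (n + 1), logSeq q θ κ r l m • F m +
        if l = 0 then 0 else F l := by
  have hstep : ∀ n, ∑ j ∈ Finset.range r, logRow q θ κ r l (n + 1) j • F (n + 1 + j) =
      logSeq q θ κ r l n • ((PowerSeries.X - PowerSeries.C (θ ^ q ^ n)) * F n) +
        (∑ j ∈ Finset.range r, logRow q θ κ r l n j • F (n + j) - logRow q θ κ r l n 0 • F n) := by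
    intro n
    have h1 : ∑ j ∈ Finset.range r, logRow q θ κ r l n j • F (n + j) - logRow q θ κ r l n 0 • F n =
        ∑ j ∈ Finset.range r, logRow q θ κ r l n (j + 1) • F (n + 1 + j) := by
      have h2 := Finset.sum_range_succ (fun j => logRow q θ κ r l n j • F (n + j)) r
      rw [Finset.sum_range_succ', logRow_eq_zero hl le_rfl, zero_smul, add_zero, add_zero] at h2
      rw [← h2, add_sub_cancel_right]
      exact Finset.sum_congr rfl fun j _ => by rw [show n + (j + 1) = n + 1 + j by omega]
    rw [h1, ← hF n, Finset.smul_sum, ← Finset.sum_add_distrib]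
    refine Finset.sum_congr rfl fun j hj => ?_
    rw [logRow_succ (Finset.mem_range.1 hj), add_smul, smul_smul, show n + j + 1 = n + 1 + j by omega]
  have hC : ∀ (c : K) (f : PowerSeries K), c • f = PowerSeries.C c * f := fun c f =>
    PowerSeries.smul_eq_C_mul f c
  induction n with
  | zero =>
    rw [hstep, zero_add, Finset.sum_range_one, pow_zero, pow_one]
    have h1 : ∑ j ∈ Finset.range r, logRow q θ κ r l 0 j • F (0 + j) = F l := by
      rw [Finset.sum_eq_single l]
      · simp [logRow]
      · intro j _ hj; simp [logRow, hj]
      · intro h; rw [Finset.mem_range] at h; omega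
    rw [h1]
    rcases eq_or_ne l 0 with rfl | hl0
    · simp [logRow, hC]
      ring
    · simp [logRow, hl0, hl0.symm, hC, logSeq]
  | succ n ih =>
    have h2 : logRow q θ κ r l (n + 1) 0 = (θ - θ ^ q ^ (n + 1)) * logSeq q θ κ r l (n + 1) := by
      rw [logSeq, invDiff, if_neg (by omega), mul_inv_cancel_left₀ (theta_sub_ne_zero hq hθ (by omega))]
    rw [hstep, ih, h2, Finset.sum_range_succ _ (n + 1)]
    simp only [hC, map_mul, map_sub]
    ring

/-- The image of a row of the logarithm, paired with an Anderson generating function. -/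
theorem IsLogRow.pairing [CompleteSpace K] {p : ℕ → ℕ → K} (hp : IsLogRow q θ κ r k l p) (hq : 1 < q)
    (hθ : ‖θ‖ = q) (hr : 1 ≤ r) (hk : 1 ≤ k) (hl : l < r) (hκr : κ r ≠ 0) {ε : ℕ → Fin r → K[X]}
    (hε : IsMotiveSeq q θ κ r ε) {F : ℕ → PowerSeries K} (hF : IsTwistSeq q θ κ r F)
    {G H : PowerSeries K} {Φ : Fin r → PowerSeries K}
    (hΦ : ∀ μ ν, HasSum (rowTerm (fun n (l : Fin (r * k + 1)) => motRow q θ r k ε n l)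
      (fun l n => p n l) μ ν) ((Φ μ).coeff ν))
    (hG : Tendsto (fun N => ((invDiffProd q θ k N • carlitzProd q θ N ^ k : K[X]) : PowerSeries K))
      atTop (𝓝 G))
    (hH : ∀ ν, HasSum (fun m => logSeq q θ κ r l m * (F m).coeff ν) (H.coeff ν)) :
    (PowerSeries.X - PowerSeries.C θ) * ∑ μ, Φ μ * F μ =
      G * ((PowerSeries.X - PowerSeries.C θ) * H + if l = 0 then 0 else F l) := by
  set S : ℕ → Fin r → K[X] := fun N => ∑ n ∈ Finset.range N, ∑ j ∈ Finset.range (r * k + 1),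
        p n j • motRow q θ r k ε n j with hS
  have hSΦ : ∀ μ, Tendsto (fun N => (S N μ : PowerSeries K)) atTop (𝓝 (Φ μ)) := by
    intro μ
    rw [PowerSeries.WithPiTopology.tendsto_iff_coeff_tendsto]
    intro ν
    refine (hΦ μ ν).tendsto_sum_nat.congr fun N => ?_
    simp only [hS, rowTerm, Polynomial.coeff_coe, Finset.sum_apply, Pi.smul_apply,
      Polynomial.finsetSum_coeff, Polynomial.coeff_smul, smul_eq_mul]
    exact Finset.sum_congr rfl fun n _ =>
      Fin.sum_univ_eq_sum_range (fun j => p n j * (motRow q θ r k ε n j μ).coeff ν) _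
  have hlhs : Tendsto (fun N => (PowerSeries.X - PowerSeries.C θ) *
      ∑ μ, (S (N + 1) μ : PowerSeries K) * F μ) atTop
      (𝓝 ((PowerSeries.X - PowerSeries.C θ) * ∑ μ, Φ μ * F μ)) := by
    refine Tendsto.const_mul _ (tendsto_finsetSum _ fun μ _ => Tendsto.mul_const _ ?_)
    exact (hSΦ μ).comp (tendsto_add_atTop_nat 1)
  have hsum : Tendsto (fun N => ∑ m ∈ Finset.range (N + 1), logSeq q θ κ r l m • F m) atTop (𝓝 H) := by
    rw [PowerSeries.WithPiTopology.tendsto_iff_coeff_tendsto]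
    intro ν
    refine ((hH ν).tendsto_sum_nat.comp (tendsto_add_atTop_nat 1)).congr fun N => ?_
    simp
  have hrhs : Tendsto (fun N => ((invDiffProd q θ k (N + 1) • carlitzProd q θ (N + 1) ^ k : K[X]) :
      PowerSeries K) * ((PowerSeries.X - PowerSeries.C θ) *
        ∑ m ∈ Finset.range (N + 1), logSeq q θ κ r l m • F m + if l = 0 then 0 else F l)) atTop
      (𝓝 (G * ((PowerSeries.X - PowerSeries.C θ) * H + if l = 0 then 0 else F l))) :=
    (hG.comp (tendsto_add_atTop_nat 1)).mul ((hsum.const_mul _).add_const _)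
  -- The two sequences agree term by term: the left side telescopes, and pairing turns each `ε (N +
  -- 1 + j)` into `F (N + 1 + j)`. All limits are coefficientwise.
  refine tendsto_nhds_unique (hlhs.congr fun N => ?_) hrhs
  have h1 := hp.sub_smul_sum hq hθ hr hk hl hε N
  have h2 : ∀ μ, ((PowerSeries.X - PowerSeries.C θ) * (S (N + 1) μ : PowerSeries K)) =
      ((∑ j ∈ Finset.range r, (invDiffProd q θ k (N + 1) * logRow q θ κ r l (N + 1) j) •
        motRow q θ r k ε (N + 1) j : Fin r → K[X]) μ : PowerSeries K) := by
    intro μ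
    rw [← h1, Pi.smul_apply, smul_eq_mul, Polynomial.coe_mul, Polynomial.coe_sub, Polynomial.coe_X,
      Polynomial.coe_C]
  have hC : ∀ (c : K) (f : PowerSeries K), c • f = PowerSeries.C c * f := fun c f =>
    PowerSeries.smul_eq_C_mul f c
  rw [← sum_logRow_smul hF hq hθ hl, Finset.mul_sum]
  simp only [← mul_assoc, h2, Finset.sum_apply, Pi.smul_apply]
  simp only [← Polynomial.coeToPowerSeries.ringHom_apply, map_sum, Finset.sum_mul]
  rw [Finset.sum_comm, Finset.mul_sum]
  refine Finset.sum_congr rfl fun j hj => ?_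
  rw [← hε.sum_mul hF hr hκr (N + 1 + j), Finset.smul_sum, Finset.mul_sum]
  refine Finset.sum_congr rfl fun μ _ => ?_
  have hj := Finset.mem_range.1 hj
  simp only [Polynomial.coeToPowerSeries.ringHom_apply, Polynomial.coe_smul, motRow,
    Nat.div_eq_of_lt hj, Nat.mod_eq_of_lt hj, pow_zero, mul_one, Polynomial.coe_mul, hC, map_mul]
  ring

end Pairing

/-! ### The Moore determinant -/

section Moore

open Polynomial

variable {Fq : Type*} [Field Fq] [Fintype Fq] {K : Type*} [Field K] [Algebra Fq K]

theorem sum_smul_pow_card_pow {ι : Type*} (s : Finset ι) (c : ι → Fq) (x : ι → K) (n : ℕ) :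
    (∑ j ∈ s, c j • x j) ^ Fintype.card Fq ^ n = ∑ j ∈ s, c j • x j ^ Fintype.card Fq ^ n := by
  induction n with
  | zero => simp
  | succ n ih =>
    rw [pow_succ, pow_mul, ih]
    have h := map_sum (FiniteField.frobeniusAlgHom Fq K) (fun j => c j • x j ^ Fintype.card Fq ^ n) s
    simp only [map_smul] at h
    refine h.trans (Finset.sum_congr rfl fun j _ => ?_)
    rw [pow_mul]
    rfl

/-- A vector in the left kernel is a `q`-polynomial of degree at most `q^{r-1}` that vanishes on the
`q^r` distinct points of the span of `ξ`. -/
theorem det_moore_ne_zero {r : ℕ} {ξ : Fin r → K} (hξ : LinearIndependent Fq ξ) :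
    (Matrix.of fun i j : Fin r => ξ j ^ Fintype.card Fq ^ (i : ℕ)).det ≠ 0 := by
  have hq : 1 < Fintype.card Fq := Fintype.one_lt_card
  intro hdet
  obtain ⟨v, hv0, hv⟩ := Matrix.exists_vecMul_eq_zero_iff.2 hdet
  set P : K[X] := ∑ i : Fin r, C (v i) * X ^ Fintype.card Fq ^ (i : ℕ) with hP
  have hcoeff : ∀ i : Fin r, P.coeff (Fintype.card Fq ^ (i : ℕ)) = v i := by
    intro i
    rw [hP, finsetSum_coeff, Finset.sum_eq_single i]
    · simp
    · intro j _ hj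
      rw [coeff_C_mul_X_pow, if_neg]
      exact fun h => hj (Fin.ext (Nat.pow_right_injective hq h).symm)
    · simp
  have heval : ∀ c : Fin r → Fq, P.eval (∑ j, c j • ξ j) = 0 := by
    intro c
    rw [hP, eval_finsetSum]
    simp only [eval_mul, eval_C, eval_pow, eval_X, sum_smul_pow_card_pow, Finset.mul_sum]
    rw [Finset.sum_comm]
    refine Finset.sum_eq_zero fun j _ => ?_
    have h := congrFun hv j
    simp only [Matrix.vecMul, dotProduct, Matrix.of_apply, Pi.zero_apply] at h
    simp only [mul_smul_comm, ← Finset.smul_sum, h, smul_zero]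
  have hinj : Function.Injective fun c : Fin r → Fq => ∑ j, c j • ξ j := by
    intro c c' h
    have h1 := Fintype.linearIndependent_iff.1 hξ (c - c') (by
      simp only [Pi.sub_apply, sub_smul, Finset.sum_sub_distrib]
      exact sub_eq_zero.2 h)
    funext j
    exact sub_eq_zero.1 (h1 j)
  have hr : 0 < r := by
    rcases Nat.eq_zero_or_pos r with rfl | h
    · exact absurd (Subsingleton.elim v 0) hv0
    · exact h
  have hdeg : P.natDegree < Fintype.card (Fin r → Fq) := by
    rw [Fintype.card_fun, Fintype.card_fin]
    refine lt_of_le_of_lt (natDegree_sum_le_of_forall_le (n := Fintype.card Fq ^ (r - 1)) _ _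
      fun i _ => ?_) (Nat.pow_lt_pow_right hq (by omega))
    exact (natDegree_C_mul_X_pow_le _ _).trans (Nat.pow_le_pow_right (by omega) (by omega))
  have hP0 := eq_zero_of_natDegree_lt_card_of_eval_eq_zero P hinj heval hdeg
  refine hv0 (funext fun i => ?_)
  rw [← hcoeff i, hP0, coeff_zero, Pi.zero_apply]

end Moore

/-! ### Exponential and logarithm of a Drinfeld module -/

section Drinfeld

variable {Fq : Type*} [Field Fq] [Fintype Fq] {r : ℕ} {κ : ℕ → CInfty Fq}

theorem twist_one_apply (x : CInfty Fq) : twist Fq 1 x = x ^ Fintype.card Fq := by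
  simpa using twist_natCast Fq 1 x

theorem twist_one_pow (n : ℕ) : twist Fq 1 ^ n = twist Fq n := by
  ext x
  rw [frob_pow_apply twist_one_apply, twist_natCast]

theorem drinfeld_coeff (n : ℕ) :
    (drinfeld r κ).coeff n 0 0 = drinfeldSeq (CInfty.theta Fq) κ r n := rfl

theorem isExpSeq_expCoeff : IsExpSeq (Fintype.card Fq) (CInfty.theta Fq) κ r
    fun n => (drinfeld r κ).expCoeff n 0 0 := by
  obtain ⟨h0, h⟩ := (drinfeld r κ).isExp_expCoeff
  refine ⟨(congrFun (congrFun h0 0) 0).trans (Matrix.one_apply_eq 0), fun n => ?_⟩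
  have hn := congrFun (congrFun (h n) 0) 0
  simp only [Matrix.mul_apply, Fin.sum_univ_one, Matrix.map_apply, Matrix.sum_apply, drinfeld_coeff,
    Fin.isValue, twist_natCast] at hn
  exact hn

/-- The logarithm of a Drinfeld module has the coefficients `logSeq`. -/
theorem logCoeff_drinfeld (hr : 0 < r) (n : ℕ) : (drinfeld r κ).logCoeff n 0 0 =
    logSeq (Fintype.card Fq) (CInfty.theta Fq) κ r 0 n := by
  have h : twistMul (twist Fq 1) (fun n => (drinfeld r κ).logCoeff n 0 0)
      (fun n => (drinfeld r κ).expCoeff n 0 0) = Pi.single 0 1 := by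
    funext n
    have hn := congrFun (congrFun ((drinfeld r κ).logCoeff_mul_expCoeff n) 0) 0
    simp only [Matrix.mul_apply, Fin.sum_univ_one, Matrix.map_apply, Matrix.sum_apply,
      Fin.isValue] at hn
    rw [twistMul_eq_sum_range]
    simp only [twist_one_pow]
    rw [hn]
    split_ifs with h
    · subst h; simp
    · simp [h]
  -- Both series are left inverses of `Exp_φ`, which has leading term `1`.
  refine congrFun (twistMul_right_cancel (twist Fq 1) isExpSeq_expCoeff.1 (h.trans ?_)) n
  exact (twistMul_logSeq_eq_single isExpSeq_expCoeff Fintype.one_lt_card (CInfty.norm_theta Fq) hr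
    twist_one_apply).symm

theorem tsum_mulVec_fin_one (A : ℕ → Matrix (Fin 1) (Fin 1) (CInfty Fq)) (z : CInfty Fq)
    (h : Summable fun n => A n 0 0 * z ^ Fintype.card Fq ^ n) :
    (∑' n : ℕ, (A n).mulVec fun _ => twist Fq n z) 0 =
      evq (Fintype.card Fq) (fun n => A n 0 0) z := by
  have happ : ∀ n : ℕ, ((A n).mulVec fun _ => twist Fq n z) 0 = A n 0 0 * z ^ Fintype.card Fq ^ n := by
    intro n
    simp [Matrix.mulVec, dotProduct, twist_natCast]
  rw [tsum_apply]
  · simp only [happ]; rfl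
  · rw [Pi.summable]
    intro i
    rw [Subsingleton.elim i 0]
    simpa only [happ] using h

theorem expPhi_eq (hκ : ∀ i, 1 ≤ i → i ≤ r → ‖κ i‖ ≤ 1) (z : CInfty Fq) : expPhi r κ z =
    evq (Fintype.card Fq) (fun n => (drinfeld r κ).expCoeff n 0 0) z :=
  tsum_mulVec_fin_one _ z
    (isExpSeq_expCoeff.summable Fintype.one_lt_card (CInfty.norm_theta Fq) hκ z)

theorem logPhi_eq (hr : 1 ≤ r) (hκ : ∀ i, 1 ≤ i → i ≤ r → ‖κ i‖ ≤ 1) {z : CInfty Fq}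
    (hz : ‖z‖ < baseRadius (Fintype.card Fq) r *
    (Fintype.card Fq : ℕ)) : logPhi r κ z =
    evq (Fintype.card Fq) (logSeq (Fintype.card Fq) (CInfty.theta Fq) κ r 0) z := by
  have h := tsum_mulVec_fin_one (fun n => (drinfeld r κ).logCoeff n) z (by
    simp only [logCoeff_drinfeld hr]
    exact summable_qterm Fintype.one_lt_card hz
      (norm_logSeq_le Fintype.one_lt_card (CInfty.norm_theta Fq) hr hκ hr))
  simp only [logCoeff_drinfeld hr] at h
  exact h

end Drinfeld

/-! ### Matrices over the valuation ring -/

section Matrices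

variable {K : Type*} [NormedField K] [IsUltrametricDist K] {n : Type*} [Fintype n] [DecidableEq n]

theorem norm_det_le_one (M : Matrix n n K) (hM : ∀ i j, ‖M i j‖ ≤ 1) : ‖M.det‖ ≤ 1 := by
  rw [Matrix.det_apply]
  refine IsUltrametricDist.norm_sum_le_of_forall_le_of_nonneg zero_le_one fun σ _ => ?_
  have h : ‖∏ i, M (σ i) i‖ ≤ 1 := by
    rw [norm_prod]
    exact Finset.prod_le_one (fun _ _ => norm_nonneg _) fun i _ => hM _ _
  rcases Int.units_eq_one_or (Equiv.Perm.sign σ) with h1 | h1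
  · rw [h1, one_smul]; exact h
  · rw [h1, Units.neg_smul, one_smul, norm_neg]; exact h

theorem norm_inv_apply_le_one (M : Matrix n n K) (hM : ∀ i j, ‖M i j‖ ≤ 1) (hdet : ‖M.det‖ = 1)
    (i j : n) : ‖M⁻¹ i j‖ ≤ 1 := by
  rw [Matrix.inv_def, Matrix.smul_apply, smul_eq_mul, norm_mul, Ring.inverse_eq_inv', norm_inv, hdet,
    inv_one, one_mul, Matrix.adjugate_apply]
  refine norm_det_le_one _ fun a b => ?_
  rw [Matrix.updateRow_apply]
  split_ifs
  · rw [Pi.single_apply]; split_ifs <;> simp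
  · exact hM a b

/-- Reversing the order of the columns makes the matrix triangular and changes the determinant by a
sign only. -/
theorem norm_det_of_antitriangular {r : ℕ} (M : Matrix (Fin r) (Fin r) K)
    (h0 : ∀ i j : Fin r, r < (i : ℕ) + j + 1 → M i j = 0)
    (h1 : ∀ i j : Fin r, (i : ℕ) + j + 1 = r → ‖M i j‖ = 1) : ‖M.det‖ = 1 := by
  have hperm := Matrix.det_permute' Fin.revPerm M
  have htri : (M.submatrix id Fin.revPerm).IsUpperTriangular := by
    intro i j hij
    apply h0
    have hij : (j : ℕ) < i := hij
    simp only [id, Fin.revPerm_apply, Fin.val_rev]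
    omega
  rw [Matrix.det_of_isUpperTriangular htri] at hperm
  have h2 : ‖∏ i, (M.submatrix id Fin.revPerm) i i‖ = 1 := by
    rw [norm_prod]
    refine Finset.prod_eq_one fun i _ => h1 _ _ ?_
    simp only [id, Fin.revPerm_apply, Fin.val_rev]
    omega
  rw [hperm, norm_mul] at h2
  rcases Int.units_eq_one_or (Equiv.Perm.sign (Fin.revPerm : Equiv.Perm (Fin r))) with h3 | h3
  · simpa [h3] using h2
  · simpa [h3] using h2

end Matrices

/-! ### The matrix `V` and its twist over the valuation ring -/

section MatV

variable {Fq : Type*} [Field Fq] [Fintype Fq] {r : ℕ} {κ : ℕ → CInfty Fq}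

theorem norm_twist_neg_pow (j : ℕ) (x : CInfty Fq) :
    ‖twist Fq (-(j : ℤ)) x‖ ^ Fintype.card Fq ^ j = ‖x‖ := by
  rw [← norm_pow, ← twist_natCast]
  have := twist_neg_twist Fq (-(j : ℤ)) x
  rw [neg_neg] at this
  rw [this]

theorem norm_twist_neg_le_one (j : ℕ) {x : CInfty Fq} (hx : ‖x‖ ≤ 1) :
    ‖twist Fq (-(j : ℤ)) x‖ ≤ 1 := by
  rw [← norm_twist_neg_pow j] at hx
  exact (pow_le_one_iff_of_nonneg (norm_nonneg _) (pow_ne_zero _ Fintype.card_ne_zero)).1 hx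

theorem norm_twist_neg_eq_one (j : ℕ) {x : CInfty Fq} (hx : ‖x‖ = 1) :
    ‖twist Fq (-(j : ℤ)) x‖ = 1 := by
  rw [← norm_twist_neg_pow j] at hx
  exact (pow_eq_one_iff_of_nonneg (norm_nonneg _) (pow_ne_zero _ Fintype.card_ne_zero)).1 hx

theorem norm_matV_le_one (hκ : ∀ i, 1 ≤ i → i ≤ r → ‖κ i‖ ≤ 1) (i j : Fin r) :
    ‖matV r κ i j‖ ≤ 1 := by
  rw [matV, Matrix.of_apply]
  split_ifs with h
  · exact norm_twist_neg_le_one _ (hκ _ (by omega) h)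
  · simp

theorem norm_det_matV (hκr : ‖κ r‖ = 1) : ‖(matV r κ).det‖ = 1 := by
  refine norm_det_of_antitriangular _ (fun i j h => ?_) fun i j h => ?_
  · rw [matV, Matrix.of_apply, if_neg (by omega)]
  · rw [matV, Matrix.of_apply, if_pos h.le, h]
    exact norm_twist_neg_eq_one _ hκr

variable (r κ) in
/-- The matrix `(V^{(-1)})^tr`, whose inverse changes the basis in `φ_tens`. -/
def twistedV : Matrix (Fin r) (Fin r) (CInfty Fq) := ((matV r κ).map (twist Fq (-1))).transpose

theorem det_twistedV : (twistedV r κ).det = twist Fq (-1) (matV r κ).det := by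
  rw [twistedV, Matrix.det_transpose, RingHom.map_det]; rfl

theorem norm_det_twistedV (hκr : ‖κ r‖ = 1) : ‖(twistedV r κ).det‖ = 1 := by
  rw [det_twistedV]
  exact norm_twist_neg_eq_one 1 (norm_det_matV hκr)

theorem isUnit_det_twistedV (hκr : ‖κ r‖ = 1) : IsUnit (twistedV r κ).det := by
  rw [isUnit_iff_ne_zero, ← norm_ne_zero_iff, norm_det_twistedV hκr]
  exact one_ne_zero

/-- The change of basis has entries in the valuation ring, so the bounds for `motRow` pass to
`tensRow`. -/
theorem norm_twistedV_inv_le_one (hκ : ∀ i, 1 ≤ i → i ≤ r → ‖κ i‖ ≤ 1) (hκr : ‖κ r‖ = 1)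
    (i j : Fin r) : ‖(twistedV r κ)⁻¹ i j‖ ≤ 1 :=
  norm_inv_apply_le_one _ (fun i j => norm_twist_neg_le_one 1 (norm_matV_le_one hκ j i))
    (norm_det_twistedV hκr) i j

end MatV

/-! ### The matrices `Θ^{(n - 1)} ⋯ Θ` -/

section ThetaProd

open Polynomial

variable {Fq : Type*} [Field Fq] [Fintype Fq] {r : ℕ} {κ : ℕ → CInfty Fq}

variable (r κ) in
/-- The row vector `τ ^ m` in the basis `1, …, τ ^ (r - 1)`. -/
def motSeq (m : ℕ) (μ : Fin r) : (CInfty Fq)[X] :=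
  if m < r then if m = μ then 1 else 0
  else thetaProd r κ (m - r + 1) ⟨r - 1, by have := μ.pos; omega⟩ μ

/-- The rows of `Θ` above the last shift the index by one, so row `i` at level `n + 1` is row `i +
1` at level `n`; the last row defines `motSeq`. -/
theorem thetaProd_apply (n : ℕ) (i μ : Fin r) : thetaProd r κ n i μ = motSeq r κ (n + i) μ := by
  induction n generalizing i with
  | zero =>
    rw [thetaProd, motSeq, if_pos (by omega), Matrix.one_apply]
    simp only [zero_add, Fin.ext_iff]
  | succ n ih =>
    rcases lt_or_ge ((i : ℕ) + 1) r with hi | hi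
    · rw [thetaProd, Matrix.mul_apply, Finset.sum_eq_single ⟨i + 1, hi⟩]
      · rw [ih, Matrix.map_apply, Theta, Matrix.of_apply, if_pos hi, if_pos rfl, Polynomial.map_one,
          one_mul, show n + ((⟨i + 1, hi⟩ : Fin r) : ℕ) = n + 1 + i from by simp only; omega]
      · intro j _ hj
        rw [Matrix.map_apply, Theta, Matrix.of_apply, if_pos hi, if_neg (fun h => hj (Fin.ext h)),
          Polynomial.map_zero, zero_mul]
      · simp
    · have h1 : i = ⟨r - 1, by have := μ.pos; omega⟩ := by apply Fin.ext; simp only; omega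
      rw [motSeq, if_neg (by omega), show n + 1 + (i : ℕ) - r + 1 = n + 1 by omega, ← h1]

/-- The last row of `Θ^{(n)}` is the relation `φ_θ = t`, twisted and solved for the top power of
`τ`; multiplying by `κ_r^{q^n}` recovers the recursion. -/
theorem isMotiveSeq_motSeq (hr : 1 ≤ r) (hκr : κ r ≠ 0) :
    IsMotiveSeq (Fintype.card Fq) (CInfty.theta Fq) κ r (motSeq r κ) := by
  refine ⟨fun m hm μ => by rw [motSeq, if_pos hm], fun n μ => ?_⟩
  obtain ⟨r', rfl⟩ : ∃ r', r = r' + 1 := ⟨r - 1, by omega⟩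
  have h1 := thetaProd_apply (κ := κ) (n + 1) (Fin.last r') μ
  rw [thetaProd, Matrix.mul_apply, Fin.sum_univ_succ] at h1
  have hne := pow_ne_zero (Fintype.card Fq ^ n) hκr
  have h2 : ∀ i : Fin r', (Theta (r' + 1) κ).map (Polynomial.map (twist Fq n)) (Fin.last r') i.succ =
      -C (κ (i + 1) ^ Fintype.card Fq ^ n / κ (r' + 1) ^ Fintype.card Fq ^ n) := by
    intro i
    simp [Theta, twist_natCast]
  have h3 : (Theta (r' + 1) κ).map (Polynomial.map (twist Fq n)) (Fin.last r') 0 =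
      C (κ (r' + 1) ^ Fintype.card Fq ^ n)⁻¹ *
        (X - C (CInfty.theta Fq ^ Fintype.card Fq ^ n)) := by
    simp [Theta, twist_natCast]
  simp only [h2, h3, thetaProd_apply] at h1
  rw [Finset.sum_range_succ, show n + r' + 1 = n + 1 + ((Fin.last r' : Fin (r' + 1)) : ℕ) by
    simp only [Fin.val_last]; omega, ← h1]
  simp only [smul_eq_C_mul, mul_add, Finset.mul_sum]
  rw [← Fin.sum_univ_eq_sum_range (fun i => C (κ (i + 1) ^ Fintype.card Fq ^ n) *
    motSeq (r' + 1) κ (n + i + 1) μ)]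
  have h4 : ∀ i : Fin r', C (κ (r' + 1) ^ Fintype.card Fq ^ n) *
      (-C (κ (i + 1) ^ Fintype.card Fq ^ n / κ (r' + 1) ^ Fintype.card Fq ^ n) *
        motSeq (r' + 1) κ (n + (i.succ : Fin (r' + 1))) μ) =
      -(C (κ (i + 1) ^ Fintype.card Fq ^ n) * motSeq (r' + 1) κ (n + i + 1) μ) := by
    intro i
    rw [neg_mul, mul_neg, ← mul_assoc, ← C_mul, mul_div_cancel₀ _ hne, Fin.val_succ, ← add_assoc]
  simp only [h4]
  rw [Finset.sum_neg_distrib, ← mul_assoc, ← mul_assoc, ← C_mul, mul_inv_cancel₀ hne, C_1, one_mul,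
    Fin.val_zero, add_zero]
  ring

theorem tensRow_eq (k n l : ℕ) (μ : Fin r) : tensRow r k κ n l μ =
    ∑ i, (twistedV r κ)⁻¹ i μ •
      motRow (Fintype.card Fq) (CInfty.theta Fq) r k (motSeq r κ) n l i := by
  simp only [tensRow, motRow, carlitzProd, Matrix.mul_apply, thetaProd_apply, Matrix.map_apply,
    Finset.mul_sum, smul_eq_C_mul]
  refine Finset.sum_congr rfl fun i _ => ?_
  rw [twistedV]
  ring

theorem gaussLe_tensRow (hr : 1 ≤ r) (hκ : ∀ i, 1 ≤ i → i ≤ r → ‖κ i‖ ≤ 1) (hκr : ‖κ r‖ = 1)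
    {k : ℕ} (n : ℕ) {l : ℕ} (hl : l ≤ r * k) (μ : Fin r) : GaussLe 1 (tensRow r k κ n l μ)
      (motWeight (Fintype.card Fq) r k (l / r) ^ Fintype.card Fq ^ n) := by
  have hq : 1 < Fintype.card Fq := Fintype.one_lt_card
  have hκr0 : κ r ≠ 0 := by rw [← norm_ne_zero_iff, hκr]; exact one_ne_zero
  rw [tensRow_eq]
  refine GaussLe.sum zero_le_one (pow_nonneg (motWeight_pos hq hr _ _).le _) _ _ fun i _ =>
    GaussLe.smul zero_le_one ?_ (norm_twistedV_inv_le_one hκ hκr i μ)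
  have h := gaussLe_motRow (isMotiveSeq_motSeq hr hκr0) hq (CInfty.norm_theta Fq) hr hκ hκr
    zero_le_one (x := fun _ => 1) (P := 1) (fun _ => le_rfl)
    (fun i => by rw [mul_one]; exact one_le_pow₀ (by exact_mod_cast hq.le)) (by simp) n hl i
  simpa using h

theorem tensWeight_eq (k u : ℕ) :
    tensWeight Fq r k u = motWeight (Fintype.card Fq) r k u := by
  have h1 : (1 : ℝ) < Fintype.card Fq := by exact_mod_cast Fintype.one_lt_card (α := Fq)
  have h0 : (0 : ℝ) < Fintype.card Fq := by linarith
  have h2 : ∀ (x : ℝ) (n : ℕ), ((Fintype.card Fq : ℝ) ^ x) ^ n = (Fintype.card Fq : ℝ) ^ (x * n) :=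
    fun x n => by rw [Real.rpow_mul h0.le, Real.rpow_natCast]
  rw [tensWeight, motWeight, baseRadius, baseRadius, h2, h2, Real.rpow_add h0, Real.rpow_add h0,
    Real.rpow_natCast]
  push_cast
  rw [pow_one, one_div_mul_eq_div, one_div_mul_eq_div]

end ThetaProd

/-! ### The Carlitz period and the Anderson–Thakur function -/

section Carlitz

open Filter Topology
open scoped PowerSeries.WithPiTopology

variable {K : Type*} [NormedField K] [IsUltrametricDist K] [CompleteSpace K] {q : ℕ} {θ : K}

theorem norm_inv_theta_pow_le (hq : 1 < q) (hθ : ‖θ‖ = q) (j : ℕ) :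
    ‖(θ ^ q ^ j)⁻¹‖ ≤ (q : ℝ)⁻¹ ^ j := by
  have h1 : (1 : ℝ) < q := by exact_mod_cast hq
  rw [norm_inv, norm_pow, hθ, ← inv_pow]
  exact pow_le_pow_of_le (by positivity) (inv_lt_one_of_one_lt₀ h1) hq j

theorem summable_norm_inv_theta_pow (hq : 1 < q) (hθ : ‖θ‖ = q) :
    Summable fun j : ℕ => ‖(θ ^ q ^ j)⁻¹‖ := by
  have h1 : (1 : ℝ) < q := by exact_mod_cast hq
  exact Summable.of_nonneg_of_le (fun _ => norm_nonneg _) (norm_inv_theta_pow_le hq hθ)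
    (summable_geometric_of_lt_one (by positivity) (inv_lt_one_of_one_lt₀ h1))

/-- In the expanded product a finite set `s` contributes only to `t^{|s|}`, with coefficient `∏
(-c_i)`, and these products are summable. -/
theorem multipliable_one_sub_C_mul_X {c : ℕ → K} (hc : Summable fun j => ‖c j‖) :
    Multipliable fun j => (1 - PowerSeries.C (c j) * PowerSeries.X : PowerSeries K) := by
  have h : Multipliable fun j => (1 + -(PowerSeries.C (c j) * PowerSeries.X) : PowerSeries K) := by
    apply multipliable_one_add_of_summable_prod
    rw [PowerSeries.WithPiTopology.summable_iff_summable_coeff]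
    intro ν
    have hs : Summable fun s : Finset ℕ => ∏ i ∈ s, -c i :=
      summable_finsetProd_of_summable_norm (f := fun i => -c i) (by simpa using hc)
    refine (hs.indicator {s | s.card = ν}).congr fun s => ?_
    have h1 : ∏ i ∈ s, -(PowerSeries.C (c i) * PowerSeries.X : PowerSeries K) =
        PowerSeries.C (∏ i ∈ s, -c i) * PowerSeries.X ^ s.card := by
      rw [map_prod, ← Finset.prod_const, ← Finset.prod_mul_distrib]
      simp
    rw [h1, PowerSeries.coeff_C_mul, PowerSeries.coeff_X_pow]
    by_cases h2 : s.card = ν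
    · simp [Set.indicator, h2]
    · simp [Set.indicator, h2, Ne.symm h2]
  simpa only [← sub_eq_add_neg] using h

theorem norm_theta_div_lt_one (hq : 1 < q) (hθ : ‖θ‖ = q) (j : ℕ) : ‖θ / θ ^ q ^ (j + 1)‖ < 1 := by
  have h1 : (1 : ℝ) < q := by exact_mod_cast hq
  rw [norm_div, norm_pow, hθ, div_lt_one (by positivity)]
  calc (q : ℝ) = (q : ℝ) ^ 1 := (pow_one _).symm
    _ < _ := pow_lt_pow_right₀ h1 (Nat.one_lt_pow (by omega) hq)

theorem multipliable_one_sub_theta_div (hq : 1 < q) (hθ : ‖θ‖ = q) :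
    Multipliable fun j : ℕ => 1 - θ / θ ^ q ^ (j + 1) := by
  have h : Multipliable fun j : ℕ => 1 + -(θ / θ ^ q ^ (j + 1)) := by
    apply multipliable_one_add_of_summable
    have := ((summable_nat_add_iff 1).2 (summable_norm_inv_theta_pow hq hθ)).mul_left ‖θ‖
    refine this.congr fun j => ?_
    rw [norm_neg, div_eq_mul_inv, norm_mul]
  simpa only [← sub_eq_add_neg] using h

/-- Each factor, hence each partial product and the limit, has norm `1`. -/
theorem tprod_one_sub_theta_div_ne_zero (hq : 1 < q) (hθ : ‖θ‖ = q) :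
    ∏' j : ℕ, (1 - θ / θ ^ q ^ (j + 1)) ≠ 0 := by
  have h := (multipliable_one_sub_theta_div hq hθ).hasProd.tendsto_prod_nat.norm
  have h1 : ∀ n, ‖∏ j ∈ Finset.range n, (1 - θ / θ ^ q ^ (j + 1))‖ = 1 := by
    intro n
    rw [norm_prod]
    refine Finset.prod_eq_one fun j _ => ?_
    have h2 := norm_theta_div_lt_one hq hθ j
    rw [sub_eq_add_neg, IsUltrametricDist.norm_add_eq_max_of_norm_ne_norm
      (by rw [norm_neg, norm_one]; exact h2.ne'), norm_neg, norm_one, max_eq_left h2.le]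
  simp only [h1] at h
  have h2 := tendsto_nhds_unique h tendsto_const_nhds
  rw [← norm_ne_zero_iff, h2]
  exact one_ne_zero

theorem constantCoeff_tprod_one_sub {c : ℕ → K} (hc : Summable fun j => ‖c j‖) :
    PowerSeries.constantCoeff
      (∏' j, (1 - PowerSeries.C (c j) * PowerSeries.X : PowerSeries K)) = 1 := by
  have h := (multipliable_one_sub_C_mul_X hc).hasProd.tendsto_prod_nat
  have h1 := ((PowerSeries.WithPiTopology.continuous_constantCoeff K).tendsto _).comp h
  refine tendsto_nhds_unique h1 (tendsto_const_nhds.congr fun n => ?_)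
  simp [map_prod]

/-- Write `t - c = -c (1 - t / c)`. For `i ≥ 1` the constants combine to `-θ^{q^i} / (θ - θ^{q^i}) =
(1 - θ / θ^{q^i})⁻¹`; for `i = 0` the value `invDiff = 1` leaves `-θ`. -/
theorem invDiff_smul_carlitzProd (hq : 1 < q) (hθ : ‖θ‖ = q) (N : ℕ) :
    PowerSeries.C (∏ i ∈ Finset.range (N + 1), invDiff q θ i) *
      (carlitzProd q θ (N + 1) : PowerSeries K) =
    PowerSeries.C (-θ * (∏ j ∈ Finset.range N, (1 - θ / θ ^ q ^ (j + 1)))⁻¹) *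
      ∏ j ∈ Finset.range (N + 1), (1 - PowerSeries.C (θ ^ q ^ j)⁻¹ * PowerSeries.X) := by
  have hθ0 : θ ≠ 0 := by
    rw [← norm_ne_zero_iff, hθ]
    have : (0 : ℝ) < q := by exact_mod_cast (by omega : 0 < q)
    exact this.ne'
  have hfac : ∀ (c : K), c ≠ 0 → (PowerSeries.X - PowerSeries.C c : PowerSeries K) =
      PowerSeries.C (-c) * (1 - PowerSeries.C c⁻¹ * PowerSeries.X) := by
    intro c hc
    rw [mul_sub, ← mul_assoc, ← map_mul, neg_mul, mul_inv_cancel₀ hc]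
    simp
    ring
  induction N with
  | zero =>
    simp only [zero_add, Finset.prod_range_one, Finset.prod_range_zero, carlitzProd, pow_zero, pow_one,
      inv_one, mul_one, invDiff, if_true, map_one, one_mul]
    rw [Polynomial.coe_sub, Polynomial.coe_X, Polynomial.coe_C, hfac θ hθ0]
  | succ N ih =>
    have hc : carlitzProd q θ (N + 1 + 1) =
        carlitzProd q θ (N + 1) * (Polynomial.X - Polynomial.C (θ ^ q ^ (N + 1))) :=
      Finset.prod_range_succ _ _
    rw [Finset.prod_range_succ _ (N + 1), Finset.prod_range_succ _ (N + 1),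
      Finset.prod_range_succ (fun j => 1 - θ / θ ^ q ^ (j + 1)) N, hc, Polynomial.coe_mul, map_mul, mul_mul_mul_comm, ih, Polynomial.coe_sub, Polynomial.coe_X,
      Polynomial.coe_C, hfac _ (pow_ne_zero _ hθ0)]
    have h1 : invDiff q θ (N + 1) * -θ ^ q ^ (N + 1) = (1 - θ / θ ^ q ^ (N + 1))⁻¹ := by
      have h2 := theta_sub_ne_zero hq hθ (Nat.succ_ne_zero N)
      have h3 := pow_ne_zero (q ^ (N + 1)) hθ0
      have h4 : 1 - θ / θ ^ q ^ (N + 1) ≠ 0 := by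
        rw [one_sub_div h3]
        refine div_ne_zero ?_ h3
        rw [← neg_sub]
        exact neg_ne_zero.2 h2
      rw [invDiff, if_neg (Nat.succ_ne_zero N)]
      refine eq_inv_of_mul_eq_one_left ?_
      rw [mul_assoc, inv_mul_eq_one₀ h2]
      field_simp
      ring
    rw [mul_inv, ← mul_assoc (-θ), ← h1]
    simp only [map_mul]
    generalize ∏ j ∈ Finset.range (N + 1), (1 - PowerSeries.C (θ ^ q ^ j)⁻¹ * PowerSeries.X) = Q
    ring

/-- The factors `((t - θ) ⋯ (t - θ ^ (q ^ (N - 1))))^k / ∏ (θ - θ ^ (q ^ i))^k` converge. -/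
theorem tendsto_invDiffProd_smul (hq : 1 < q) (hθ : ‖θ‖ = q) (k : ℕ) :
    Tendsto (fun N => ((invDiffProd q θ k N • carlitzProd q θ N ^ k : Polynomial K) :
      PowerSeries K)) atTop
      (𝓝 ((PowerSeries.C (-θ * (∏' j : ℕ, (1 - θ / θ ^ q ^ (j + 1)))⁻¹) *
        ∏' j : ℕ, (1 - PowerSeries.C (θ ^ q ^ j)⁻¹ * PowerSeries.X)) ^ k)) := by
  rw [← tendsto_add_atTop_iff_nat 1]
  have h1 := (multipliable_one_sub_theta_div hq hθ).hasProd.tendsto_prod_nat.inv₀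
    (tprod_one_sub_theta_div_ne_zero hq hθ)
  have h2 := (multipliable_one_sub_C_mul_X
    (summable_norm_inv_theta_pow hq hθ)).hasProd.tendsto_prod_nat
  have h3 := (((PowerSeries.WithPiTopology.continuous_C (R := K)).tendsto _).comp
    (h1.const_mul (-θ))).mul (h2.comp (tendsto_add_atTop_nat 1))
  refine (h3.pow k).congr fun N => ?_
  simp only [Function.comp]
  rw [← invDiff_smul_carlitzProd hq hθ N, Polynomial.coe_smul, PowerSeries.smul_eq_C_mul, invDiffProd,
    Polynomial.coe_pow, map_pow, mul_pow]

end Carlitz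

/-! ### The limit of the Carlitz factors in terms of `π̃` and `ω_C` -/

section CarlitzPeriod

open Filter Topology
open scoped PowerSeries.WithPiTopology

variable {Fq : Type*} [Field Fq] [Fintype Fq]

theorem inv_pow_powerSeries {K : Type*} [Field K] (f : PowerSeries K) (k : ℕ) :
    (f ^ k)⁻¹ = f⁻¹ ^ k := by
  induction k with
  | zero => simp
  | succ k ih => rw [pow_succ, PowerSeries.mul_inv_rev, ih, pow_succ']

theorem ne_zero_of_pow_eq_neg_theta {η : CInfty Fq}
    (hη : η ^ (Fintype.card Fq - 1) = -CInfty.theta Fq) : η ≠ 0 := by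
  rintro rfl
  have hq : 1 < Fintype.card Fq := Fintype.one_lt_card
  rw [zero_pow (by omega), eq_comm, neg_eq_zero, ← norm_eq_zero, CInfty.norm_theta] at hη
  exact Fintype.card_ne_zero (by exact_mod_cast hη)

/-- The root `η` occurs in both `π̃` and `ω_C` and cancels in the quotient; only `η ≠ 0` matters. -/
theorem tendsto_period_factor {η : CInfty Fq} (hη : η ≠ 0) (k : ℕ) :
    Tendsto (fun N => ((invDiffProd (Fintype.card Fq) (CInfty.theta Fq) k N •
      carlitzProd (Fintype.card Fq) (CInfty.theta Fq) N ^ k : Polynomial (CInfty Fq)) :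
      PowerSeries (CInfty Fq))) atTop
      (𝓝 (PowerSeries.C ((-carlitzPeriod η) ^ k) * (omegaC η ^ k)⁻¹)) := by
  have hq : 1 < Fintype.card Fq := Fintype.one_lt_card
  have hθ := CInfty.norm_theta Fq
  have h := tendsto_invDiffProd_smul hq hθ k
  convert h using 2
  rw [inv_pow_powerSeries, map_pow, ← mul_pow]
  congr 1
  have hc := constantCoeff_tprod_one_sub (summable_norm_inv_theta_pow hq hθ)
  rw [omegaC, PowerSeries.mul_inv_rev, carlitzPeriod]
  set Q := ∏' j : ℕ, (1 - PowerSeries.C (CInfty.theta Fq ^ Fintype.card Fq ^ j)⁻¹ *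
    (PowerSeries.X : PowerSeries (CInfty Fq)))
  have h1 : (Q⁻¹)⁻¹ = Q := by
    rw [PowerSeries.inv_eq_iff_mul_eq_one, PowerSeries.mul_inv_cancel]
    · rw [hc]; exact one_ne_zero
    · rw [PowerSeries.constantCoeff_inv, hc, inv_one]; exact one_ne_zero
  rw [h1, PowerSeries.C_inv, mul_comm Q, ← mul_assoc, ← map_mul]
  congr 2
  field_simp

end CarlitzPeriod

/-! ### Torsion points and periods -/

/-- For `‖x‖ ≥ α q > q` the term `κ_r x^{q^r}` would strictly dominate all others, so the sum could
not vanish. -/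
theorem norm_lt_of_torsion {K : Type*} [NormedField K] [IsUltrametricDist K] {q r : ℕ} {θ : K}
    {κ : ℕ → K} (hq : 1 < q) (hθ : ‖θ‖ = q) (hr : 1 ≤ r) (hκ : ∀ i, 1 ≤ i → i ≤ r → ‖κ i‖ ≤ 1)
    (hκr : ‖κ r‖ = 1) {x : K}
    (hx : θ * x + ∑ i ∈ Finset.range r, κ (i + 1) * x ^ q ^ (i + 1) = 0) :
    ‖x‖ < baseRadius q r * q := by
  have hq1 : (1 : ℝ) < q := by exact_mod_cast hq
  by_contra! hle
  have hxq : (q : ℝ) < ‖x‖ := by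
    have := one_lt_baseRadius hq hr
    nlinarith
  have hx1 : 1 < ‖x‖ := hq1.trans hxq
  obtain ⟨s, rfl⟩ : ∃ s, r = s + 1 := ⟨r - 1, by omega⟩
  rw [Finset.sum_range_succ, ← add_assoc] at hx
  have h1 := congrArg norm (eq_neg_of_add_eq_zero_right hx)
  rw [norm_mul, hκr, one_mul, norm_pow, norm_neg] at h1
  refine absurd h1 (ne_of_gt (lt_of_le_of_lt (IsUltrametricDist.norm_add_le_max _ _) (max_lt ?_ ?_)))
  · calc ‖θ * x‖ = q * ‖x‖ := by rw [norm_mul, hθ]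
      _ < ‖x‖ * ‖x‖ := by gcongr
      _ = ‖x‖ ^ 2 := (sq _).symm
      _ ≤ ‖x‖ ^ q ^ (s + 1) := pow_le_pow_right₀ hx1.le
        (hq.trans_le (Nat.le_self_pow (Nat.succ_ne_zero s) q))
  · refine lt_of_le_of_lt (IsUltrametricDist.norm_sum_le_of_forall_le_of_nonneg
      (C := ‖x‖ ^ q ^ s) (by positivity) fun i hi => ?_)
      (pow_lt_pow_right₀ hx1 (Nat.pow_lt_pow_right hq (Nat.lt_succ_self s)))
    rw [Finset.mem_range] at hi
    rw [norm_mul, norm_pow]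
    calc ‖κ (i + 1)‖ * ‖x‖ ^ q ^ (i + 1) ≤ 1 * ‖x‖ ^ q ^ (i + 1) := by
          gcongr; exact hκ _ (by omega) (by omega)
      _ = ‖x‖ ^ q ^ (i + 1) := one_mul _
      _ ≤ ‖x‖ ^ q ^ s := pow_le_pow_right₀ hx1.le (Nat.pow_le_pow_right (by omega) (by omega))

section Periods

open Filter Topology

variable {Fq : Type*} [Field Fq] [Fintype Fq] {r : ℕ} {κ : ℕ → CInfty Fq}

theorem theta_ne_zero : CInfty.theta Fq ≠ 0 := by
  rw [← norm_ne_zero_iff, CInfty.norm_theta]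
  exact_mod_cast Fintype.card_ne_zero

theorem expPhi_theta_mul (hκ : ∀ i, 1 ≤ i → i ≤ r → ‖κ i‖ ≤ 1) (z : CInfty Fq) :
    expPhi r κ (CInfty.theta Fq * z) = CInfty.theta Fq * expPhi r κ z +
      ∑ i ∈ Finset.range r, κ (i + 1) * expPhi r κ z ^ Fintype.card Fq ^ (i + 1) := by
  rw [expPhi_eq hκ, expPhi_eq hκ]
  exact isExpSeq_expCoeff.evq_theta_mul Fintype.one_lt_card (CInfty.norm_theta Fq) hκ twist_one_apply z

theorem norm_expPhi (hr : 1 ≤ r) (hκ : ∀ i, 1 ≤ i → i ≤ r → ‖κ i‖ ≤ 1) {z : CInfty Fq}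
    (hz : ‖z‖ < baseRadius (Fintype.card Fq) r * (Fintype.card Fq : ℕ)) :
    ‖expPhi r κ z‖ = ‖z‖ := by
  rw [expPhi_eq hκ]
  exact norm_evq Fintype.one_lt_card hz isExpSeq_expCoeff.1
    (isExpSeq_expCoeff.norm_mul_radius_le Fintype.one_lt_card (CInfty.norm_theta Fq) hr hκ)

theorem isQuasiPeriodic_iff (hκ : ∀ i, 1 ≤ i → i ≤ r → ‖κ i‖ ≤ 1) {l : ℕ}
    {F : CInfty Fq → CInfty Fq} : IsQuasiPeriodic r κ l F ↔
      IsQuasiPeriodicFor (Fintype.card Fq) (CInfty.theta Fq)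
        (fun n => (drinfeld r κ).expCoeff n 0 0) l F := by
  simp only [IsQuasiPeriodic, IsQuasiPeriodicFor, expPhi_eq hκ]

variable (r κ) in
/-- `z` is a period of `φ` such that `z / θ` lies in the disc where `exp_φ` is isometric. -/
structure IsSmallPeriod (z : CInfty Fq) : Prop where
  norm_div_lt : ‖z / CInfty.theta Fq‖ < baseRadius (Fintype.card Fq) r * (Fintype.card Fq : ℕ)
  expPhi_eq_zero : expPhi r κ z = 0

/-- The torsion point lies in the disc where `exp` inverts `log`, so `exp (z / θ) = x` and `exp z =
φ_θ(x) = 0`. -/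
theorem isSmallPeriod_of_mem_thetaTorsion (hr : 1 ≤ r) (hκ : ∀ i, 1 ≤ i → i ≤ r → ‖κ i‖ ≤ 1)
    (hκr : ‖κ r‖ = 1) {x z : CInfty Fq} (hx : x ∈ thetaTorsion r κ)
    (hz : z = CInfty.theta Fq * logPhi r κ x) :
    IsSmallPeriod r κ z ∧ expPhi r κ (z / CInfty.theta Fq) = x := by
  have hq : 1 < Fintype.card Fq := Fintype.one_lt_card
  have hθ := CInfty.norm_theta Fq
  have hx' : CInfty.theta Fq * x +
      ∑ i ∈ Finset.range r, κ (i + 1) * x ^ Fintype.card Fq ^ (i + 1) = 0 := by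
    have h : CInfty.theta Fq * x + ∑ i ∈ Finset.Icc 1 r, κ i * x ^ Fintype.card Fq ^ i = 0 := hx
    rwa [Finset.range_eq_Ico, Finset.sum_Ico_add' (fun i => κ i * x ^ Fintype.card Fq ^ i),
      zero_add, Finset.Ico_add_one_right_eq_Icc]
  have hlt := norm_lt_of_torsion hq hθ hr hκ hκr hx'
  have hdiv : z / CInfty.theta Fq = logPhi r κ x := by
    rw [hz, mul_div_cancel_left₀ _ theta_ne_zero]
  have hlog := logPhi_eq hr hκ hlt
  have hexp : expPhi r κ (logPhi r κ x) = x := by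
    rw [expPhi_eq hκ, hlog]
    exact evq_evq_logSeq isExpSeq_expCoeff hq hθ hr hκ twist_one_apply hlt
  refine ⟨⟨?_, ?_⟩, by rw [hdiv, hexp]⟩
  · rw [hdiv, hlog, norm_evq hq hlt (by simp [logSeq, logRow, invDiff]) (norm_logSeq_le hq hθ hr hκ hr)]
    exact hlt
  · rw [hz, expPhi_theta_mul hκ, hexp, hx']

theorem IsSmallPeriod.norm_div_pow_lt {z : CInfty Fq} (hz : IsSmallPeriod r κ z) (ν : ℕ) :
    ‖z / CInfty.theta Fq ^ (ν + 1)‖ <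
      baseRadius (Fintype.card Fq) r * (Fintype.card Fq : ℕ) := by
  refine lt_of_le_of_lt ?_ hz.norm_div_lt
  rw [pow_succ', ← div_div, norm_div _ (_ ^ ν), norm_pow, CInfty.norm_theta]
  refine div_le_self (norm_nonneg _) (one_le_pow₀ ?_)
  exact_mod_cast (Fintype.one_lt_card (α := Fq)).le

/-- The functional equation `(t - θ) f = κ_1 f^{(1)} + ⋯ + κ_r f^{(r)}` and its twists. -/
theorem IsSmallPeriod.isTwistSeq (hκ : ∀ i, 1 ≤ i → i ≤ r → ‖κ i‖ ≤ 1) {z : CInfty Fq}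
    (hz : IsSmallPeriod r κ z) : IsTwistSeq (Fintype.card Fq) (CInfty.theta Fq) κ r
      fun m => psTwist Fq m (agf r κ z) := by
  intro n
  have hcoeff : ∀ m ν : ℕ, (psTwist Fq m (agf r κ z)).coeff ν =
      expPhi r κ (z / CInfty.theta Fq ^ (ν + 1)) ^ Fintype.card Fq ^ m := by
    intro m ν
    rw [psTwist, PowerSeries.coeff_map, agf, PowerSeries.coeff_mk, twist_natCast]
  have hfe : ∀ ν : ℕ, expPhi r κ (z / CInfty.theta Fq ^ ν) ^ Fintype.card Fq ^ n =
      CInfty.theta Fq ^ Fintype.card Fq ^ n *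
        expPhi r κ (z / CInfty.theta Fq ^ (ν + 1)) ^ Fintype.card Fq ^ n +
      ∑ i ∈ Finset.range r, κ (i + 1) ^ Fintype.card Fq ^ n *
        expPhi r κ (z / CInfty.theta Fq ^ (ν + 1)) ^ Fintype.card Fq ^ (n + i + 1) := by
    intro ν
    have h := expPhi_theta_mul hκ (z / CInfty.theta Fq ^ (ν + 1))
    rw [pow_succ, mul_comm (CInfty.theta Fq), div_mul_eq_mul_div,
      mul_div_mul_right _ _ theta_ne_zero] at h
    rw [h, ← twist_natCast, map_add, map_mul, map_sum]
    simp only [twist_natCast, map_mul, ← pow_mul, ← pow_add]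
    rw [pow_succ (CInfty.theta Fq) ν]
    congr 1
    refine Finset.sum_congr rfl fun i _ => ?_
    rw [show i + 1 + n = n + i + 1 by omega]
  ext ν
  rw [map_sum, sub_mul, map_sub, PowerSeries.coeff_C_mul, hcoeff]
  simp only [PowerSeries.coeff_smul, smul_eq_mul, hcoeff]
  cases ν with
  -- `X * f` has no constant term, and the missing coefficient would be a power of `exp z`; it
  -- vanishes because `z` is a period.
  | zero =>
    rw [PowerSeries.coeff_zero_X_mul]
    have h := hfe 0
    rw [pow_zero, div_one, hz.expPhi_eq_zero,
      zero_pow (pow_ne_zero _ Fintype.card_ne_zero)] at h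
    rw [eq_sub_iff_add_eq', ← h]
  | succ ν => rw [PowerSeries.coeff_succ_X_mul, hcoeff, hfe (ν + 1), add_sub_cancel_left]

variable (r κ) in
/-- The series `∑ s_m f^{(m)}`, where `∑ s_m τ^m` is `logSeq` and `f` is the Anderson generating
function of `z`. -/
def logAgf (l : ℕ) (z : CInfty Fq) : PowerSeries (CInfty Fq) := PowerSeries.mk fun ν =>
  evq (Fintype.card Fq) (logSeq (Fintype.card Fq) (CInfty.theta Fq) κ r l)
    (expPhi r κ (z / CInfty.theta Fq ^ (ν + 1)))

theorem IsSmallPeriod.hasSum_logAgf (hr : 1 ≤ r) (hκ : ∀ i, 1 ≤ i → i ≤ r → ‖κ i‖ ≤ 1)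
    {z : CInfty Fq} (hz : IsSmallPeriod r κ z) {l : ℕ} (hl : l < r) (ν : ℕ) :
    HasSum (fun m : ℕ => logSeq (Fintype.card Fq) (CInfty.theta Fq) κ r l m *
      (psTwist Fq m (agf r κ z)).coeff ν) ((logAgf r κ l z).coeff ν) := by
  have hb : ‖expPhi r κ (z / CInfty.theta Fq ^ (ν + 1))‖ <
      baseRadius (Fintype.card Fq) r * (Fintype.card Fq : ℕ) := by
    rw [norm_expPhi hr hκ (hz.norm_div_pow_lt ν)]
    exact hz.norm_div_pow_lt ν
  have h := (summable_qterm Fintype.one_lt_card hb (norm_logSeq_le Fintype.one_lt_card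
    (CInfty.norm_theta Fq) hr hκ hl)).hasSum
  rw [logAgf, PowerSeries.coeff_mk]
  refine h.congr_fun fun m => ?_
  rw [psTwist, PowerSeries.coeff_map, agf, PowerSeries.coeff_mk, twist_natCast]

/-- Since `log` inverts `exp` at each `z / θ^{ν+1}`, the series is `∑ z t^ν / θ^{ν+1} = z / (θ -
t)`. -/
theorem IsSmallPeriod.mul_logAgf_zero (hr : 1 ≤ r) (hκ : ∀ i, 1 ≤ i → i ≤ r → ‖κ i‖ ≤ 1)
    {z : CInfty Fq} (hz : IsSmallPeriod r κ z) :
    (PowerSeries.X - PowerSeries.C (CInfty.theta Fq)) * logAgf r κ 0 z = -PowerSeries.C z := by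
  have hcoeff : ∀ ν, (logAgf r κ 0 z).coeff ν = z / CInfty.theta Fq ^ (ν + 1) := by
    intro ν
    rw [logAgf, PowerSeries.coeff_mk, expPhi_eq hκ]
    exact evq_logSeq_evq isExpSeq_expCoeff Fintype.one_lt_card (CInfty.norm_theta Fq) hr hκ
      twist_one_apply (hz.norm_div_pow_lt ν)
  have hθ0 := theta_ne_zero (Fq := Fq)
  ext ν
  rw [sub_mul, map_sub, PowerSeries.coeff_C_mul, hcoeff, map_neg, PowerSeries.coeff_C]
  cases ν with
  | zero =>
    rw [PowerSeries.coeff_zero_X_mul, if_pos rfl]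
    field_simp
    ring
  | succ ν =>
    rw [PowerSeries.coeff_succ_X_mul, hcoeff, if_neg (Nat.succ_ne_zero ν), neg_zero, sub_eq_zero]
    field_simp
    ring

/-- The coefficients are `-F (z / θ^{ν+1})`, and the functional equation of `F` cancels the twisted
generating function in every positive degree. In degree `0` the multiplication by `t` supplies
nothing, which leaves `F z`. -/
theorem IsSmallPeriod.mul_logAgf (hr : 1 ≤ r) (hκ : ∀ i, 1 ≤ i → i ≤ r → ‖κ i‖ ≤ 1)
    {z : CInfty Fq} (hz : IsSmallPeriod r κ z) {l : ℕ} (hl : l < r) (hl1 : l ≠ 0)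
    {F : CInfty Fq → CInfty Fq} (hF : IsQuasiPeriodic r κ l F) :
    (PowerSeries.X - PowerSeries.C (CInfty.theta Fq)) * logAgf r κ l z +
      psTwist Fq l (agf r κ z) = PowerSeries.C (F z) := by
  have hcoeff : ∀ ν, (logAgf r κ l z).coeff ν = -F (z / CInfty.theta Fq ^ (ν + 1)) := by
    intro ν
    rw [logAgf, PowerSeries.coeff_mk, expPhi_eq hκ]
    exact ((isQuasiPeriodic_iff hκ).1 hF).evq_logSeq_evq isExpSeq_expCoeff Fintype.one_lt_card
      (CInfty.norm_theta Fq) hr hκ twist_one_apply hl hl1 (hz.norm_div_pow_lt ν)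
  have hfe : ∀ ν, expPhi r κ (z / CInfty.theta Fq ^ (ν + 1)) ^ Fintype.card Fq ^ l =
      F (z / CInfty.theta Fq ^ ν) - CInfty.theta Fq * F (z / CInfty.theta Fq ^ (ν + 1)) := by
    intro ν
    rw [← hF.2, pow_succ, ← mul_div_assoc, mul_comm (CInfty.theta Fq),
      mul_div_mul_right _ _ theta_ne_zero]
  ext ν
  rw [sub_mul, map_add, map_sub, PowerSeries.coeff_C_mul, hcoeff, PowerSeries.coeff_C, psTwist,
    PowerSeries.coeff_map, agf, PowerSeries.coeff_mk, twist_natCast, hfe]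
  cases ν with
  | zero =>
    rw [PowerSeries.coeff_zero_X_mul, if_pos rfl, pow_zero, div_one]
    ring
  | succ ν =>
    rw [PowerSeries.coeff_succ_X_mul, hcoeff, if_neg (Nat.succ_ne_zero ν)]
    ring

end Periods

/-! ### The logarithm series of a `t`-module -/

section LogSeries

variable {Fq : Type*} [Field Fq] [Fintype Fq] {d : ℕ}

theorem mapMatrix_twist_pow (n : ℕ) (M : Matrix (Fin d) (Fin d) (CInfty Fq)) :
    ((twist Fq 1).mapMatrix ^ n) M = M.map (twist Fq n) := by
  have h : ((twist Fq 1).mapMatrix ^ n : Matrix (Fin d) (Fin d) (CInfty Fq) →+* _) M =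
      M.map (twist Fq 1 ^ n : CInfty Fq →+* CInfty Fq) := by
    induction n with
    | zero => ext; simp
    | succ n ih =>
      rw [pow_succ', RingHom.mul_def, RingHom.comp_apply, ih]
      ext i j
      simp [pow_succ']
  rw [h, twist_one_pow]

/-- `Log_G * ρ_θ = d[θ] * Log_G`. -/
theorem AndersonTModule.sum_logCoeff_mul_coeff (G : AndersonTModule Fq d) (n : ℕ) :
    ∑ i ∈ Finset.range (n + 1), G.logCoeff i * (G.coeff (n - i)).map (twist Fq i) =
      G.coeff 0 * G.logCoeff n := by
  set σ : Matrix (Fin d) (Fin d) (CInfty Fq) →+* Matrix (Fin d) (Fin d) (CInfty Fq) :=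
    (twist Fq 1).mapMatrix with hσ
  have hle : twistMul σ G.logCoeff G.expCoeff = Pi.single 0 1 := by
    funext n
    rw [twistMul_eq_sum_range]
    simp only [hσ, mapMatrix_twist_pow]
    rw [G.logCoeff_mul_expCoeff]
    split_ifs with h
    · subst h; simp
    · simp [h]
  have hexp : twistMul σ G.expCoeff (Pi.single 0 (G.coeff 0)) = twistMul σ G.coeff G.expCoeff := by
    funext n
    rw [twistMul_single_right, twistMul_eq_sum_range]
    simp only [hσ, mapMatrix_twist_pow]
    exact G.isExp_expCoeff.2 n
  -- `Log ρ_θ Exp = Log Exp d[θ] = d[θ] = d[θ] Log Exp`; cancel `Exp` on the right.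
  have hkey : twistMul σ G.logCoeff G.coeff = twistMul σ (Pi.single 0 (G.coeff 0)) G.logCoeff := by
    refine twistMul_right_cancel σ G.isExp_expCoeff.1 ?_
    rw [twistMul_assoc, ← hexp, ← twistMul_assoc, hle, twistMul_assoc, hle, twistMul_single_left,
      twistMul_single_left]
    funext n
    rcases Nat.eq_zero_or_pos n with rfl | h
    · simp
    · simp [h.ne']
  have h := congrFun hkey n
  rw [twistMul_single_left, twistMul_eq_sum_range] at h
  simp only [hσ, mapMatrix_twist_pow] at h
  exact h

variable {r k : ℕ} {κ : ℕ → CInfty Fq}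

theorem logCoeff_tensorModule_succ (n : ℕ) :
    (tensorModule r k κ).logCoeff (n + 1) * ((tensorModule r k κ).coeff 0).map (twist Fq (n + 1 : ℕ)) +
      (tensorModule r k κ).logCoeff n * ((tensorModule r k κ).coeff 1).map (twist Fq n) =
      (tensorModule r k κ).coeff 0 * (tensorModule r k κ).logCoeff (n + 1) := by
  have h := (tensorModule r k κ).sum_logCoeff_mul_coeff (n + 1)
  rw [Finset.sum_range_succ, Finset.sum_range_succ, Finset.sum_eq_zero, zero_add, Nat.sub_self,
    Nat.add_sub_cancel_left] at h
  · exact (add_comm _ _).trans h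
  · intro i hi
    rw [Finset.mem_range] at hi
    have h0 : (tensorModule r k κ).coeff (n + 1 - i) = 0 := by
      ext a b
      simp [tensorModule, show n + 1 - i ≠ 0 by omega, show n + 1 - i ≠ 1 by omega]
    rw [h0, Matrix.map_zero _ (map_zero _), mul_zero]

theorem map_tensorModule_coeff_zero (n : ℕ) (i j : Fin (r * k + 1)) :
    ((tensorModule r k κ).coeff 0).map (twist Fq n) i j =
      tensD (Fintype.card Fq) (CInfty.theta Fq) r n i j := by
  simp only [tensorModule, Matrix.map_apply, Matrix.of_apply, tensD, if_true, Fin.ext_iff]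
  split_ifs <;> simp [twist_natCast]

theorem map_tensorModule_coeff_one (n : ℕ) (i j : Fin (r * k + 1)) :
    ((tensorModule r k κ).coeff 1).map (twist Fq n) i j =
      tensA (Fintype.card Fq) κ r k n i j := by
  simp only [tensorModule, Matrix.map_apply, Matrix.of_apply, tensA, one_ne_zero, if_true, if_false]
  split_ifs <;> simp [twist_natCast]

variable (r k κ) in
/-- The entries of a row of the logarithm series of the tensor product. -/
def logEntry (i : Fin (r * k + 1)) (n j : ℕ) : CInfty Fq :=
  if h : j < r * k + 1 then (tensorModule r k κ).logCoeff n i ⟨j, h⟩ else 0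

theorem logEntry_val (i j : Fin (r * k + 1)) (n : ℕ) :
    logEntry r k κ i n j = (tensorModule r k κ).logCoeff n i j := dif_pos j.2

/-- By `hir` the row is one of the last `r`, where `d[θ]` has only its diagonal entry; left
multiplication by `d[θ]` is then multiplication by `θ`, and no other row enters. -/
theorem isLogRow_logEntry {l : ℕ} (i : Fin (r * k + 1)) (hir : r * k < i + r)
    (hi : (i : ℕ) = if l = 0 then r * k else r * (k - 1) + l) :
    IsLogRow (Fintype.card Fq) (CInfty.theta Fq) κ r k l (logEntry r k κ i) := by
  refine ⟨fun j hj => ?_, fun n j hj => ?_⟩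
  · rw [← hi, logEntry, dif_pos (Nat.lt_succ_of_le hj), AndersonTModule.logCoeff, if_pos rfl,
      Matrix.one_apply]
    simp only [Fin.ext_iff, eq_comm]
  · have h := congrFun (congrFun (logCoeff_tensorModule_succ (r := r) (k := k) (κ := κ) n) i)
      ⟨j, Nat.lt_succ_of_le hj⟩
    have hrhs : ((tensorModule r k κ).coeff 0 * (tensorModule r k κ).logCoeff (n + 1)) i
        ⟨j, Nat.lt_succ_of_le hj⟩ = CInfty.theta Fq * logEntry r k κ i (n + 1) j := by
      rw [Matrix.mul_apply, Finset.sum_eq_single i]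
      · rw [logEntry, dif_pos (Nat.lt_succ_of_le hj)]
        simp [tensorModule]
      · intro b _ hb
        have h1 : (tensorModule r k κ).coeff 0 i b = 0 := by
          simp only [tensorModule, Matrix.of_apply, if_true]
          rw [if_neg (fun h => hb h.symm), if_neg (by have := b.2; omega)]
        rw [h1, zero_mul]
      · simp
    rw [hrhs, Matrix.add_apply, Matrix.mul_apply, Matrix.mul_apply] at h
    simp only [map_tensorModule_coeff_zero, map_tensorModule_coeff_one] at h
    rw [← h, ← Fin.sum_univ_eq_sum_range (fun i' => logEntry r k κ i (n + 1) i' *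
      tensD (Fintype.card Fq) (CInfty.theta Fq) r (n + 1) i' j),
      ← Fin.sum_univ_eq_sum_range (fun i' => logEntry r k κ i n i' *
      tensA (Fintype.card Fq) κ r k n i' j)]
    simp only [logEntry_val]

end LogSeries

/-! ### The map `φ_tens` -/

section PhiTens

open Filter Topology

variable {Fq : Type*} [Field Fq] [Fintype Fq] {r k : ℕ} {κ : ℕ → CInfty Fq}

theorem phiTensTerm_eq_rowTerm (a : Fin (r * k + 1) → ℕ → CInfty Fq) (μ : Fin r) (ν : ℕ) :
    phiTensTerm r k κ a μ ν =
      rowTerm (fun n (l : Fin (r * k + 1)) => tensRow r k κ n l) a μ ν := rfl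

theorem mem_MTens_iff {a : Fin (r * k + 1) → ℕ → CInfty Fq} : a ∈ MTens Fq r k ↔
    ∀ l : Fin (r * k + 1), Tendsto (fun n => ‖a l n‖ *
      motWeight (Fintype.card Fq) r k (l / r) ^ Fintype.card Fq ^ n) atTop (𝓝 0) := by
  simp only [MTens, Set.mem_ofPred_eq, tensWeight_eq]

theorem gaussLe_tensRow_fin (hr : 1 ≤ r) (hκ : ∀ i, 1 ≤ i → i ≤ r → ‖κ i‖ ≤ 1) (hκr : ‖κ r‖ = 1)
    (μ : Fin r) (n : ℕ) (l : Fin (r * k + 1)) : GaussLe 1 (tensRow r k κ n l μ)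
      (motWeight (Fintype.card Fq) r k (l / r) ^ Fintype.card Fq ^ n) :=
  gaussLe_tensRow hr hκ hκr n (Nat.le_of_lt_succ l.2) μ

theorem summable_phiTensTerm (hr : 1 ≤ r) (hκ : ∀ i, 1 ≤ i → i ≤ r → ‖κ i‖ ≤ 1) (hκr : ‖κ r‖ = 1)
    {a : Fin (r * k + 1) → ℕ → CInfty Fq} (ha : a ∈ MTens Fq r k) (μ : Fin r) (ν : ℕ) :
    Summable (phiTensTerm r k κ a μ ν) :=
  summable_rowTerm (fun l : Fin (r * k + 1) => motWeight_pos Fintype.one_lt_card hr k (l / r)) μ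
    (gaussLe_tensRow_fin hr hκ hκr μ) (mem_MTens_iff.1 ha) ν

theorem phiTens_mem_tateAlgebra (hr : 1 ≤ r) (hκ : ∀ i, 1 ≤ i → i ≤ r → ‖κ i‖ ≤ 1)
    (hκr : ‖κ r‖ = 1) {a : Fin (r * k + 1) → ℕ → CInfty Fq} (ha : a ∈ MTens Fq r k) (μ : Fin r) :
    phiTens r k κ a μ ∈ tateAlgebra Fq := by
  have h := tendsto_norm_tsum_rowTerm
    (fun l : Fin (r * k + 1) => motWeight_pos (Fintype.one_lt_card (α := Fq)) hr k (l / r)) μ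
    (gaussLe_tensRow_fin hr hκ hκr μ) (mem_MTens_iff.1 ha)
  simpa only [tateAlgebra, phiTens, phiTensTerm_eq_rowTerm, Set.mem_ofPred_eq, PowerSeries.coeff_mk] using h

theorem norm_coeff_phiTens_le (hr : 1 ≤ r) (hκ : ∀ i, 1 ≤ i → i ≤ r → ‖κ i‖ ≤ 1)
    (hκr : ‖κ r‖ = 1) {a : Fin (r * k + 1) → ℕ → CInfty Fq} {B : ℝ}
    (hB : ∀ (l : Fin (r * k + 1)) (n : ℕ),
      ‖a l n‖ * tensWeight Fq r k (l / r) ^ Fintype.card Fq ^ n ≤ B) (μ : Fin r) (ν : ℕ) :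
    ‖(phiTens r k κ a μ).coeff ν‖ ≤ B := by
  simp only [tensWeight_eq] at hB
  have h0 : 0 ≤ B := (mul_nonneg (norm_nonneg _) (pow_nonneg
    (motWeight_pos Fintype.one_lt_card hr k _).le _)).trans (hB 0 0)
  rw [phiTens, PowerSeries.coeff_mk]
  exact norm_tsum_rowTerm_le (v := fun l : Fin (r * k + 1) => motWeight (Fintype.card Fq) r k (l / r))
    μ (gaussLe_tensRow_fin hr hκ hκr μ) h0 hB ν

theorem motRow_eq (hκr : ‖κ r‖ = 1) (n l : ℕ) (μ : Fin r) :
    motRow (Fintype.card Fq) (CInfty.theta Fq) r k (motSeq r κ) n l μ =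
      ∑ i, twistedV r κ i μ • tensRow r k κ n l i := by
  simp only [tensRow_eq, Finset.smul_sum, smul_smul]
  rw [Finset.sum_comm]
  have h1 := Matrix.nonsing_inv_mul _ (isUnit_det_twistedV hκr)
  have h2 : ∀ j, ∑ i, (twistedV r κ i μ * (twistedV r κ)⁻¹ j i) •
      motRow (Fintype.card Fq) (CInfty.theta Fq) r k (motSeq r κ) n l j =
      (1 : Matrix (Fin r) (Fin r) (CInfty Fq)) j μ •
        motRow (Fintype.card Fq) (CInfty.theta Fq) r k (motSeq r κ) n l j := by
    intro j
    rw [← Finset.sum_smul, ← h1, Matrix.mul_apply]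
    simp only [mul_comm]
  simp only [h2, Matrix.one_apply, ite_smul, one_smul, zero_smul, Finset.sum_ite_eq',
    Finset.mem_univ, if_true]

theorem hasSum_rowTerm_motRow (hr : 1 ≤ r) (hκ : ∀ i, 1 ≤ i → i ≤ r → ‖κ i‖ ≤ 1) (hκr : ‖κ r‖ = 1)
    {a : Fin (r * k + 1) → ℕ → CInfty Fq} (ha : a ∈ MTens Fq r k) (μ : Fin r) (ν : ℕ) :
    HasSum (rowTerm (fun n (l : Fin (r * k + 1)) =>
      motRow (Fintype.card Fq) (CInfty.theta Fq) r k (motSeq r κ) n l) a μ ν)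
      ((∑ i, phiTens r k κ a i * PowerSeries.C (twistedV r κ i μ)).coeff ν) := by
  have h := hasSum_sum fun (i : Fin r) (_ : i ∈ Finset.univ) =>
    (summable_phiTensTerm hr hκ hκr ha i ν).hasSum.mul_right (twistedV r κ i μ)
  simp only [map_sum, PowerSeries.coeff_mul_C, phiTens, PowerSeries.coeff_mk]
  refine h.congr_fun fun n => ?_
  simp only [rowTerm, motRow_eq hκr, phiTensTerm, Polynomial.finsetSum_coeff, Polynomial.coeff_smul,
    smul_eq_mul, Finset.mul_sum, Finset.sum_mul]
  rw [Finset.sum_comm]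
  refine Finset.sum_congr rfl fun i _ => Finset.sum_congr rfl fun l _ => ?_
  ring

theorem sub_mem_MTens {a b : Fin (r * k + 1) → ℕ → CInfty Fq} (hr : 1 ≤ r) (ha : a ∈ MTens Fq r k)
    (hb : b ∈ MTens Fq r k) : a - b ∈ MTens Fq r k := by
  rw [mem_MTens_iff] at ha hb ⊢
  intro l
  have h := (ha l).add (hb l)
  rw [add_zero] at h
  have hw := fun n : ℕ => pow_nonneg
    (motWeight_pos (Fintype.one_lt_card (α := Fq)) hr k (l / r)).le (Fintype.card Fq ^ n)
  refine squeeze_zero (fun n => mul_nonneg (norm_nonneg _) (hw n)) (fun n => ?_) h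
  rw [← add_mul]
  exact mul_le_mul_of_nonneg_right (norm_sub_le _ _) (hw n)

/-- Multiplication by the constant matrix `twistedV` returns to the basis `m`, where the coordinate
argument applies to `a - b`. -/
theorem injOn_phiTens (hr : 1 ≤ r) (hk : 1 ≤ k) (hκ : ∀ i, 1 ≤ i → i ≤ r → ‖κ i‖ ≤ 1)
    (hκr : ‖κ r‖ = 1) : Set.InjOn (phiTens r k κ) (MTens Fq r k) := by
  intro a ha b hb hab
  have hκr0 : κ r ≠ 0 := by rw [← norm_ne_zero_iff, hκr]; exact one_ne_zero
  rw [← sub_eq_zero]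
  refine eq_zero_of_tsum_rowTerm_eq_zero (isMotiveSeq_motSeq hr hκr0) Fintype.one_lt_card
    (CInfty.norm_theta Fq) hr hk hκ hκr (mem_MTens_iff.1 (sub_mem_MTens hr ha hb)) fun μ ν => ?_
  have h := (hasSum_rowTerm_motRow hr hκ hκr ha μ ν).sub (hasSum_rowTerm_motRow hr hκ hκr hb μ ν)
  rw [hab, sub_self] at h
  refine h.congr_fun fun n => ?_
  simp only [rowTerm, Pi.sub_apply, sub_mul, Finset.sum_sub_distrib]

end PhiTens

/-! ### The matrices `Υ` and `Ψ` -/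

section RigidAnalyticTrivialisation

variable {Fq : Type*} [Field Fq] [Fintype Fq] {r k l : ℕ} {κ : ℕ → CInfty Fq}
  {lam ξ : Fin r → CInfty Fq}

/-- A power series is a unit as soon as its constant term is; since `exp (lam j / θ) = ξ j`, the
constant terms form the Moore matrix of `ξ`. -/
theorem isUnit_det_Upsilon (hξ : LinearIndependent Fq ξ)
    (hlam : ∀ j, expPhi r κ (lam j / CInfty.theta Fq) = ξ j) : IsUnit (Upsilon r κ lam).det := by
  rw [PowerSeries.isUnit_iff_constantCoeff, RingHom.map_det, isUnit_iff_ne_zero]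
  have h : (PowerSeries.constantCoeff (R := CInfty Fq)).mapMatrix (Upsilon r κ lam) =
      Matrix.of fun i j : Fin r => ξ j ^ Fintype.card Fq ^ (i : ℕ) := by
    ext i j : 2
    rw [RingHom.mapMatrix_apply, Matrix.map_apply, Upsilon, Matrix.of_apply, Matrix.of_apply, psTwist,
      ← PowerSeries.coeff_zero_eq_constantCoeff_apply, PowerSeries.coeff_map, agf,
      PowerSeries.coeff_mk, twist_natCast, zero_add, pow_one, hlam]
  rw [h]
  exact det_moore_ne_zero hξ

theorem psTwist_neg_psTwist (i : ℤ) (f : PowerSeries (CInfty Fq)) :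
    psTwist Fq (-i) (psTwist Fq i f) = f := by
  ext ν
  simp [psTwist, PowerSeries.coeff_map, twist_neg_twist]

/-- By definition `Ψ (Υ^{(1)})^tr V = 1`; transpose this and twist by `-1`. -/
theorem twistedV_mul_Upsilon_mul_Psi (hκr : ‖κ r‖ = 1) (hΥ : IsUnit (Upsilon r κ lam).det) :
    ((twistedV r κ).map (PowerSeries.C (R := CInfty Fq)) * Upsilon r κ lam) *
      (Psi r κ lam).transpose.map (psTwist Fq (-1)) = 1 := by
  set A : Matrix (Fin r) (Fin r) (PowerSeries (CInfty Fq)) :=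
    (matV r κ).map (PowerSeries.C (R := CInfty Fq)) with hA
  set B := ((Upsilon r κ lam).map (psTwist Fq 1)).transpose with hB
  have hV : IsUnit (matV r κ).det := by
    rw [isUnit_iff_ne_zero, ← norm_ne_zero_iff, norm_det_matV hκr]
    exact one_ne_zero
  have hA1 : IsUnit A.det := by
    have h := hV.map (PowerSeries.C (R := CInfty Fq))
    rwa [RingHom.map_det] at h
  have hB1 : IsUnit B.det := by
    have h := hΥ.map (psTwist Fq 1)
    rw [RingHom.map_det] at h
    rw [hB, Matrix.det_transpose]
    exact h
  have h1 : Psi r κ lam * (B * A) = 1 := by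
    rw [Psi, ← hA, ← hB, Matrix.mul_assoc, ← Matrix.mul_assoc B⁻¹, Matrix.nonsing_inv_mul _ hB1,
      Matrix.one_mul, Matrix.nonsing_inv_mul _ hA1]
  have h2 := congrArg (fun M => (psTwist Fq (-1)).mapMatrix M.transpose) h1
  simp only [Matrix.transpose_mul, Matrix.transpose_one, map_mul, map_one,
    RingHom.mapMatrix_apply] at h2
  rw [← h2]
  congr 2
  · ext i j : 2
    simp only [twistedV, hA, Matrix.map_apply, Matrix.transpose_apply, psTwist, PowerSeries.map_C]
  · ext i j : 2
    simp only [hB, Matrix.map_apply, Matrix.transpose_apply, psTwist_neg_psTwist]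

/-- Solving for a row vector `φ` with `(t - θ) φ W Υ = g w`. -/
theorem mul_apply_eq_mul_rowPsi (hκr : ‖κ r‖ = 1) (hΥ : IsUnit (Upsilon r κ lam).det)
    {φ : Fin r → PowerSeries (CInfty Fq)} {w : Fin r → CInfty Fq} {b g : PowerSeries (CInfty Fq)}
    (h : ∀ j, b * ∑ μ, (∑ i, φ i * PowerSeries.C (twistedV r κ i μ)) * Upsilon r κ lam μ j =
      g * PowerSeries.C (w j)) (μ : Fin r) : b * φ μ = g * rowPsi r κ lam w μ := by
  have h1 : b • Matrix.vecMul φ ((twistedV r κ).map (PowerSeries.C (R := CInfty Fq)) *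
      Upsilon r κ lam) = g • fun j => PowerSeries.C (w j) := by
    rw [← Matrix.vecMul_vecMul]
    exact funext h
  have h2 := congrArg (fun v => Matrix.vecMul v ((Psi r κ lam).transpose.map (psTwist Fq (-1)))) h1
  simp only [Matrix.smul_vecMul, Matrix.vecMul_vecMul] at h2
  rw [twistedV_mul_Upsilon_mul_Psi hκr hΥ, Matrix.vecMul_one] at h2
  exact congrFun h2 μ

theorem rowPsi_neg (w : Fin r → CInfty Fq) (μ : Fin r) :
    rowPsi r κ lam (fun i => -w i) μ = -rowPsi r κ lam w μ := by
  have h : (fun i => PowerSeries.C (-w i)) = -fun i => PowerSeries.C (w i) :=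
    funext fun i => map_neg _ _
  rw [rowPsi, rowPsi, h, Matrix.neg_vecMul, Pi.neg_apply]

end RigidAnalyticTrivialisation

/-! ### Rows of the logarithm series as images under `𝓜_tens` -/

section LogCoordinates

variable {Fq : Type*} [Field Fq] [Fintype Fq] {r k l : ℕ} {κ : ℕ → CInfty Fq}
  {lam ξ : Fin r → CInfty Fq}

theorem eq_mul_inv_mul_of_mul_eq {K : Type*} [Field K] {b f g h c : PowerSeries K}
    (hb : PowerSeries.constantCoeff b ≠ 0) (H : b * f = c * g⁻¹ * h) : f = c * (g * b)⁻¹ * h := by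
  rw [PowerSeries.mul_inv_rev]
  calc f = b⁻¹ * (b * f) := by rw [← mul_assoc, PowerSeries.inv_mul_cancel _ hb, one_mul]
    _ = c * (b⁻¹ * g⁻¹) * h := by rw [H]; ring

variable (r k κ) in
/-- The `i`-th row of the logarithm series of the tensor product. -/
def logSeriesRow (i : Fin (r * k + 1)) (l : Fin (r * k + 1)) (n : ℕ) : CInfty Fq :=
  (tensorModule r k κ).logCoeff n i l

theorem logSeriesRow_mem_MTens (hr : 1 ≤ r) (hk : 1 ≤ k) (hκ : ∀ i, 1 ≤ i → i ≤ r → ‖κ i‖ ≤ 1)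
    (hl : l < r) (i : Fin (r * k + 1)) (hir : r * k < i + r)
    (hi : (i : ℕ) = if l = 0 then r * k else r * (k - 1) + l) :
    logSeriesRow r k κ i ∈ MTens Fq r k := by
  rw [mem_MTens_iff]
  intro j
  have h := (isLogRow_logEntry (κ := κ) i hir hi).tendsto Fintype.one_lt_card (CInfty.norm_theta Fq)
    hr hk hκ hl (Nat.le_of_lt_succ j.2)
  simp only [logEntry_val] at h
  exact h

/-- The images under `φ_tens` of the last rows of the logarithm series. -/
theorem mul_phiTens_logSeriesRow (hr : 1 ≤ r) (hk : 1 ≤ k)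
    (hκ : ∀ i, 1 ≤ i → i ≤ r → ‖κ i‖ ≤ 1) (hκr : ‖κ r‖ = 1) {η : CInfty Fq} (hη : η ≠ 0)
    (hξ : LinearIndependent Fq ξ) (hlam : ∀ j, IsSmallPeriod r κ (lam j))
    (hlamξ : ∀ j, expPhi r κ (lam j / CInfty.theta Fq) = ξ j)
    (hl : l < r) (i : Fin (r * k + 1)) (hir : r * k < i + r)
    (hi : (i : ℕ) = if l = 0 then r * k else r * (k - 1) + l) {w : Fin r → CInfty Fq}
    (hw : ∀ j, (PowerSeries.X - PowerSeries.C (CInfty.theta Fq)) * logAgf r κ l (lam j) +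
      (if l = 0 then 0 else psTwist Fq l (agf r κ (lam j))) = PowerSeries.C (w j)) (μ : Fin r) :
    (PowerSeries.X - PowerSeries.C (CInfty.theta Fq)) * phiTens r k κ (logSeriesRow r k κ i) μ =
      PowerSeries.C ((-carlitzPeriod η) ^ k) * (omegaC η ^ k)⁻¹ * rowPsi r κ lam w μ := by
  have hκr0 : κ r ≠ 0 := by rw [← norm_ne_zero_iff, hκr]; exact one_ne_zero
  have hmem := logSeriesRow_mem_MTens hr hk hκ hl i hir hi
  refine mul_apply_eq_mul_rowPsi hκr (isUnit_det_Upsilon hξ hlamξ) (fun j => ?_) μ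
  rw [← hw j]
  refine (isLogRow_logEntry (κ := κ) i hir hi).pairing Fintype.one_lt_card (CInfty.norm_theta Fq)
    hr hk hl hκr0 (isMotiveSeq_motSeq hr hκr0) ((hlam j).isTwistSeq hκ) (fun μ ν => ?_)
    (tendsto_period_factor hη k) ((hlam j).hasSum_logAgf hr hκ hl)
  have h := hasSum_rowTerm_motRow hr hκ hκr hmem μ ν
  simp only [logEntry_val]
  exact h

theorem mellinTens_eq (hinj : Set.InjOn (phiTens r k κ) (MTens Fq r k))
    {a : Fin (r * k + 1) → ℕ → CInfty Fq} (ha : a ∈ MTens Fq r k)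
    {f : Fin r → PowerSeries (CInfty Fq)} (hf : phiTens r k κ a = f) : mellinTens r k κ f = a := by
  rw [← hf]
  exact hinj.leftInvOn_invFunOn ha

theorem hasSum_deltaOneTerm {z : Fin (r * k + 1) → CInfty Fq}
    (hz : z ∈ (tensorModule r k κ).logDomain) (i : Fin (r * k + 1)) :
    HasSum (deltaOneTerm z (logSeriesRow r k κ i)) ((tensorModule r k κ).log z i) := by
  have h : Summable fun n : ℕ => ((tensorModule r k κ).logCoeff n).mulVec fun i => twist Fq n (z i) := hz
  refine (Pi.hasSum.1 h.hasSum i).congr_fun fun n => ?_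
  simp only [deltaOneTerm, logSeriesRow, Matrix.mulVec, dotProduct, twist_natCast]

theorem log_coordinate (hinj : Set.InjOn (phiTens r k κ) (MTens Fq r k)) (i : Fin (r * k + 1))
    (ha : logSeriesRow r k κ i ∈ MTens Fq r k) {f : Fin r → PowerSeries (CInfty Fq)}
    (hf : phiTens r k κ (logSeriesRow r k κ i) = f) :
    f ∈ phiTens r k κ '' MTens Fq r k ∧
      (fun l n => (tensorModule r k κ).logCoeff n i l) = mellinTens r k κ f ∧
      ∀ z ∈ (tensorModule r k κ).logDomain, Summable (deltaOneTerm z (mellinTens r k κ f)) ∧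
        (tensorModule r k κ).log z i = mellinTensAt r k κ z f := by
  have h := mellinTens_eq hinj ha hf
  refine ⟨⟨_, ha, hf⟩, h.symm, fun z hz => ?_⟩
  have hs := hasSum_deltaOneTerm hz i
  rw [mellinTensAt, deltaOne, h]
  exact ⟨hs.summable, hs.tsum_eq.symm⟩

theorem norm_algebraMap_eq_one {c : Fq} (hc : c ≠ 0) : ‖algebraMap Fq (CInfty Fq) c‖ = 1 := by
  have h := congrArg norm (congrArg (algebraMap Fq (CInfty Fq)) (FiniteField.pow_card_sub_one_eq_one c hc))
  rw [map_pow, map_one, norm_pow, norm_one] at h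
  have hq : 1 < Fintype.card Fq := Fintype.one_lt_card
  exact (pow_eq_one_iff_of_nonneg (norm_nonneg _) (by omega)).1 h

end LogCoordinates

end TModuleLog

end

/-! ### The main theorem -/

theorem theorem1p5 {Fq : Type*} [Field Fq] [Fintype Fq] (r k : ℕ) (hr : 1 ≤ r) (hk : 1 ≤ k)
    (κ : ℕ → TModuleLog.CInfty Fq)
    (hκ : ∀ i, 1 ≤ i → i < r → ‖κ i‖ ≤ 1)
    (hκr : ∃ c : Fq, c ≠ 0 ∧ κ r = algebraMap Fq (TModuleLog.CInfty Fq) c)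
    (η : TModuleLog.CInfty Fq) (hη : η ^ (Fintype.card Fq - 1) = -TModuleLog.CInfty.theta Fq)
    (ξ : Fin r → TModuleLog.CInfty Fq) (hξ : LinearIndependent Fq ξ)
    (hξspan : (Submodule.span Fq (Set.range ξ) : Set (TModuleLog.CInfty Fq)) =
      TModuleLog.thetaTorsion r κ)
    (lam : Fin r → TModuleLog.CInfty Fq)
    (hlam : ∀ i, lam i = TModuleLog.CInfty.theta Fq * TModuleLog.logPhi r κ (ξ i)) :
    -- the functions `F_{τ^l}` are well defined
    (∀ l, 1 ≤ l → l < r → ∃! F, TModuleLog.IsQuasiPeriodic r κ l F) ∧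
    -- `φ_tens : 𝕄_tens → Mat_{1 × r}(𝕋)` is well defined, bounded and injective
    (∀ a ∈ TModuleLog.MTens Fq r k,
      (∀ μ ν, Summable (TModuleLog.phiTensTerm r k κ a μ ν)) ∧
      (∀ μ, TModuleLog.phiTens r k κ a μ ∈ TModuleLog.tateAlgebra Fq) ∧
      ∀ B : ℝ, (∀ (l : Fin (r * k + 1)) (n : ℕ),
          ‖a l n‖ * TModuleLog.tensWeight Fq r k (l / r) ^ Fintype.card Fq ^ n ≤ B) →
        ∀ μ ν, ‖(TModuleLog.phiTens r k κ a μ).coeff ν‖ ≤ B) ∧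
    Set.InjOn (TModuleLog.phiTens r k κ) (TModuleLog.MTens Fq r k) ∧
    -- the coordinate `r k + 1` of the logarithm series, and of its values
    (TModuleLog.periodImage r k κ η lam ∈
        TModuleLog.phiTens r k κ '' TModuleLog.MTens Fq r k ∧
      (fun l n => (TModuleLog.tensorModule r k κ).logCoeff n (Fin.last (r * k)) l) =
        TModuleLog.mellinTens r k κ (TModuleLog.periodImage r k κ η lam) ∧
      ∀ z ∈ (TModuleLog.tensorModule r k κ).logDomain,
        Summable (TModuleLog.deltaOneTerm z
          (TModuleLog.mellinTens r k κ (TModuleLog.periodImage r k κ η lam))) ∧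
        (TModuleLog.tensorModule r k κ).log z (Fin.last (r * k)) =
          TModuleLog.mellinTensAt r k κ z (TModuleLog.periodImage r k κ η lam)) ∧
    -- the coordinates `r k + 2 - j` for `2 ≤ j ≤ r`, with index `r k + 1 - j` counted from `0`
    ∀ (j : ℕ) (hj : 2 ≤ j) (hjr : j ≤ r) (F : TModuleLog.CInfty Fq → TModuleLog.CInfty Fq),
      TModuleLog.IsQuasiPeriodic r κ (r + 1 - j) F →
        TModuleLog.quasiPeriodImage r k κ η lam F ∈
            TModuleLog.phiTens r k κ '' TModuleLog.MTens Fq r k ∧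
          (fun l n => (TModuleLog.tensorModule r k κ).logCoeff n ⟨r * k + 1 - j, by omega⟩ l) =
            TModuleLog.mellinTens r k κ (TModuleLog.quasiPeriodImage r k κ η lam F) ∧
          ∀ z ∈ (TModuleLog.tensorModule r k κ).logDomain,
            Summable (TModuleLog.deltaOneTerm z
              (TModuleLog.mellinTens r k κ (TModuleLog.quasiPeriodImage r k κ η lam F))) ∧
            (TModuleLog.tensorModule r k κ).log z ⟨r * k + 1 - j, by omega⟩ =
              TModuleLog.mellinTensAt r k κ z (TModuleLog.quasiPeriodImage r k κ η lam F) := by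
  have hq : 1 < Fintype.card Fq := Fintype.one_lt_card
  obtain ⟨c, hc, hκrc⟩ := hκr
  have hκr : ‖κ r‖ = 1 := by rw [hκrc]; exact TModuleLog.norm_algebraMap_eq_one hc
  -- A nonzero constant of `F_q` has norm `1`, so the bound on the coefficients extends to `i = r`.
  replace hκ : ∀ i, 1 ≤ i → i ≤ r → ‖κ i‖ ≤ 1 := by
    intro i h1 h2
    rcases h2.lt_or_eq with h | rfl
    · exact hκ i h1 h
    · exact hκr.le
  have hη0 := TModuleLog.ne_zero_of_pow_eq_neg_theta hη
  have hper : ∀ j, TModuleLog.IsSmallPeriod r κ (lam j) ∧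
      TModuleLog.expPhi r κ (lam j / TModuleLog.CInfty.theta Fq) = ξ j := by
    intro j
    refine TModuleLog.isSmallPeriod_of_mem_thetaTorsion hr hκ hκr ?_ (hlam j)
    rw [← hξspan]
    exact Submodule.subset_span (Set.mem_range_self j)
  have hinj := TModuleLog.injOn_phiTens hr hk hκ hκr
  have hrk : r * (k - 1) + r = r * k := by
    rw [← Nat.mul_succ, Nat.succ_eq_add_one, Nat.sub_add_cancel hk]
  refine ⟨fun l hl1 hl => ?_, fun a ha => ⟨TModuleLog.summable_phiTensTerm hr hκ hκr ha,
    TModuleLog.phiTens_mem_tateAlgebra hr hκ hκr ha, fun B hB =>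
      TModuleLog.norm_coeff_phiTens_le hr hκ hκr hB⟩, hinj, ?_, fun j hj hjr F hF => ?_⟩
  · simp only [TModuleLog.isQuasiPeriodic_iff hκ]
    exact TModuleLog.existsUnique_isQuasiPeriodicFor TModuleLog.isExpSeq_expCoeff hq
      (TModuleLog.CInfty.norm_theta Fq) hκ TModuleLog.twist_one_apply hl (by omega)
  · have hir : r * k < (Fin.last (r * k) : ℕ) + r := by rw [Fin.val_last]; omega
    have hi : (Fin.last (r * k) : ℕ) = if 0 = 0 then r * k else r * (k - 1) + 0 := by simp
    refine TModuleLog.log_coordinate hinj _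
      (TModuleLog.logSeriesRow_mem_MTens hr hk hκ hr _ hir hi) (funext fun μ => ?_)
    -- Division by `θ - t` is legitimate because its constant term `θ` is nonzero.
    refine TModuleLog.eq_mul_inv_mul_of_mul_eq (by simp [TModuleLog.theta_ne_zero]) ?_
    have h := TModuleLog.mul_phiTens_logSeriesRow hr hk hκ hκr hη0 hξ (fun j => (hper j).1)
      (fun j => (hper j).2) hr _ hir hi (w := fun j => -lam j) (fun j => by
        rw [(hper j).1.mul_logAgf_zero hr hκ, if_pos rfl, add_zero, map_neg]) μ
    rw [TModuleLog.rowPsi_neg, mul_neg] at h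
    -- The right-hand side `-λ` and the factor `θ - t` in place of `t - θ` contribute two signs,
    -- which cancel.
    rw [← neg_sub, neg_mul, h, neg_neg]
  · have hir : r * k < ((⟨r * k + 1 - j, by omega⟩ : Fin (r * k + 1)) : ℕ) + r := by
      simp only
      omega
    -- The index `l = r + 1 - j` of the quasi-periodic function is nonzero since `j ≤ r`, and `r (k
    -- - 1) + l` is the row counted from `0`.
    have hi : ((⟨r * k + 1 - j, by omega⟩ : Fin (r * k + 1)) : ℕ) =
        if r + 1 - j = 0 then r * k else r * (k - 1) + (r + 1 - j) := by
      rw [if_neg (by omega)]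
      simp only
      omega
    have hl : r + 1 - j < r := by omega
    refine TModuleLog.log_coordinate hinj _
      (TModuleLog.logSeriesRow_mem_MTens hr hk hκ hl _ hir hi) (funext fun μ => ?_)
    refine TModuleLog.eq_mul_inv_mul_of_mul_eq (by simp [TModuleLog.theta_ne_zero]) ?_
    exact TModuleLog.mul_phiTens_logSeriesRow hr hk hκ hκr hη0 hξ (fun j => (hper j).1)
      (fun j => (hper j).2) hl _ hir hi (fun i => by
        rw [if_neg (by omega)]
        exact (hper i).1.mul_logAgf hr hκ hl (by omega) hF) μ
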